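/- **Setup.** Let $p,q\in\mathbb C$ with $|p|<1$ and $q\neq 0$. For $u\in\mathbb C\setminus\{0\}$ and integers $k\ge 0$ put $$\theta(u)=\prod_{j=0}^\infty(1-p^ju)(1-p^{j+1}/u),\qquad (u)_k=\theta(u)\theta(qu)\cdots\theta(q^{k-1}u),\qquad (u_1,\dots,u_m)_k=(u_1)_k\cdots(u_m)_k .$$ For $z=(z_1,\dots,z_n)$ and $x=(x_1,\dots,x_n)\in\mathbb Z_{\ge0}^n$ write $Z=z_1\cdots z_n$, $|x|=x_1+\dots+x_n$ and $$\frac{\Delta(zq^x)}{\Delta(z)}=\prod_{1\le i<j\le n}\frac{q^{x_i}\theta(q^{x_j-x_i}z_j/z_i)}{\theta(z_j/z_i)} .$$ **Theorem 4.1.** Let $n,N\ge 0$ be integers and let $a,b,c,d,e,f,g,z_1,\dots,z_n$ be nonzero complex numbers with $$a^3q^{N+2}=bcdefg\,z_1^2\cdots z_n^2 ,\qquad \lambda=\frac{a^2q}{bcd}.$$ Assume that $\theta(z_j/z_i)\ne0$ for $i<j$, that $\theta(az_i)\ne0$ for all $i$, that $\theta(\lambda)\ne0$, and that none of the following vanishes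 (for all $i,j$, and all $x$ with $|x|\le N$): $$(aq/c,aq/d,aq/e,aq/f,aq/g,\lambda q,\lambda q^{N+1})_N,\quad (aq/z_i,\,aq^{N+1}z_i,\,aqz_i/b)_N,\quad (qz_i/z_j)_N,\quad \Big(\frac{\lambda b}{az_i}\Big)_{|x|-x_i},$$ and, for $n$ odd, $\big(q^{-N}Z/a,\tfrac{\lambda q}{eZ},\tfrac{\lambda q}{fZ},\tfrac{\lambda q}{gZ}\big)_N$, respectively, for $n$ even, $\big(\tfrac{\lambda q}{Z},\tfrac{\lambda q}{efZ},\tfrac{\lambda q}{egZ},\tfrac{\lambda q}{fgZ}\big)_N$. (That is, all denominators below are nonzero.) Then $$\begin{aligned} &\sum_{\substack{x_1,\dots,x_n\ge0\\ x_1+\dots+x_n\le N}}\frac{\Delta(zq^x)}{\Delta(z)}\prod_{i=1}^n\frac{\theta(az_iq^{|x|+x_i})}{\theta(az_i)}\;\frac{\prod_{1\le i<j\le n}(z_iz_j)_{x_i+x_j}}{\prod_{i=1}^n(aq/z_i)_{|x|-x_i}}\\ &\qquad\times\frac{(q^{-N},b)_{|x|}\prod_{i=1}^n(az_i)_{|x|}}{(aq/c,aq/d,aq/e,aq/f,aq/g)_{|x|}}\,q^{|x|}\prod_{i=1}^n\frac{(cz_i,dz_i,ez_i,fz_i,gz_i)_{x_i}}{(aq^{N+1}z_i,aqz_i/b)_{x_i}\prod_{j=1}^n(qz_i/z_j)_{x_i}}\\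 &=\frac{Z^N\prod_{i=1}^n(aqz_i)_N}{(\lambda q,aq/e,aq/f,aq/g)_N\prod_{i=1}^n(aq/z_i)_N}\\ &\quad\times\sum_{\substack{x_1,\dots,x_n\ge0\\ x_1+\dots+x_n\le N}}\frac{\Delta(zq^x)}{\Delta(z)}\,\frac{\theta(\lambda q^{2|x|})}{\theta(\lambda)}\,\frac{\prod_{1\le i<j\le n}(z_iz_j)_{x_i+x_j}}{\prod_{i=1}^n\big(\frac{\lambda b}{az_i}\big)_{|x|-x_i}}\;\frac{(\lambda,q^{-N},\lambda c/a,\lambda d/a)_{|x|}\prod_{i=1}^n\big(\frac{\lambda b}{az_i}\big)_{|x|}}{(\lambda q^{N+1},aq/c,aq/d)_{|x|}}\,q^{|x|}\\ &\qquad\times\prod_{i=1}^n\frac{(ez_i,fz_i,gz_i,q^{-N}z_i/a)_{x_i}}{(aqz_i/b)_{x_i}\prod_{j=1}^n(qz_i/z_j)_{x_i}}\;\cdot\;P_{|x|}, \end{aligned}$$ where $$P_{s}=\begin{cases}\displaystyle\Big(\frac a\lambda\Big)^N\frac{\big(\frac{aq}{Z},\frac{\lambda q}{eZ},\frac{\lambda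 q}{fZ},\frac{\lambda q}{gZ}\big)_N}{\big(\frac{q^{-N}Z}{a},\frac{\lambda q}{eZ},\frac{\lambda q}{fZ},\frac{\lambda q}{gZ}\big)_{s}},& n\text{ odd},\\[5mm] \displaystyle\frac{\big(\frac{\lambda q}{Z},\frac{aq}{eZ},\frac{aq}{fZ},\frac{aq}{gZ}\big)_N}{\big(\frac{\lambda q}{Z},\frac{\lambda q}{efZ},\frac{\lambda q}{egZ},\frac{\lambda q}{fgZ}\big)_{s}},& n\text{ even}.\end{cases}$$ -/

import Mathlib

open scoped BigOperators

noncomputable section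

namespace EllipticBailey

/-- The modified theta function `θ(u) = ∏_{j ≥ 0} (1 - p^j u) (1 - p^{j+1} / u)` of nome `p`
(used for `|p| < 1` and `u ≠ 0`). -/
def theta (p u : ℂ) : ℂ := ∏' j : ℕ, ((1 - p ^ j * u) * (1 - p ^ (j + 1) / u))

/-- The infinite product defining `theta` converges. -/
theorem multipliable_theta {p : ℂ} (hp : ‖p‖ < 1) (u : ℂ) :
    Multipliable (fun j : ℕ => (1 - p ^ j * u) * (1 - p ^ (j + 1) / u)) := by
  have hs : Summable (fun j : ℕ => ‖p‖ ^ j) := summable_geometric_of_lt_one (norm_nonneg p) hp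
  have h1 : Multipliable (fun j : ℕ => 1 + (-(p ^ j * u))) := by
    apply multipliable_one_add_of_summable
    simpa [norm_mul, norm_pow] using hs.mul_right ‖u‖
  have h2 : Multipliable (fun j : ℕ => 1 + (-(p ^ (j + 1) / u))) := by
    apply multipliable_one_add_of_summable
    have h := hs.mul_right (‖p‖ / ‖u‖)
    refine h.congr fun j => ?_
    rw [norm_neg, norm_div, norm_pow, pow_succ, mul_div_assoc]
  simpa only [sub_eq_add_neg] using h1.mul h2

/-- The elliptic shifted factorial `(u)_k = θ(u) θ(q u) ⋯ θ(q^{k-1} u)`, for `k ≥ 0`. -/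
def poch (p q u : ℂ) (k : ℕ) : ℂ := ∏ j ∈ Finset.range k, theta p (q ^ j * u)

/-- The product `(u₁, …, u_m)_k = (u₁)_k ⋯ (u_m)_k`. -/
def pochs (p q : ℂ) (us : List ℂ) (k : ℕ) : ℂ := (us.map fun u => poch p q u k).prod

/-- The index set: all `x ∈ ℕⁿ` with `x₁ + ⋯ + x_n ≤ N`. -/
def simplex (n N : ℕ) : Finset (Fin n → ℕ) :=
  (Fintype.piFinset fun _ => Finset.range (N + 1)).filter fun x => ∑ i, x i ≤ N

theorem mem_simplex {n N : ℕ} {x : Fin n → ℕ} : x ∈ simplex n N ↔ ∑ i, x i ≤ N := by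
  simp only [simplex, Finset.mem_filter, Fintype.mem_piFinset, Finset.mem_range,
    and_iff_right_iff_imp]
  intro h i
  exact Nat.lt_succ_of_le ((Finset.single_le_sum (fun _ _ => Nat.zero_le _)
    (Finset.mem_univ i)).trans h)

/-- `Δ(z q^x) / Δ(z) = ∏_{i<j} q^{x_i} θ(q^{x_j - x_i} z_j / z_i) / θ(z_j / z_i)`. -/
def deltaRatio (p q : ℂ) {n : ℕ} (z : Fin n → ℂ) (x : Fin n → ℕ) : ℂ :=
  ∏ i, ∏ j ∈ Finset.Ioi i,
    q ^ x i * theta p (q ^ ((x j : ℤ) - (x i : ℤ)) * (z j / z i)) / theta p (z j / z i)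

/-- `∏_{i<j} (z_i z_j)_{x_i + x_j}`. -/
def pairProd (p q : ℂ) {n : ℕ} (z : Fin n → ℂ) (x : Fin n → ℕ) : ℂ :=
  ∏ i, ∏ j ∈ Finset.Ioi i, poch p q (z i * z j) (x i + x j)

/-- The summand, at `x`, of the series with parameters `a, b, c, d, e, f, g`. -/
def leftTerm (p q a b c d e f g : ℂ) {n : ℕ} (z : Fin n → ℂ) (N : ℕ) (x : Fin n → ℕ) : ℂ :=
  let s := ∑ i, x i
  deltaRatio p q z x
    * (∏ i, theta p (a * z i * q ^ (s + x i)) / theta p (a * z i))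
    * (pairProd p q z x / ∏ i, poch p q (a * q / z i) (s - x i))
    * (pochs p q [q ^ (-(N : ℤ)), b] s * (∏ i, poch p q (a * z i) s)
        / pochs p q [a * q / c, a * q / d, a * q / e, a * q / f, a * q / g] s)
    * q ^ s
    * ∏ i, (pochs p q [c * z i, d * z i, e * z i, f * z i, g * z i] (x i)
        / (pochs p q [a * q ^ (N + 1) * z i, a * q * z i / b] (x i)
            * ∏ j, poch p q (q * z i / z j) (x i)))

/-- The factor of the right-hand side that depends on the parity of `n`; `s` stands for `|x|`
and `Z` for `z₁ ⋯ z_n`. -/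
def parityFactor (p q a lam e f g Z : ℂ) (n N s : ℕ) : ℂ :=
  if Odd n then
    (a / lam) ^ N
      * (pochs p q [a * q / Z, lam * q / (e * Z), lam * q / (f * Z), lam * q / (g * Z)] N
        / pochs p q [q ^ (-(N : ℤ)) * Z / a, lam * q / (e * Z), lam * q / (f * Z),
            lam * q / (g * Z)] s)
  else
    pochs p q [lam * q / Z, a * q / (e * Z), a * q / (f * Z), a * q / (g * Z)] N
      / pochs p q [lam * q / Z, lam * q / (e * f * Z), lam * q / (e * g * Z),
          lam * q / (f * g * Z)] s

/-- The summand, at `x`, of the transformed series, including the parity-dependent factor. -/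
def rightTerm (p q a b c d e f g lam : ℂ) {n : ℕ} (z : Fin n → ℂ) (N : ℕ) (x : Fin n → ℕ) : ℂ :=
  let s := ∑ i, x i
  deltaRatio p q z x
    * (theta p (lam * q ^ (2 * s)) / theta p lam)
    * (pairProd p q z x / ∏ i, poch p q (lam * b / (a * z i)) (s - x i))
    * (pochs p q [lam, q ^ (-(N : ℤ)), lam * c / a, lam * d / a] s
        * (∏ i, poch p q (lam * b / (a * z i)) s)
        / pochs p q [lam * q ^ (N + 1), a * q / c, a * q / d] s)
    * q ^ s
    * (∏ i, (pochs p q [e * z i, f * z i, g * z i, q ^ (-(N : ℤ)) * z i / a] (x i)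
        / (poch p q (a * q * z i / b) (x i) * ∏ j, poch p q (q * z i / z j) (x i))))
    * parityFactor p q a lam e f g (∏ i, z i) n N s

/-- The prefactor of the transformed series. -/
def prefactor (p q a e f g lam : ℂ) {n : ℕ} (z : Fin n → ℂ) (N : ℕ) : ℂ :=
  (∏ i, z i) ^ N * (∏ i, poch p q (a * q * z i) N)
    / (pochs p q [lam * q, a * q / e, a * q / f, a * q / g] N * ∏ i, poch p q (a * q / z i) N)

end EllipticBailey

end
open EllipticBailey

/-! Write every parameter as an exponential and replace `theta` by `sigma p x = exp (-x/2) * theta p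
(exp x)`. This function is odd and satisfies the three-term relation of the Weierstrass sigma
function. To see this, the triple product turns `theta` into a Laurent series. Splitting a product
of two such series by parity then writes `sigma (x+y) * sigma (x-y)` as a 2 × 2 determinant `A x * B
y - A y * B x`, and the three-term relation is the Plücker relation for such determinants. Apart
from continuity and countability of the zeros, nothing else about theta functions is used: the
transformation is proved for any `s` with `IsSigma s`, in additive variables with step `h`.

The three-term relation is an interpolation formula. It gives a partial fraction identity of type A
(`gustafsonSum_eq_zero`) and a sum of type D whose value depends on the parity of the number of
variables (`quadSum_eq_quadValue`); this is where the two cases of the theorem originate.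

The transformation is proved by induction on `N`. Fix everything but `c` and `d`; balancing then
fixes `c + d`. Multiplied by `(a+h-c)_N (a+h-d)_N`, both sides become combinations of products of
`N` factors `s (c+u) * s (B-c+u)`, and such functions are determined by their values at `N+1`
points. The points taken are `c = a - lam + k*h`.

For `k = 0` the right-hand sum collapses to the term `x = 0`, and on the left `b` cancels against
`d`, leaving a multivariable Jackson sum (`jackson_sum`). To pass from `k` to `k+1`, compare the
sums at `(c+h, d)` and `(c, d+h)`. On either side the difference expands by partial fractions into a
sum over the variables `z_k`. Its numerators vanish on the face `x_k = 0`, so each piece is the same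
kind of sum, with `N` lowered by one and `a, b, z_k` raised by `h`, `lam` by `2h`
(`left_contiguous`, `right_contiguous`). The coefficients agree (`rightConst_mul_rightCoeff`), so
the induction hypothesis applies.

The Jackson sum is proved by the same mechanism: its contiguous relation changes `u` and `N`
together, and its closed form obeys the same recursion because of the type D identity.

The argument requires non-vanishing along whole progressions `u + ℤ h`. The general case follows by
moving the parameters along a complex line that respects the balancing conditions: only countably
many points of the line are bad, and both sides are continuous at the given point. Finally the
exponential factors between `theta` and `sigma` are collected and seen to cancel by balancing. -/

noncomputable section

namespace EllipticBailey

open Finset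

/-! ### Abstract sigma functions and their interpolation formula. -/

/-- An odd continuous function satisfying the three-term relation of the Weierstrass sigma
function, with countably many zeros. -/
structure IsSigma (s : ℂ → ℂ) : Prop where
  odd : ∀ x, s (-x) = -s x
  three_term : ∀ x y u v, s (x + y) * s (x - y) * (s (u + v) * s (u - v))
    - s (x + v) * s (x - v) * (s (u + y) * s (u - y)) = s (y + v) * s (y - v) * (s (x + u) * s (x - u))
  cont : Continuous s
  countable_zeros : {x | s x = 0}.Countable

/-- A countable subset of the plane has dense complement. This removes auxiliary non-vanishing
assumptions from identities between continuous functions. -/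
theorem eq_zero_of_eqOn_compl_countable {F : ℂ → ℂ} (hF : Continuous F) {Z : Set ℂ}
    (hZ : Z.Countable) (h : ∀ e, e ∉ Z → F e = 0) (e : ℂ) : F e = 0 := by
  have h1 : Dense Zᶜ := hZ.dense_compl ℝ
  have h2 : F = fun _ => 0 := hF.ext_on h1 continuous_const (fun x hx => h x hx)
  rw [h2]

namespace IsSigma

variable {s : ℂ → ℂ} (hs : IsSigma s)
include hs

theorem zero : s 0 = 0 := by
  have := hs.odd 0
  rw [neg_zero] at this
  linear_combination this / 2

theorem sub_comm (x y : ℂ) : s (x - y) = -s (y - x) := by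
  rw [← hs.odd, neg_sub]

theorem countable_zeros_comp {m : ℂ} (hm : m ≠ 0) (x : ℂ) : {t : ℂ | s (x + t * m) = 0}.Countable := by
  have : {t : ℂ | s (x + t * m) = 0} = (fun t => x + t * m) ⁻¹' {x | s x = 0} := rfl
  rw [this]
  refine hs.countable_zeros.preimage_of_injOn ?_
  intro a _ b _ hab
  have : a * m = b * m := by simpa using hab
  exact mul_right_cancel₀ hm this

/-- Two-point interpolation for `α ↦ s (u - α) s (u - (B - α))`. -/
theorem interpolation (u B α α₁ α₂ : ℂ) :
    s (u - α) * s (u - (B - α)) * (s (α₁ - α₂) * s (α₁ + α₂ - B))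
      = s (u - α₁) * s (u - (B - α₁)) * (s (α - α₂) * s (α + α₂ - B))
        - s (u - α₂) * s (u - (B - α₂)) * (s (α - α₁) * s (α + α₁ - B)) := by
  have h := hs.three_term (u - B / 2) (α - B / 2) (α₁ - B / 2) (α₂ - B / 2)
  have e1 : u - B / 2 + (α - B / 2) = u - (B - α) := by ring
  have e2 : u - B / 2 - (α - B / 2) = u - α := by ring
  have e3 : α₁ - B / 2 + (α₂ - B / 2) = α₁ + α₂ - B := by ring
  have e4 : α₁ - B / 2 - (α₂ - B / 2) = α₁ - α₂ := by ring
  have e5 : u - B / 2 + (α₂ - B / 2) = u - (B - α₂) := by ring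
  have e6 : u - B / 2 - (α₂ - B / 2) = u - α₂ := by ring
  have e7 : α₁ - B / 2 + (α - B / 2) = α + α₁ - B := by ring
  have e8 : α₁ - B / 2 - (α - B / 2) = -(α - α₁) := by ring
  have e9 : α - B / 2 + (α₂ - B / 2) = α + α₂ - B := by ring
  have e10 : α - B / 2 - (α₂ - B / 2) = α - α₂ := by ring
  have e11 : u - B / 2 + (α₁ - B / 2) = u - (B - α₁) := by ring
  have e12 : u - B / 2 - (α₁ - B / 2) = u - α₁ := by ring
  rw [e1, e2, e3, e4, e5, e6, e7, e8, e9, e10, e11, e12, hs.odd] at h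
  linear_combination h

end IsSigma

/-! ### The partial fraction identity of type A. -/

section Gustafson

variable {ι : Type*} [DecidableEq ι]

/-- The partial fraction sum of type `A`. -/
def gustafsonSum (s : ℂ → ℂ) (z w : ι → ℂ) (S : Finset ι) : ℂ :=
  ∑ k ∈ S, ∏ j ∈ S, s (z k - w j) / (if j = k then 1 else s (z k - z j))

/-- When a zero meets a pole, the residue at that point disappears and the corresponding factor
cancels from all other terms, leaving one variable fewer. -/
theorem gustafsonSum_erase {s : ℂ → ℂ} (hs : IsSigma s) {z w : ι → ℂ} {S : Finset ι}
    (hz : ∀ i ∈ S, ∀ j ∈ S, i ≠ j → s (z i - z j) ≠ 0) {i : ι} (hi : i ∈ S) (hw : w i = z i) :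
    gustafsonSum s z w S = gustafsonSum s z w (S.erase i) := by
  unfold gustafsonSum
  rw [← Finset.add_sum_erase S _ hi, ← Finset.mul_prod_erase S _ hi, hw, sub_self, hs.zero]
  rw [zero_div, zero_mul, zero_add]
  refine Finset.sum_congr rfl fun k hk => ?_
  have hk' := Finset.mem_erase.1 hk
  rw [← Finset.mul_prod_erase S _ hi, hw, if_neg (Ne.symm hk'.1),
    div_self (hz k hk'.2 i hi hk'.1), one_mul]

/-- Each summand depends on the pair `w i, w j` only through `s (z k - w i) * s (z k - w j)`. With
`w i + w j` fixed, the two-point formula therefore applies termwise with coefficients that do not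
depend on `k`. -/
theorem gustafsonSum_interpolation {s : ℂ → ℂ} (hs : IsSigma s) (z w : ι → ℂ) {S : Finset ι}
    {i j : ι} (hi : i ∈ S) (hj : j ∈ S) (hij : i ≠ j) (α₁ α₂ : ℂ) :
    gustafsonSum s z w S * (s (α₁ - α₂) * s (α₁ + α₂ - (w i + w j)))
      = gustafsonSum s z (Function.update (Function.update w i α₁) j (w i + w j - α₁)) S
          * (s (w i - α₂) * s (w i + α₂ - (w i + w j)))
        - gustafsonSum s z (Function.update (Function.update w i (w i + w j - α₂)) j α₂) S
          * (s (w i - α₁) * s (w i + α₁ - (w i + w j))) := by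
  unfold gustafsonSum
  rw [Finset.sum_mul, Finset.sum_mul, Finset.sum_mul, ← Finset.sum_sub_distrib]
  refine Finset.sum_congr rfl fun k _ => ?_
  have hj' : j ∈ S.erase i := Finset.mem_erase.2 ⟨hij.symm, hj⟩
  have key : ∀ v : ι → ℂ, (∀ l, l ≠ i → l ≠ j → v l = w l) →
      ∏ l ∈ S, s (z k - v l) / (if l = k then 1 else s (z k - z l))
        = s (z k - v i) * s (z k - v j) *
          ((1 / (if i = k then 1 else s (z k - z i))) * (1 / (if j = k then 1 else s (z k - z j))) *
            ∏ l ∈ (S.erase i).erase j, s (z k - w l) / (if l = k then 1 else s (z k - z l))) := by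
    intro v hv
    rw [← Finset.mul_prod_erase S _ hi, ← Finset.mul_prod_erase _ _ hj']
    have : ∏ l ∈ (S.erase i).erase j, s (z k - v l) / (if l = k then 1 else s (z k - z l))
        = ∏ l ∈ (S.erase i).erase j, s (z k - w l) / (if l = k then 1 else s (z k - z l)) := by
      refine Finset.prod_congr rfl fun l hl => ?_
      have := Finset.mem_erase.1 hl
      rw [hv l (Finset.mem_erase.1 this.2).1 this.1]
    rw [this]
    ring
  rw [key w (fun _ _ _ => rfl), key _ (fun l h1 h2 => by
    rw [Function.update_of_ne h2, Function.update_of_ne h1]), key _ (fun l h1 h2 => by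
    rw [Function.update_of_ne h2, Function.update_of_ne h1])]
  simp only [Function.update_self, Function.update_of_ne hij]
  have h := hs.interpolation (z k) (w i + w j) (w i) α₁ α₂
  rw [add_sub_cancel_left] at h
  linear_combination ((1 / (if i = k then 1 else s (z k - z i))) * (1 / (if j = k then 1 else s (z k - z j))) *
            ∏ l ∈ (S.erase i).erase j, s (z k - w l) / (if l = k then 1 else s (z k - z l))) * h

/-- Induction on the number of points: a pair of zeros can be moved, with its sum kept, until one of
them sits on a pole, and then a point drops out. -/
theorem gustafsonSum_eq_zero {s : ℂ → ℂ} (hs : IsSigma s) {z w : ι → ℂ} {S : Finset ι}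
    (hz : ∀ i ∈ S, ∀ j ∈ S, i ≠ j → s (z i - z j) ≠ 0) (hw : ∑ i ∈ S, z i = ∑ i ∈ S, w i) :
    gustafsonSum s z w S = 0 := by
  induction hm : S.card using Nat.strong_induction_on generalizing S w with
  | _ m ih =>
  subst hm
  have hpre : ∀ w : ι → ℂ, ∑ i ∈ S, z i = ∑ i ∈ S, w i → ∀ i ∈ S, w i = z i →
      gustafsonSum s z w S = 0 := by
    intro w hw i hi hwi
    rw [gustafsonSum_erase hs hz hi hwi]
    refine ih _ (Finset.card_erase_lt_of_mem hi) (fun a ha b hb hab =>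
      hz a (Finset.mem_of_mem_erase ha) b (Finset.mem_of_mem_erase hb) hab) ?_ rfl
    rw [← Finset.add_sum_erase S _ hi, ← Finset.add_sum_erase S w hi, hwi] at hw
    exact add_left_cancel hw
  have hpair : ∀ w : ι → ℂ, ∑ i ∈ S, z i = ∑ i ∈ S, w i → ∀ i ∈ S, ∀ j ∈ S, i ≠ j →
      s (z i + z j - (w i + w j)) ≠ 0 → gustafsonSum s z w S = 0 := by
    intro w hw i hi j hj hij hne
    have hsum : ∀ α β, α + β = w i + w j →
        ∑ l ∈ S, z l = ∑ l ∈ S, Function.update (Function.update w i α) j β l := by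
      intro α β hab
      have hj' : j ∈ S.erase i := Finset.mem_erase.2 ⟨hij.symm, hj⟩
      rw [hw, ← Finset.add_sum_erase S _ hi, ← Finset.add_sum_erase _ _ hj',
        ← Finset.add_sum_erase S (Function.update _ _ _) hi, ← Finset.add_sum_erase _ _ hj',
        Function.update_self, Function.update_of_ne hij, Function.update_self,
        ← add_assoc, ← add_assoc, hab]
      congr 1
      refine Finset.sum_congr rfl fun l hl => ?_
      have := Finset.mem_erase.1 hl
      rw [Function.update_of_ne this.1, Function.update_of_ne (Finset.mem_erase.1 this.2).1]
    -- The nodes are `z i` and `z j`, so each configuration on the right has a zero on a pole and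
    -- vanishes by `hpre`.
    have h := gustafsonSum_interpolation hs z w hi hj hij (z i) (z j)
    rw [hpre _ (hsum _ _ (by ring)) i hi (by simp [Function.update_of_ne hij]),
      hpre _ (hsum _ _ (by ring)) j hj (by simp), zero_mul, zero_mul, sub_zero] at h
    exact (mul_eq_zero.1 h).resolve_right (mul_ne_zero (hz i hi j hj hij) hne)
  by_cases h3 : 3 ≤ S.card
  · obtain ⟨i, j, l, hi, hj, hl, hij, hil, hjl⟩ := Finset.two_lt_card_iff.1 h3
    -- To ensure the non-vanishing required by `hpair`, move `w i` and the third zero `w l` in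
    -- opposite directions. The total stays balanced while `w i + w j` varies.
    let u : ι → ℂ := fun t => if t = i then 1 else if t = l then -1 else 0
    have hu : ∑ t ∈ S, u t = 0 := by
      rw [← Finset.add_sum_erase S _ hi, ← Finset.add_sum_erase (S.erase i) _
        (Finset.mem_erase.2 ⟨hil.symm, hl⟩)]
      have : ∑ x ∈ (S.erase i).erase l, u x = 0 := by
        refine Finset.sum_eq_zero fun t ht => ?_
        have := Finset.mem_erase.1 ht
        simp only [u, if_neg this.1, if_neg (Finset.mem_erase.1 this.2).1]
      rw [this]
      simp [u, hil.symm]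
    have hc : Continuous fun e : ℂ => gustafsonSum s z (fun t => w t + e * u t) S := by
      have := hs.cont
      unfold gustafsonSum
      fun_prop
    have := eq_zero_of_eqOn_compl_countable hc
      (hs.countable_zeros_comp (m := -1) (by norm_num) (z i + z j - (w i + w j))) (fun e he => ?_) 0
    · simpa using this
    · refine hpair _ ?_ i hi j hj hij ?_
      · rw [Finset.sum_add_distrib, ← Finset.mul_sum, hu, mul_zero, add_zero, hw]
      · simp only [Set.mem_ofPred_eq] at he
        simp only [u, if_true, if_neg hij.symm, if_neg hjl]
        convert he using 2
        ring
  · have hcard : S.card = 0 ∨ S.card = 1 ∨ S.card = 2 := by omega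
    rcases hcard with h | h | h
    · rw [Finset.card_eq_zero.1 h]; rfl
    · obtain ⟨i, rfl⟩ := Finset.card_eq_one.1 h
      rw [Finset.sum_singleton, Finset.sum_singleton] at hw
      exact hpre w (by simpa using hw) i (by simp) hw.symm
    -- For two points balancing forces `z i + z j = w i + w j`, so `hpair` is never available; the
    -- two terms cancel by oddness.
    · obtain ⟨i, j, hij, rfl⟩ := Finset.card_eq_two.1 h
      rw [Finset.sum_pair hij, Finset.sum_pair hij] at hw
      unfold gustafsonSum
      rw [Finset.sum_pair hij, Finset.prod_pair hij, Finset.prod_pair hij, if_pos rfl, if_pos rfl,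
        if_neg hij, if_neg hij.symm]
      have e1 : z i - w i = -(z j - w j) := by linear_combination hw
      have e2 : z i - w j = -(z j - w i) := by linear_combination hw
      rw [e1, e2, hs.odd, hs.odd, hs.sub_comm (z i) (z j), div_neg]
      ring

end Gustafson

/-! ### The sum of type D and its dependence on parity. -/

section PairSum

variable {ι : Type*} [DecidableEq ι]

/-- The sum of type `D` with four free parameters. -/
def quadSum (s : ℂ → ℂ) (z : ι → ℂ) (c e f g : ℂ) (S : Finset ι) : ℂ :=
  ∑ k ∈ S, s (c + z k) * s (g + z k) * (s (e + z k) * s (f + z k))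
    * ∏ j ∈ S, if j = k then 1 else s (z j + z k) / s (z k - z j)

/-- The value of `quadSum`, in terms of the sum `Z` of the variables and the parity `m` of their
number. -/
def quadValue (s : ℂ → ℂ) (c e f g Z : ℂ) (m : ℕ) : ℂ :=
  if Odd m then s (c + Z) * s (g + Z) * (s (e + Z) * s (f + Z))
  else s Z * s (c + e + Z) * (s (c + f + Z) * s (c + g + Z))

/-- At `c = -z i` the factor `s (c + z k)` cancels the denominator `s (z k - z i)` and leaves `s (z
i + z k)`: one variable is removed and the sign of `c` is reversed. -/
theorem quadSum_erase {s : ℂ → ℂ} (hs : IsSigma s) {z : ι → ℂ} {S : Finset ι}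
    (hz : ∀ i ∈ S, ∀ j ∈ S, i ≠ j → s (z i - z j) ≠ 0) (e f g : ℂ) {i : ι} (hi : i ∈ S) :
    quadSum s z (-z i) e f g S = quadSum s z (z i) e f g (S.erase i) := by
  unfold quadSum
  rw [← Finset.add_sum_erase S _ hi, neg_add_cancel, hs.zero, zero_mul, zero_mul, zero_mul,
    zero_add]
  refine Finset.sum_congr rfl fun k hk => ?_
  have hk' := Finset.mem_erase.1 hk
  have := hz k hk'.2 i hi hk'.1
  rw [← Finset.mul_prod_erase S _ hi, if_neg (Ne.symm hk'.1), neg_add_eq_sub]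
  field_simp

/-- Both sides satisfy the same two-point interpolation in `c` with `c + g` fixed. At the nodes `-z
i` a variable drops out and the parity flips, which interchanges the two forms of the value. -/
theorem quadSum_eq_quadValue {s : ℂ → ℂ} (hs : IsSigma s) {z : ι → ℂ} {S : Finset ι}
    (hz : ∀ i ∈ S, ∀ j ∈ S, i ≠ j → s (z i - z j) ≠ 0) {c e f g : ℂ}
    (h : c + e + f + g + 2 * ∑ i ∈ S, z i = 0) :
    quadSum s z c e f g S = quadValue s c e f g (∑ i ∈ S, z i) S.card := by
  induction hm : S.card using Nat.strong_induction_on generalizing S c e f g with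
  | _ m ih =>
  subst hm
  set Z := ∑ i ∈ S, z i with hZ
  have hpre : ∀ e f g : ℂ, ∀ i ∈ S, -z i + e + f + g + 2 * Z = 0 →
      quadSum s z (-z i) e f g S = quadValue s (-z i) e f g Z S.card := by
    intro e f g i hi h
    have hZ' : Z = z i + ∑ l ∈ S.erase i, z l := (Finset.add_sum_erase S z hi).symm
    rw [quadSum_erase hs hz e f g hi, ih _ (Finset.card_erase_lt_of_mem hi) (fun a ha b hb hab =>
      hz a (Finset.mem_of_mem_erase ha) b (Finset.mem_of_mem_erase hb) hab)
      (by linear_combination h - 2 * hZ') rfl]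
    have hc : S.card = (S.erase i).card + 1 := (Finset.card_erase_add_one hi).symm
    rw [hc, hZ']
    set m := (S.erase i).card
    set Y := ∑ l ∈ S.erase i, z l
    unfold quadValue
    have hodd : Odd (m + 1) ↔ ¬Odd m := Nat.odd_add_one
    by_cases ho : Odd m
    · rw [if_pos ho, if_neg (fun h => hodd.1 h ho)]
      have e1 : -z i + e + (z i + Y) = e + Y := by ring
      have e2 : -z i + f + (z i + Y) = f + Y := by ring
      have e3 : -z i + g + (z i + Y) = g + Y := by ring
      rw [e1, e2, e3]; ring
    · rw [if_neg ho, if_pos (hodd.2 ho)]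
      have e1 : -z i + (z i + Y) = Y := by ring
      have e2 : g + (z i + Y) = z i + g + Y := by ring
      have e3 : e + (z i + Y) = z i + e + Y := by ring
      have e4 : f + (z i + Y) = z i + f + Y := by ring
      rw [e1, e2, e3, e4]; ring
  have hpair : ∀ c e f g : ℂ, c + e + f + g + 2 * Z = 0 → ∀ i ∈ S, ∀ j ∈ S, i ≠ j →
      s (-z i + -z j - (c + g)) ≠ 0 →
      quadSum s z c e f g S - quadValue s c e f g Z S.card = 0 := by
    intro c e f g h i hi j hj hij hne
    have hI := fun u => hs.interpolation (-u) (c + g) c (-z i) (-z j)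
    have hI' : ∀ u, s (c + u) * s (g + u) * (s (-z i - -z j) * s (-z i + -z j - (c + g)))
        = s (-z i + u) * s ((c + g - -z i) + u) * (s (c - -z j) * s (c + -z j - (c + g)))
          - s (-z j + u) * s ((c + g - -z j) + u) * (s (c - -z i) * s (c + -z i - (c + g))) := by
      intro u
      have := hI u
      have e : ∀ x, s (-u - x) = -s (x + u) := fun x => by rw [← hs.odd]; congr 1; ring
      rw [add_sub_cancel_left] at this
      simp only [e, neg_mul_neg] at this
      exact this
    have h1 : quadSum s z c e f g S * (s (-z i - -z j) * s (-z i + -z j - (c + g)))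
        = quadSum s z (-z i) e f (c + g - -z i) S * (s (c - -z j) * s (c + -z j - (c + g)))
          - quadSum s z (-z j) e f (c + g - -z j) S * (s (c - -z i) * s (c + -z i - (c + g))) := by
      unfold quadSum
      rw [Finset.sum_mul, Finset.sum_mul, Finset.sum_mul, ← Finset.sum_sub_distrib]
      refine Finset.sum_congr rfl fun k _ => ?_
      linear_combination ((s (e + z k) * s (f + z k))
        * ∏ j ∈ S, if j = k then 1 else s (z j + z k) / s (z k - z j)) * hI' (z k)
    have h2 : quadValue s c e f g Z S.card * (s (-z i - -z j) * s (-z i + -z j - (c + g)))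
        = quadValue s (-z i) e f (c + g - -z i) Z S.card * (s (c - -z j) * s (c + -z j - (c + g)))
          - quadValue s (-z j) e f (c + g - -z j) Z S.card
            * (s (c - -z i) * s (c + -z i - (c + g))) := by
      unfold quadValue
      split_ifs
      · linear_combination (s (e + Z) * s (f + Z)) * hI' Z
      -- In the even case, balancing rewrites `s (c + f + Z)` through `g`, so that `c` and `g` enter
      -- symmetrically and the formula can be applied at `u = e + Z`.
      · have e1 : ∀ x, s (x + f + Z) = - s (c + g - x + (e + Z)) := fun x => by
          rw [← hs.odd]; congr 1; linear_combination h
        have e2 : ∀ x, x + (c + g - x) + Z = c + g + Z := fun x => by ring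
        rw [e1, e1, e1, e2, e2, add_sub_cancel_left]
        have := hI' (e + Z)
        simp only [← add_assoc] at this ⊢
        linear_combination (-s Z * s (c + g + Z)) * this
    rw [hpre _ _ _ i hi (by linear_combination h), hpre _ _ _ j hj (by linear_combination h),
      ← h2] at h1
    have h3 : -z i - -z j = -(z i - z j) := by ring
    rw [sub_eq_zero]
    refine mul_right_cancel₀ (mul_ne_zero ?_ hne) h1
    rw [h3, hs.odd]
    exact neg_ne_zero.2 (hz i hi j hj hij)
  by_cases h2 : 2 ≤ S.card
  · obtain ⟨i, j, hi, hj, hij⟩ := Finset.one_lt_card_iff.1 h2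
    -- Trading `t` between `c` and `e` preserves balancing and moves `c + g` away from the zeros
    -- excluded in `hpair`.
    have hc : Continuous fun t : ℂ =>
        quadSum s z (c + t) (e - t) f g S - quadValue s (c + t) (e - t) f g Z S.card := by
      have := hs.cont
      unfold quadSum quadValue
      split_ifs
      · refine Continuous.sub ?_ (by fun_prop)
        refine continuous_finsetSum _ fun k _ => ?_
        fun_prop
      · refine Continuous.sub ?_ (by fun_prop)
        refine continuous_finsetSum _ fun k _ => ?_
        fun_prop
    have := eq_zero_of_eqOn_compl_countable hc
      (hs.countable_zeros_comp (m := -1) (by norm_num) (-z i + -z j - (c + g))) (fun t ht => ?_) 0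
    · rw [sub_eq_zero] at this
      simpa using this
    · refine hpair _ _ _ _ (by linear_combination h) i hi j hj hij ?_
      simp only [Set.mem_ofPred_eq] at ht
      convert ht using 2
      ring
  · have hcard : S.card = 0 ∨ S.card = 1 := by omega
    rcases hcard with h0 | h1
    · have hS := Finset.card_eq_zero.1 h0
      have hZ0 : Z = 0 := by rw [hZ, hS, Finset.sum_empty]
      rw [h0, hZ0, hS]
      simp [quadSum, quadValue, hs.zero]
    · obtain ⟨i, rfl⟩ := Finset.card_eq_one.1 h1
      have hZ0 : Z = z i := by rw [hZ, Finset.sum_singleton]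
      rw [h1, hZ0]
      simp [quadSum, quadValue]

end PairSum

end EllipticBailey

end

noncomputable section

namespace EllipticBailey

open Finset Filter Topology

/-! ### The triple product identity and the product formula for theta series. -/

section TripleProduct

variable {p : ℂ}

/-- `∏_{j=1}^m (1 - p^j)`. -/
def qFac (p : ℂ) (m : ℕ) : ℂ := ∏ j ∈ Finset.range m, (1 - p ^ (j + 1))

/-- The reciprocal of `qFac`, extended by zero to negative integers. -/
def qFacInv (p : ℂ) (m : ℤ) : ℂ := if m < 0 then 0 else (qFac p m.toNat)⁻¹

theorem one_sub_pow_ne_zero (hp : ‖p‖ < 1) (j : ℕ) : 1 - p ^ (j + 1) ≠ 0 := by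
  intro h
  have h1 : ‖p ^ (j + 1)‖ = 1 := by rw [← sub_eq_zero.1 h, norm_one]
  rw [norm_pow] at h1
  exact absurd h1 (pow_lt_one₀ (norm_nonneg p) hp (Nat.succ_ne_zero j)).ne

theorem qFac_ne_zero (hp : ‖p‖ < 1) (m : ℕ) : qFac p m ≠ 0 :=
  Finset.prod_ne_zero_iff.2 fun j _ => one_sub_pow_ne_zero hp j

theorem qFacInv_sub_one (hp : ‖p‖ < 1) (m : ℤ) :
    qFacInv p (m - 1) = (1 - p ^ m) * qFacInv p m := by
  unfold qFacInv
  rcases lt_trichotomy m 0 with h | h | h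
  · rw [if_pos h, if_pos (by omega), mul_zero]
  · subst h; simp
  · obtain ⟨k, rfl⟩ : ∃ k : ℕ, m = k + 1 := ⟨(m - 1).toNat, by omega⟩
    rw [if_neg (by omega), if_neg (by omega)]
    have e1 : ((k : ℤ) + 1 - 1).toNat = k := by omega
    have e2 : ((k : ℤ) + 1).toNat = k + 1 := by omega
    have := qFac_ne_zero hp k
    have h2 := one_sub_pow_ne_zero hp k
    rw [e1, e2]
    unfold qFac at *
    rw [Finset.prod_range_succ]
    have e3 : p ^ ((k : ℤ) + 1) = p ^ (k + 1) := by exact_mod_cast zpow_natCast p (k + 1)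
    rw [e3]
    field_simp

/-- The exponent `k (k - 1) / 2`. -/
def triExp (k : ℤ) : ℤ := k * (k - 1) / 2

theorem two_mul_triExp (k : ℤ) : 2 * triExp k = k * (k - 1) :=
  Int.mul_ediv_cancel' (by
    have := Int.even_mul_succ_self (k - 1)
    rw [sub_add_cancel, mul_comm] at this
    exact this.two_dvd)

theorem triExp_add_one (k : ℤ) : triExp (k + 1) = triExp k + k := by
  have h1 := two_mul_triExp k
  have h2 := two_mul_triExp (k + 1)
  linarith

/-- The coefficients of the theta series. -/
def thetaCoeff (p : ℂ) (k : ℤ) : ℂ := (-1) ^ k * p ^ triExp k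

theorem thetaCoeff_add_one (hp0 : p ≠ 0) (k : ℤ) :
    thetaCoeff p (k + 1) = -p ^ k * thetaCoeff p k := by
  unfold thetaCoeff
  rw [triExp_add_one, zpow_add₀ hp0, zpow_add_one₀ (by norm_num)]
  ring

theorem thetaCoeff_one_sub (k : ℤ) : thetaCoeff p (1 - k) = -thetaCoeff p k := by
  have h : triExp (1 - k) = triExp k := by
    have h1 := two_mul_triExp k
    have h2 := two_mul_triExp (1 - k)
    linarith
  unfold thetaCoeff
  rw [h, zpow_sub₀ (by norm_num), zpow_one]
  have : ((-1 : ℂ) ^ k) * (-1) ^ k = 1 := by rw [← mul_zpow]; simp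
  have h0 : ((-1 : ℂ) ^ k) ≠ 0 := zpow_ne_zero _ (by norm_num)
  field_simp
  linear_combination (p ^ triExp k) * this

theorem hasSum_of_eq {f g : ℤ → ℂ} {a b : ℂ} (h : HasSum f a) (hfg : ∀ k, g k = f k)
    (hab : b = a) : HasSum g b := by
  rw [hab, funext hfg]
  exact h

/-- The finite form of the triple product identity. -/
theorem hasSum_finite_triple_product (hp : ‖p‖ < 1) (hp0 : p ≠ 0) {u : ℂ} (hu : u ≠ 0) (n : ℕ) :
    HasSum (fun k : ℤ => thetaCoeff p k * u ^ k
        * (qFac p (2 * n) * qFacInv p (n - k) * qFacInv p (n + k)))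
      (∏ j ∈ Finset.range n, ((1 - p ^ j * u) * (1 - p ^ (j + 1) / u))) := by
  induction n with
  | zero =>
    have : (1 : ℂ) = thetaCoeff p 0 * u ^ (0 : ℤ)
        * (qFac p (2 * 0) * qFacInv p (((0 : ℕ) : ℤ) - 0) * qFacInv p (((0 : ℕ) : ℤ) + 0)) := by
      simp [thetaCoeff, triExp, qFac, qFacInv]
    rw [Finset.prod_range_zero, this]
    refine hasSum_single 0 fun k hk => ?_
    rcases lt_or_gt_of_ne hk with h | h
    · have : qFacInv p (((0 : ℕ) : ℤ) + k) = 0 := by unfold qFacInv; rw [if_pos (by simpa using h)]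
      rw [this]; ring
    · have : qFacInv p (((0 : ℕ) : ℤ) - k) = 0 := by unfold qFacInv; rw [if_pos (by simpa using h)]
      rw [this]; ring
  | succ n ih =>
    -- The new factor is `(1 - p^n u)(1 - p^(n+1)/u) = 1 + p^(2n+1) - p^n u - p^(n+1)/u`. The last
    -- two terms shift the index of the series by one in either direction.
    have h0 := ih.mul_right (1 + p ^ (2 * n + 1))
    have h1 := ((Equiv.subRight (1 : ℤ)).hasSum_iff.2 ih).mul_right (-(p ^ n * u))
    have h2 := ((Equiv.addRight (1 : ℤ)).hasSum_iff.2 ih).mul_right (-(p ^ (n + 1) / u))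
    have h3 := (h0.add h1).add h2
    refine hasSum_of_eq h3 (fun k => ?_) ?_
    · simp only [Function.comp_apply, Equiv.coe_addRight, Equiv.subRight_apply]
      have hr : ∀ m : ℤ, qFacInv p m = (1 - p ^ (m + 1)) * qFacInv p (m + 1) := fun m => by
        have := qFacInv_sub_one hp (m + 1)
        rwa [add_sub_cancel_right] at this
      have a1 : (n : ℤ) - k + 1 = ((n + 1 : ℕ) : ℤ) - k := by push_cast; ring
      have a2 : (n : ℤ) + k + 1 = ((n + 1 : ℕ) : ℤ) + k := by push_cast; ring
      have b1 : qFacInv p (n - k) = (1 - p ^ ((n : ℤ) - k + 1)) * qFacInv p ((n + 1 : ℕ) - k) := by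
        rw [hr, a1]
      have b2 : qFacInv p (n + k) = (1 - p ^ ((n : ℤ) + k + 1)) * qFacInv p ((n + 1 : ℕ) + k) := by
        rw [hr, a2]
      have b3 : qFacInv p (n - (k - 1)) = qFacInv p ((n + 1 : ℕ) - k) := by
        congr 1; push_cast; ring
      have b4 : qFacInv p (n + (k - 1)) = (1 - p ^ ((n : ℤ) + k)) * qFacInv p (n + k) := by
        rw [hr]; congr 2 <;> ring_nf
      have b5 : qFacInv p (n - (k + 1)) = (1 - p ^ ((n : ℤ) - k)) * qFacInv p (n - k) := by
        rw [hr]; congr 2 <;> ring_nf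
      have b6 : qFacInv p (n + (k + 1)) = qFacInv p ((n + 1 : ℕ) + k) := by
        congr 1; push_cast; ring
      have c1 := thetaCoeff_add_one hp0 k
      have c2 := thetaCoeff_add_one hp0 (k - 1)
      rw [sub_add_cancel] at c2
      have hk0 : p ^ k ≠ 0 := zpow_ne_zero _ hp0
      have c3 : thetaCoeff p (k - 1) = -p * (p ^ k)⁻¹ * thetaCoeff p k := by
        rw [c2, zpow_sub_one₀ hp0]; field_simp
      have d1 : u ^ (k - 1) = u ^ k / u := by rw [zpow_sub_one₀ hu]; rfl
      have d2 : u ^ (k + 1) = u ^ k * u := zpow_add_one₀ hu k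
      have e1 : p ^ ((n : ℤ) - k + 1) = p ^ n * p / p ^ k := by
        rw [zpow_add_one₀ hp0, zpow_sub₀ hp0, zpow_natCast]; ring
      have e2 : p ^ ((n : ℤ) + k + 1) = p ^ n * p ^ k * p := by
        rw [zpow_add_one₀ hp0, zpow_add₀ hp0, zpow_natCast]
      have e3 : p ^ ((n : ℤ) + k) = p ^ n * p ^ k := by rw [zpow_add₀ hp0, zpow_natCast]
      have e4 : p ^ ((n : ℤ) - k) = p ^ n / p ^ k := by rw [zpow_sub₀ hp0, zpow_natCast]
      have f1 : qFac p (2 * (n + 1)) = qFac p (2 * n) * (1 - p ^ (2 * n + 1)) * (1 - p ^ (2 * n + 2)) := by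
        unfold qFac
        rw [show 2 * (n + 1) = 2 * n + 1 + 1 by ring, Finset.prod_range_succ, Finset.prod_range_succ]
      rw [b4, b5, b1, b2, b3, b6, c1, c3, d1, d2, f1, e1, e2, e3, e4]
      have hpn : p ^ (2 * n + 1) = p ^ n * p ^ n * p := by ring
      have hpn2 : p ^ (2 * n + 2) = p ^ n * p ^ n * p * p := by ring
      rw [hpn, hpn2, pow_succ]
      field_simp
      ring
    · rw [Finset.prod_range_succ]
      have : p ^ (2 * n + 1) = p ^ n * p ^ (n + 1) := by ring
      rw [this]
      field_simp
      ring_nf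

/-- Consecutive coefficients have ratio `-p^k`, so the ratio test has limit zero in both directions.
-/
theorem summable_thetaSeries (hp : ‖p‖ < 1) (hp0 : p ≠ 0) {u : ℂ} (hu : u ≠ 0) :
    Summable fun k : ℤ => thetaCoeff p k * u ^ k := by
  have hc : ∀ k, thetaCoeff p k ≠ 0 := fun k =>
    mul_ne_zero (zpow_ne_zero _ (by norm_num)) (zpow_ne_zero _ hp0)
  have hpow : Tendsto (fun n : ℕ => ‖p‖ ^ n) atTop (𝓝 0) :=
    tendsto_pow_atTop_nhds_zero_of_lt_one (norm_nonneg p) hp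
  refine Summable.of_nat_of_neg ?_ ?_
  · refine summable_of_ratio_test_tendsto_lt_one (l := 0) one_pos
      (Eventually.of_forall fun n => mul_ne_zero (hc _) (zpow_ne_zero _ hu)) ?_
    have := hpow.mul_const ‖u‖
    rw [zero_mul] at this
    refine this.congr fun n => ?_
    have h1 := hc n
    have h2 : u ^ (n : ℤ) ≠ 0 := zpow_ne_zero _ hu
    rw [← norm_div, ← norm_pow, ← norm_mul, Nat.cast_add_one, thetaCoeff_add_one hp0,
      zpow_add_one₀ hu, zpow_natCast p, ← norm_neg]
    congr 1
    field_simp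
  · refine summable_of_ratio_test_tendsto_lt_one (l := 0) one_pos
      (Eventually.of_forall fun n => mul_ne_zero (hc _) (zpow_ne_zero _ hu)) ?_
    have := (hpow.comp (tendsto_add_atTop_nat 1)).mul_const ‖u⁻¹‖
    rw [zero_mul] at this
    refine this.congr fun n => ?_
    have h1 := thetaCoeff_add_one hp0 (-(n : ℤ) - 1)
    rw [sub_add_cancel] at h1
    have e : -((n + 1 : ℕ) : ℤ) = -(n : ℤ) - 1 := by push_cast; ring
    have e2 : p ^ (-(n : ℤ) - 1) = (p ^ (n + 1))⁻¹ := by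
      rw [← e, zpow_neg, zpow_natCast]
    have h2 := hc (-(n : ℤ) - 1)
    have h3 : u ^ (-(n : ℤ)) ≠ 0 := zpow_ne_zero _ hu
    have h4 : p ^ (n + 1) ≠ 0 := pow_ne_zero _ hp0
    rw [Function.comp_apply, ← norm_div, ← norm_pow, ← norm_mul, e, h1, zpow_sub_one₀ hu, e2,
      ← norm_neg]
    congr 1
    field_simp

/-- The theta series `∑ (-1)^k p^(k(k-1)/2) u^k`. -/
def thetaSeries (p u : ℂ) : ℂ := ∑' k : ℤ, thetaCoeff p k * u ^ k

theorem qFac_limit (hp : ‖p‖ < 1) : ∃ Q : ℂ, Q ≠ 0 ∧ Tendsto (qFac p) atTop (𝓝 Q) := by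
  have hsum : Summable fun j : ℕ => ‖-(p ^ (j + 1))‖ := by
    have := (summable_nat_add_iff 1).2 (summable_geometric_of_lt_one (norm_nonneg p) hp)
    simpa [norm_neg, norm_pow] using this
  refine ⟨∏' j : ℕ, (1 + -(p ^ (j + 1))), tprod_one_add_ne_zero_of_summable (fun j => ?_) hsum, ?_⟩
  · rw [← sub_eq_add_neg]; exact one_sub_pow_ne_zero hp j
  · have := (multipliable_one_add_of_summable hsum).hasProd.tendsto_prod_nat
    simp only [← sub_eq_add_neg] at this ⊢
    exact this

/-- The triple product identity. -/
theorem theta_eq_thetaSeries (hp : ‖p‖ < 1) (hp0 : p ≠ 0) :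
    ∃ Q : ℂ, Q ≠ 0 ∧ ∀ u : ℂ, u ≠ 0 → Q * theta p u = thetaSeries p u := by
  obtain ⟨Q, hQ, hlim⟩ := qFac_limit hp
  refine ⟨Q, hQ, fun u hu => ?_⟩
  have h1 : Tendsto (fun n : ℕ => ∏ j ∈ Finset.range n, ((1 - p ^ j * u) * (1 - p ^ (j + 1) / u)))
      atTop (𝓝 (theta p u)) := (multipliable_theta hp u).hasProd.tendsto_prod_nat
  obtain ⟨M, hM⟩ := (Metric.isBounded_range_of_tendsto _ hlim).exists_norm_le
  obtain ⟨M', hM'⟩ := (Metric.isBounded_range_of_tendsto _ (hlim.inv₀ hQ)).exists_norm_le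
  have hM1 : ∀ n, ‖qFac p n‖ ≤ M := fun n => hM _ ⟨n, rfl⟩
  have hM0 : 0 ≤ M := (norm_nonneg _).trans (hM1 0)
  have hM'1 : ∀ n, ‖(qFac p n)⁻¹‖ ≤ M' := fun n => hM' _ ⟨n, rfl⟩
  have hM'0 : 0 ≤ M' := (norm_nonneg _).trans (hM'1 0)
  have hInv : ∀ m, ‖qFacInv p m‖ ≤ M' := fun m => by
    unfold qFacInv
    split_ifs
    · rwa [norm_zero]
    · exact hM'1 _
  have hInvLim : ∀ f : ℕ → ℤ, Tendsto f atTop atTop →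
      Tendsto (fun n => qFacInv p (f n)) atTop (𝓝 Q⁻¹) := fun f hf => by
    have ht : Tendsto (fun n => (f n).toNat) atTop atTop := by
      refine tendsto_atTop.2 fun b => ?_
      filter_upwards [tendsto_atTop.1 hf b] with n hn
      omega
    refine ((hlim.inv₀ hQ).comp ht).congr' ?_
    filter_upwards [tendsto_atTop.1 hf 0] with n hn
    simp only [Function.comp_apply]
    unfold qFacInv
    rw [if_neg (not_lt.2 hn)]
  -- Dominated convergence in the finite identity: the `p`-binomial coefficients are bounded
  -- uniformly in `n` and `k`, and for fixed `k` they tend to `Q * Q⁻¹ * Q⁻¹`.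
  have h2 : Tendsto (fun n : ℕ => ∏ j ∈ Finset.range n, ((1 - p ^ j * u) * (1 - p ^ (j + 1) / u)))
      atTop (𝓝 (∑' k : ℤ, thetaCoeff p k * u ^ k * (Q * Q⁻¹ * Q⁻¹))) := by
    refine (tendsto_tsum_of_dominated_convergence
      (f := fun (n : ℕ) (k : ℤ) => thetaCoeff p k * u ^ k
        * (qFac p (2 * n) * qFacInv p (n - k) * qFacInv p (n + k)))
      (bound := fun k => ‖thetaCoeff p k * u ^ k‖ * (M * M' * M'))
      ((summable_thetaSeries hp hp0 hu).norm.mul_right _) (fun k => ?_) ?_).congr fun n =>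
        (hasSum_finite_triple_product hp hp0 hu n).tsum_eq
    · refine Tendsto.const_mul _ (Tendsto.mul (Tendsto.mul ?_ ?_) ?_)
      · exact hlim.comp (tendsto_id.const_mul_atTop' two_pos)
      · exact hInvLim _ (tendsto_atTop_add_const_right _ (-k) tendsto_natCast_atTop_atTop)
      · exact hInvLim _ (tendsto_atTop_add_const_right _ k tendsto_natCast_atTop_atTop)
    · refine Eventually.of_forall fun n k => ?_
      rw [norm_mul, norm_mul _ (qFacInv p (n + k)), norm_mul (qFac p (2 * n))]
      gcongr
      · exact hM1 _
      · exact hInv _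
      · exact hInv _
  have h3 := tendsto_nhds_unique h1 h2
  rw [h3, tsum_mul_right]
  unfold thetaSeries
  field_simp

/-- The reflection `k ↦ 1 - k` preserves the exponent `k (k-1) / 2` and reverses the sign. -/
theorem thetaSeries_inv (u : ℂ) (hu : u ≠ 0) : thetaSeries p u⁻¹ = -u⁻¹ * thetaSeries p u := by
  unfold thetaSeries
  rw [← tsum_mul_left, ← (Equiv.subLeft (1 : ℤ)).tsum_eq]
  refine tsum_congr fun k => ?_
  rw [Equiv.subLeft_apply, thetaCoeff_one_sub, inv_zpow, ← zpow_neg, neg_sub, zpow_sub_one₀ hu]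
  ring

/-- Even and odd sums `m + n` of pairs of integers. -/
def parityEquiv : (ℤ × ℤ) ⊕ (ℤ × ℤ) ≃ ℤ × ℤ where
  toFun := Sum.elim (fun x => (x.1 + x.2, x.1 - x.2)) (fun x => (x.1 + x.2, x.1 - x.2 + 1))
  invFun y := if Even (y.1 + y.2) then Sum.inl ((y.1 + y.2) / 2, (y.1 - y.2) / 2)
    else Sum.inr ((y.1 + y.2 - 1) / 2, (y.1 - y.2 + 1) / 2)
  left_inv := by
    rintro (⟨a, b⟩ | ⟨a, b⟩)
    · have h : Even (a + b + (a - b)) := ⟨a, by ring⟩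
      simp only [Sum.elim_inl, h, if_true, Sum.inl.injEq, Prod.mk.injEq]
      omega
    · have h : ¬Even (a + b + (a - b + 1)) := by rw [Int.not_even_iff_odd]; exact ⟨a, by ring⟩
      simp only [Sum.elim_inr, h, if_false, Sum.inr.injEq, Prod.mk.injEq]
      omega
  right_inv := by
    rintro ⟨a, b⟩
    by_cases h : Even (a + b)
    · simp only [h, if_true, Sum.elim_inl, Prod.mk.injEq]
      obtain ⟨k, hk⟩ := h
      omega
    · simp only [h, if_false, Sum.elim_inr, Prod.mk.injEq]
      obtain ⟨k, hk⟩ := Int.not_even_iff_odd.1 h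
      omega

/-- Multiply the two series and separate pairs of indices by the parity of their sum. In each class
the substitution to half sum and half difference decouples `x` from `y` and squares the nome. The
result is antisymmetric bilinear up to a factor, which is what the three-term relation requires. -/
theorem thetaSeries_mul (hp : ‖p‖ < 1) (hp0 : p ≠ 0) {x y : ℂ} (hx : x ≠ 0) (hy : y ≠ 0) :
    thetaSeries p (x * y) * thetaSeries p (x / y)
      = thetaSeries (p ^ 2) (-x ^ 2) * thetaSeries (p ^ 2) (-p * y ^ 2)
        - x / y * (thetaSeries (p ^ 2) (-p * x ^ 2) * thetaSeries (p ^ 2) (-y ^ 2)) := by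
  have hp2 : ‖p ^ 2‖ < 1 := by rw [norm_pow]; exact pow_lt_one₀ (norm_nonneg p) hp two_ne_zero
  have hp20 : p ^ 2 ≠ 0 := pow_ne_zero _ hp0
  have hN : ∀ {u : ℂ}, u ≠ 0 → Summable fun k : ℤ => ‖thetaCoeff p k * u ^ k‖ := fun hu =>
    (summable_thetaSeries hp hp0 hu).norm
  have hN2 : ∀ {u : ℂ}, u ≠ 0 → Summable fun k : ℤ => ‖thetaCoeff (p ^ 2) k * u ^ k‖ := fun hu =>
    (summable_thetaSeries hp2 hp20 hu).norm
  have hx2 : -x ^ 2 ≠ 0 := neg_ne_zero.2 (pow_ne_zero _ hx)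
  have hy2 : -y ^ 2 ≠ 0 := neg_ne_zero.2 (pow_ne_zero _ hy)
  have hpx2 : -p * x ^ 2 ≠ 0 := mul_ne_zero (neg_ne_zero.2 hp0) (pow_ne_zero _ hx)
  have hpy2 : -p * y ^ 2 ≠ 0 := mul_ne_zero (neg_ne_zero.2 hp0) (pow_ne_zero _ hy)
  have hsq : ∀ k : ℤ, ((-1 : ℂ) ^ k) * (-1) ^ k = 1 := fun k => by rw [← mul_zpow]; simp
  unfold thetaSeries
  rw [tsum_mul_tsum_of_summable_norm (hN (mul_ne_zero hx hy)) (hN (div_ne_zero hx hy)),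
    tsum_mul_tsum_of_summable_norm (hN2 hx2) (hN2 hpy2),
    tsum_mul_tsum_of_summable_norm (hN2 hpx2) (hN2 hy2), ← parityEquiv.tsum_eq,
    ← tsum_mul_left, sub_eq_add_neg, ← tsum_neg]
  have hsum := parityEquiv.summable_iff.2
    (summable_mul_of_summable_norm (hN (mul_ne_zero hx hy)) (hN (div_ne_zero hx hy)))
  have h := Summable.tsum_sum (hsum.comp_injective Sum.inl_injective)
    (hsum.comp_injective Sum.inr_injective)
  simp only [Function.comp_apply] at h
  rw [h]
  have sq : ∀ (w : ℂ) (k : ℤ), (w ^ 2) ^ k = w ^ k * w ^ k := fun w k => by rw [pow_two, mul_zpow]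
  have neg : ∀ (w : ℂ) (k : ℤ), (-w) ^ k = (-1) ^ k * w ^ k := fun w k => by
    rw [← mul_zpow, neg_one_mul]
  congr 1
  · refine tsum_congr fun ⟨a, b⟩ => ?_
    have ht : triExp (a + b) + triExp (a - b) = 2 * triExp a + 2 * triExp b + b := by
      have h1 := two_mul_triExp a
      have h2 := two_mul_triExp b
      have h3 := two_mul_triExp (a + b)
      have h4 := two_mul_triExp (a - b)
      linarith
    have hpp : p ^ triExp (a + b) * p ^ triExp (a - b)
        = (p ^ 2) ^ triExp a * (p ^ 2) ^ triExp b * p ^ b := by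
      rw [← zpow_add₀ hp0, ht, zpow_add₀ hp0, zpow_add₀ hp0, zpow_mul, zpow_mul]
      rfl
    have e : parityEquiv (Sum.inl (a, b)) = (a + b, a - b) := rfl
    have h1 := hsq a
    have h2 := hsq b
    have hxb : x ^ b ≠ 0 := zpow_ne_zero _ hx
    have hya : y ^ a ≠ 0 := zpow_ne_zero _ hy
    have hyb : y ^ b ≠ 0 := zpow_ne_zero _ hy
    have h0 : ((-1 : ℂ) ^ b) ≠ 0 := zpow_ne_zero _ (by norm_num)
    rw [e]
    unfold thetaCoeff
    dsimp only
    rw [mul_zpow x y, div_zpow x y, neg (x ^ 2), neg_mul, neg (p * y ^ 2), mul_zpow p, sq x, sq y,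
      zpow_add₀ hx, zpow_add₀ hy, zpow_sub₀ hx, zpow_sub₀ hy,
      zpow_add₀ (by norm_num : (-1 : ℂ) ≠ 0), zpow_sub₀ (by norm_num : (-1 : ℂ) ≠ 0)]
    trans (-1) ^ a * (-1) ^ a * (x ^ a * x ^ a * (y ^ b * y ^ b))
      * (p ^ triExp (a + b) * p ^ triExp (a - b))
    · field_simp
    · rw [hpp]
      linear_combination (-x ^ a * x ^ a * y ^ b * y ^ b * (p ^ 2) ^ triExp a * (p ^ 2) ^ triExp b
        * p ^ b * ((-1) ^ a * (-1) ^ a)) * h2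
  · refine tsum_congr fun ⟨a, b⟩ => ?_
    have ht : triExp (a + b) + triExp (a - b + 1) = 2 * triExp a + 2 * triExp b + a := by
      have h1 := two_mul_triExp a
      have h2 := two_mul_triExp b
      have h3 := two_mul_triExp (a + b)
      have h4 := two_mul_triExp (a - b + 1)
      linarith
    have hpp : p ^ triExp (a + b) * p ^ triExp (a - b + 1)
        = (p ^ 2) ^ triExp a * (p ^ 2) ^ triExp b * p ^ a := by
      rw [← zpow_add₀ hp0, ht, zpow_add₀ hp0, zpow_add₀ hp0, zpow_mul, zpow_mul]
      rfl
    have e : parityEquiv (Sum.inr (a, b)) = (a + b, a - b + 1) := rfl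
    have h1 := hsq a
    have h2 := hsq b
    have hxb : x ^ b ≠ 0 := zpow_ne_zero _ hx
    have hya : y ^ a ≠ 0 := zpow_ne_zero _ hy
    have hyb : y ^ b ≠ 0 := zpow_ne_zero _ hy
    have h0 : ((-1 : ℂ) ^ b) ≠ 0 := zpow_ne_zero _ (by norm_num)
    rw [e]
    unfold thetaCoeff
    dsimp only
    rw [mul_zpow x y, div_zpow x y, neg (y ^ 2), neg_mul, neg (p * x ^ 2), mul_zpow p, sq x, sq y,
      zpow_add_one₀ hx, zpow_add_one₀ hy,
      zpow_add₀ hx, zpow_add₀ hy, zpow_sub₀ hx, zpow_sub₀ hy,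
      zpow_add_one₀ (by norm_num : (-1 : ℂ) ≠ 0),
      zpow_add₀ (by norm_num : (-1 : ℂ) ≠ 0), zpow_sub₀ (by norm_num : (-1 : ℂ) ≠ 0)]
    trans -((-1) ^ a * (-1) ^ a) * (x ^ a * x ^ a * (y ^ b * y ^ b)) * (x / y)
      * (p ^ triExp (a + b) * p ^ triExp (a - b + 1))
    · field_simp
    · rw [hpp]
      linear_combination (x ^ a * x ^ a * y ^ b * y ^ b * (p ^ 2) ^ triExp a * (p ^ 2) ^ triExp b
        * p ^ a * (x / y) * ((-1) ^ a * (-1) ^ a)) * h2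

end TripleProduct

end EllipticBailey
end

noncomputable section

namespace EllipticBailey

open Finset Filter Topology

/-! ### The odd normalization of theta is a sigma function. -/

section Sigma

/-- The odd normalization of `theta` in the exponential variable. -/
def sigma (p x : ℂ) : ℂ := Complex.exp (-x / 2) * theta p (Complex.exp x)

theorem theta_exp (p x : ℂ) : theta p (Complex.exp x) = Complex.exp (x / 2) * sigma p x := by
  unfold sigma
  rw [← mul_assoc, ← Complex.exp_add, neg_div, add_neg_cancel, Complex.exp_zero, one_mul]

theorem theta_zero_nome (u : ℂ) : theta 0 u = 1 - u := by
  unfold theta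
  rw [tprod_eq_mulSingle 0]
  · simp
  · intro j hj
    simp [hj]

theorem countable_exp_fiber (w : ℂ) : {x : ℂ | Complex.exp x = w}.Countable := by
  by_cases h : ∃ x₀, Complex.exp x₀ = w
  · obtain ⟨x₀, rfl⟩ := h
    refine (Set.countable_range fun n : ℤ => x₀ + n * (2 * Real.pi * Complex.I)).mono ?_
    intro x hx
    obtain ⟨n, hn⟩ := Complex.exp_eq_exp_iff_exists_int.1 hx
    exact ⟨n, hn.symm⟩
  · have : {x : ℂ | Complex.exp x = w} = ∅ :=
      Set.eq_empty_of_forall_notMem fun x hx => h ⟨x, hx⟩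
    rw [this]
    exact Set.countable_empty

theorem theta_ne_zero {p : ℂ} (hp : ‖p‖ < 1) {u : ℂ}
    (h1 : ∀ j : ℕ, 1 - p ^ j * u ≠ 0) (h2 : ∀ j : ℕ, 1 - p ^ (j + 1) / u ≠ 0) : theta p u ≠ 0 := by
  have hs : Summable (fun j : ℕ => ‖p‖ ^ j) := summable_geometric_of_lt_one (norm_nonneg p) hp
  have e1 : Summable fun j : ℕ => ‖-(p ^ j * u)‖ := by
    simpa [norm_mul, norm_pow] using hs.mul_right ‖u‖
  have e2 : Summable fun j : ℕ => ‖-(p ^ (j + 1) / u)‖ := by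
    have h := hs.mul_right (‖p‖ / ‖u‖)
    refine h.congr fun j => ?_
    rw [norm_neg, norm_div, norm_pow, pow_succ, mul_div_assoc]
  have h3 := tprod_one_add_ne_zero_of_summable (f := fun j : ℕ => -(p ^ j * u))
    (fun j => by rw [← sub_eq_add_neg]; exact h1 j) e1
  have h4 := tprod_one_add_ne_zero_of_summable (f := fun j : ℕ => -(p ^ (j + 1) / u))
    (fun j => by rw [← sub_eq_add_neg]; exact h2 j) e2
  have h5 := (multipliable_one_add_of_summable e1).tprod_mul (multipliable_one_add_of_summable e2)
  simp only [← sub_eq_add_neg] at h3 h4 h5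
  unfold theta
  rw [h5]
  exact mul_ne_zero h3 h4

/-- A zero of `sigma` forces some factor of the convergent product to vanish, so `exp x` is
`(p^j)⁻¹` or `p^(j+1)`; each of these values has a countable fibre under `exp`. -/
theorem countable_zeros_sigma {p : ℂ} (hp : ‖p‖ < 1) : {x | sigma p x = 0}.Countable := by
  refine ((Set.countable_iUnion fun j : ℕ => countable_exp_fiber (p ^ j)⁻¹).union
    (Set.countable_iUnion fun j : ℕ => countable_exp_fiber (p ^ (j + 1)))).mono ?_
  intro x hx
  by_contra hc
  rw [Set.mem_union, not_or, Set.mem_iUnion, Set.mem_iUnion, not_exists, not_exists] at hc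
  refine theta_ne_zero hp (fun j h => hc.1 j ?_) (fun j h => hc.2 j ?_)
    ((mul_eq_zero.1 hx).resolve_left (Complex.exp_ne_zero _))
  · exact eq_inv_of_mul_eq_one_right (sub_eq_zero.1 h).symm
  · exact ((div_eq_one_iff_eq (Complex.exp_ne_zero _)).1 (sub_eq_zero.1 h).symm).symm

/-- On the disc of radius `R` the term of index `k` is dominated by the sum of the absolute values
of the terms at `exp R` and `exp (-R)`. -/
theorem continuous_thetaSeries_exp {p : ℂ} (hp : ‖p‖ < 1) (hp0 : p ≠ 0) :
    Continuous fun x => thetaSeries p (Complex.exp x) := by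
  rw [continuous_iff_continuousAt]
  intro x
  set R : ℝ := ‖x‖ + 1
  have hcont : ContinuousOn (fun x => thetaSeries p (Complex.exp x)) (Metric.ball 0 R) := by
    have h1 := (summable_thetaSeries hp hp0 (Complex.exp_ne_zero (R : ℂ))).norm
    have h2 := (summable_thetaSeries hp hp0 (Complex.exp_ne_zero (-R : ℂ))).norm
    refine continuousOn_tsum (fun k => ?_) (h1.add h2) ?_
    · refine Continuous.continuousOn ?_
      simp only [← Complex.exp_int_mul]
      fun_prop
    · intro k y hy
      have hy' : ‖y‖ ≤ R := (mem_ball_zero_iff.1 hy).le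
      rw [norm_mul, norm_mul, norm_mul, ← mul_add]
      refine mul_le_mul_of_nonneg_left ?_ (norm_nonneg _)
      simp only [← Complex.exp_int_mul, Complex.norm_exp]
      have h3 : ((k : ℂ) * y).re = k * y.re := by simp
      have h4 : ((k : ℂ) * (R : ℂ)).re = k * R := by simp
      have h5 : ((k : ℂ) * (-R : ℂ)).re = k * (-R) := by simp
      rw [h3, h4, h5]
      have h6 := abs_le.1 ((Complex.abs_re_le_norm y).trans hy')
      rcases le_total (0 : ℝ) k with hk | hk
      · refine (Real.exp_le_exp.2 (mul_le_mul_of_nonneg_left h6.2 hk)).trans ?_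
        exact le_add_of_nonneg_right (Real.exp_nonneg _)
      · refine (Real.exp_le_exp.2 (mul_le_mul_of_nonpos_left h6.1 hk)).trans ?_
        exact le_add_of_nonneg_left (Real.exp_nonneg _)
  exact hcont.continuousAt (Metric.isOpen_ball.mem_nhds (by simp [R]))

theorem isSigma_sigma {p : ℂ} (hp : ‖p‖ < 1) : IsSigma (sigma p) := by
  -- If `s (x+y) * s (x-y)` is a constant times the determinant with columns `(A x, B x)` and `(A y,
  -- B y)`, the three-term relation is the Plücker relation for four vectors in the plane.
  have plucker : ∀ (Q : ℂ) (_ : Q ≠ 0) (A B : ℂ → ℂ),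
      (∀ x y, Q * (sigma p (x + y) * sigma p (x - y)) = A x * B y - A y * B x) →
      ∀ x y u v, sigma p (x + y) * sigma p (x - y) * (sigma p (u + v) * sigma p (u - v))
        - sigma p (x + v) * sigma p (x - v) * (sigma p (u + y) * sigma p (u - y))
        = sigma p (y + v) * sigma p (y - v) * (sigma p (x + u) * sigma p (x - u)) := by
    intro Q hQ A B h x y u v
    refine mul_left_cancel₀ (mul_ne_zero hQ hQ) ?_
    trans (A x * B y - A y * B x) * (A u * B v - A v * B u)
      - (A x * B v - A v * B x) * (A u * B y - A y * B u)
    · rw [← h, ← h, ← h, ← h]; ring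
    · trans (A y * B v - A v * B y) * (A x * B u - A u * B x)
      · ring
      · rw [← h, ← h]; ring
  -- The Laurent series needs invertible `p`. For `p = 0` the function is a hyperbolic sine up to a
  -- constant and the determinant is elementary.
  by_cases hp0 : p = 0
  · subst hp0
    have hs : ∀ x, sigma 0 x = Complex.exp (-x / 2) - Complex.exp (x / 2) := fun x => by
      unfold sigma
      rw [theta_zero_nome, mul_sub, mul_one, ← Complex.exp_add]
      congr 2
      ring
    refine ⟨fun x => ?_, ?_, ?_, countable_zeros_sigma hp⟩
    · rw [hs, hs, neg_neg]; ring
    · refine plucker 1 one_ne_zero (fun x => Complex.exp (-x) + Complex.exp x) (fun _ => 1) ?_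
      intro x y
      rw [hs, hs, one_mul, mul_one, mul_one, sub_mul, mul_sub, mul_sub, ← Complex.exp_add,
        ← Complex.exp_add, ← Complex.exp_add, ← Complex.exp_add]
      have e1 : -(x + y) / 2 + -(x - y) / 2 = -x := by ring
      have e2 : -(x + y) / 2 + (x - y) / 2 = -y := by ring
      have e3 : (x + y) / 2 + -(x - y) / 2 = y := by ring
      have e4 : (x + y) / 2 + (x - y) / 2 = x := by ring
      rw [e1, e2, e3, e4]; ring
    · rw [funext hs]; fun_prop
  · obtain ⟨Q, hQ, hT⟩ := theta_eq_thetaSeries hp hp0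
    have hs : ∀ x, Q * sigma p x = Complex.exp (-x / 2) * thetaSeries p (Complex.exp x) := fun x => by
      rw [← hT _ (Complex.exp_ne_zero x)]; unfold sigma; ring
    refine ⟨fun x => mul_left_cancel₀ hQ ?_, ?_, ?_, countable_zeros_sigma hp⟩
    · rw [hs, Complex.exp_neg, thetaSeries_inv _ (Complex.exp_ne_zero x), mul_neg, hs,
        ← Complex.exp_neg, neg_neg]
      have : Complex.exp (-x / 2) = Complex.exp (x / 2) * Complex.exp (-x) := by
        rw [← Complex.exp_add]; congr 1; ring
      rw [this]; ring
    · refine plucker (Q * Q) (mul_ne_zero hQ hQ)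
        (fun x => Complex.exp (-x) * thetaSeries (p ^ 2) (-Complex.exp x ^ 2))
        (fun x => thetaSeries (p ^ 2) (-p * Complex.exp x ^ 2)) ?_
      intro x y
      have h := thetaSeries_mul hp hp0 (Complex.exp_ne_zero x) (Complex.exp_ne_zero y)
      rw [← Complex.exp_add, ← Complex.exp_sub] at h
      have h2 : Complex.exp (-(x + y) / 2) * Complex.exp (-(x - y) / 2) = Complex.exp (-x) := by
        rw [← Complex.exp_add]; congr 1; ring
      have h3 : Complex.exp (-x) * Complex.exp (x - y) = Complex.exp (-y) := by
        rw [← Complex.exp_add]; congr 1; ring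
      calc _ = (Q * sigma p (x + y)) * (Q * sigma p (x - y)) := by ring
        _ = Complex.exp (-(x + y) / 2) * Complex.exp (-(x - y) / 2) *
            (thetaSeries p (Complex.exp (x + y)) * thetaSeries p (Complex.exp (x - y))) := by
          rw [hs, hs]; ring
        _ = _ := by
          rw [h2, h, ← h3]; ring
    · have : sigma p = fun x => Q⁻¹ * (Complex.exp (-x / 2) * thetaSeries p (Complex.exp x)) := by
        funext x
        rw [← hs]; field_simp
      rw [this]
      have := continuous_thetaSeries_exp hp hp0
      fun_prop

end Sigma

end EllipticBailey
end

noncomputable section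

namespace EllipticBailey

open Finset

/-! ### Additive shifted factorials, and non-vanishing along progressions. -/

section Factorials

variable (s : ℂ → ℂ) (h : ℂ)

/-- The additive shifted factorial `s(u) s(u + h) ⋯ s(u + (k - 1) h)`. -/
def sp (u : ℂ) (k : ℕ) : ℂ := ∏ j ∈ Finset.range k, s (u + j * h)

/-- `s` has no zero on `u + ℤ h`. -/
def NZ (u : ℂ) : Prop := ∀ m : ℤ, s (u + m * h) ≠ 0

variable {s h}

theorem sp_zero (u : ℂ) : sp s h u 0 = 1 := by simp [sp]

theorem sp_succ (u : ℂ) (k : ℕ) : sp s h u (k + 1) = sp s h u k * s (u + k * h) := by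
  simp [sp, Finset.prod_range_succ]

theorem sp_succ' (u : ℂ) (k : ℕ) : sp s h u (k + 1) = s u * sp s h (u + h) k := by
  unfold sp
  rw [Finset.prod_range_succ', mul_comm]
  congr 1
  · simp
  · refine Finset.prod_congr rfl fun j _ => ?_
    congr 1
    push_cast
    ring

theorem sp_shift (u : ℂ) (k : ℕ) : s u * sp s h (u + h) k = sp s h u k * s (u + k * h) := by
  rw [← sp_succ', sp_succ]

theorem sp_shift_two (u : ℂ) (k : ℕ) :
    s u * s (u + h) * sp s h (u + 2 * h) k = sp s h u (k + 1) * s (u + (k + 1) * h) := by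
  have h1 := sp_succ' (s := s) (h := h) u (k + 1)
  have h2 := sp_succ (s := s) (h := h) u (k + 1)
  have h3 := sp_succ' (s := s) (h := h) (u + h) k
  rw [h1, h3] at h2
  rw [mul_assoc, show u + 2 * h = u + h + h by ring, h2]
  push_cast
  rfl

theorem NZ.at {u v : ℂ} (H : NZ s h u) (m : ℤ) (e : v = u + m * h) : s v ≠ 0 := e ▸ H m

theorem NZ.shift {u v : ℂ} (H : NZ s h u) (m : ℤ) (e : v = u + m * h) : NZ s h v := fun k => by
  have := H (m + k)
  rw [e]
  convert this using 2
  push_cast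
  ring

theorem NZ.neg (hs : IsSigma s) {u v : ℂ} (H : NZ s h u) (e : v = -u) : NZ s h v := fun k => by
  have := H (-k)
  rw [e, show -u + k * h = -(u + ((-k : ℤ) : ℂ) * h) by push_cast; ring, hs.odd]
  exact neg_ne_zero.2 this

theorem NZ.sp {u v : ℂ} (H : NZ s h u) (m : ℤ) (e : v = u + m * h) (k : ℕ) : sp s h v k ≠ 0 :=
  Finset.prod_ne_zero_iff.2 fun j _ => H.at (m + j) (by rw [e]; push_cast; ring)

end Factorials

/-! ### Products over pairs of indices in which only one index is modified. -/

section Pairs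

variable {n : ℕ}

theorem prod_pairs_single (k : Fin n) (r : Fin n → ℂ) :
    ∏ i, ∏ j ∈ Finset.Ioi i, (if i = k then r j else if j = k then r i else 1)
      = ∏ j, if j = k then 1 else r j := by
  have h1 : ∀ i, ∏ j ∈ Finset.Ioi i, (if i = k then r j else if j = k then r i else 1)
      = if i = k then ∏ j ∈ Finset.Ioi k, r j else if i < k then r i else 1 := by
    intro i
    by_cases hi : i = k
    · subst hi; simp
    · simp only [if_neg hi]
      rw [Finset.prod_ite_eq']
      simp only [Finset.mem_Ioi]
  simp only [h1]
  rw [← Finset.mul_prod_erase _ _ (Finset.mem_univ k),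
    ← Finset.mul_prod_erase _ (fun j => if j = k then 1 else r j) (Finset.mem_univ k),
    if_pos rfl, if_pos rfl, one_mul]
  have h2 : ∏ x ∈ univ.erase k, (if x = k then ∏ j ∈ Finset.Ioi k, r j else if x < k then r x else 1)
      = ∏ x ∈ univ.erase k, if x < k then r x else 1 :=
    Finset.prod_congr rfl fun x hx => if_neg (Finset.ne_of_mem_erase hx)
  have h3 : ∏ x ∈ univ.erase k, (if x = k then 1 else r x) = ∏ x ∈ univ.erase k, r x :=
    Finset.prod_congr rfl fun x hx => if_neg (Finset.ne_of_mem_erase hx)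
  have h4 : Finset.Ioi k = (univ.erase k).filter fun x => ¬x < k := by
    ext x
    simp only [Finset.mem_Ioi, Finset.mem_filter, Finset.mem_erase, Finset.mem_univ, and_true,
      not_lt]
    exact ⟨fun hx => ⟨hx.ne', hx.le⟩, fun hx => lt_of_le_of_ne hx.2 hx.1.symm⟩
  rw [h2, h3, h4, ← Finset.prod_filter, mul_comm, Finset.prod_filter_mul_prod_filter_not]

/-- Compare pair products of symmetric weights that agree away from `k`. -/
theorem prod_pairs_compare {W W' : Fin n → Fin n → ℂ} (hW : ∀ i j, i ≠ j → W i j = W j i)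
    (hW' : ∀ i j, i ≠ j → W' i j = W' j i) (k : Fin n) (r t : Fin n → ℂ)
    (h1 : ∀ i j, i ≠ j → i ≠ k → j ≠ k → W' i j = W i j)
    (h2 : ∀ j, j ≠ k → W' k j * r j = W k j * t j) :
    (∏ i, ∏ j ∈ Finset.Ioi i, W' i j) * (∏ j, if j = k then 1 else r j)
      = (∏ i, ∏ j ∈ Finset.Ioi i, W i j) * (∏ j, if j = k then 1 else t j) := by
  rw [← prod_pairs_single, ← prod_pairs_single, ← Finset.prod_mul_distrib,
    ← Finset.prod_mul_distrib]
  refine Finset.prod_congr rfl fun i _ => ?_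
  rw [← Finset.prod_mul_distrib, ← Finset.prod_mul_distrib]
  refine Finset.prod_congr rfl fun j hj => ?_
  have hij : i ≠ j := (Finset.mem_Ioi.1 hj).ne
  by_cases hi : i = k
  · subst hi
    rw [if_pos rfl, if_pos rfl]
    exact h2 j hij.symm
  · rw [if_neg hi, if_neg hi]
    by_cases hjk : j = k
    · subst hjk
      rw [if_pos rfl, if_pos rfl, hW' _ _ hij, hW _ _ hij]
      exact h2 i hi
    · rw [if_neg hjk, if_neg hjk, h1 i j hij hi hjk]

end Pairs

/-! ### The weights of the summands and their behaviour when one index is raised. -/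

section Weights

variable {s : ℂ → ℂ} {h : ℂ} {n : ℕ}

/-- Shift the `k`-th variable by `h`. -/
def shiftVar (h : ℂ) (z : Fin n → ℂ) (k : Fin n) : Fin n → ℂ := fun i => z i + if i = k then h else 0

/-- Increase the `k`-th index by one. -/
def incr (x : Fin n → ℕ) (k : Fin n) : Fin n → ℕ := fun i => x i + if i = k then 1 else 0

theorem sum_incr (x : Fin n → ℕ) (k : Fin n) : ∑ i, incr x k i = ∑ i, x i + 1 := by
  unfold incr
  rw [Finset.sum_add_distrib, Finset.sum_ite_eq']
  simp

theorem sum_shiftVar (z : Fin n → ℂ) (k : Fin n) : ∑ i, shiftVar h z k i = ∑ i, z i + h := by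
  unfold shiftVar
  rw [Finset.sum_add_distrib, Finset.sum_ite_eq']
  simp

theorem shiftVar_self (z : Fin n → ℂ) (k : Fin n) : shiftVar h z k k = z k + h := by
  simp [shiftVar]

theorem shiftVar_of_ne (z : Fin n → ℂ) {k i : Fin n} (hi : i ≠ k) : shiftVar h z k i = z i := by
  simp [shiftVar, hi]

theorem incr_self (x : Fin n → ℕ) (k : Fin n) : incr x k k = x k + 1 := by simp [incr]

theorem incr_of_ne (x : Fin n → ℕ) {k i : Fin n} (hi : i ≠ k) : incr x k i = x i := by
  simp [incr, hi]

/-- A sum over the simplex of a function that vanishes on the face `x k = 0`. -/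
theorem sum_simplex_succ (N : ℕ) (k : Fin n) (F : (Fin n → ℕ) → ℂ) (hF : ∀ x, x k = 0 → F x = 0) :
    ∑ x ∈ simplex n (N + 1), F x = ∑ x ∈ simplex n N, F (incr x k) := by
  rw [← Finset.sum_filter_of_ne (p := fun x => x k ≠ 0) (fun x _ hx h0 => hx (hF x h0))]
  symm
  refine Finset.sum_bij (fun x _ => incr x k) (fun x hx => ?_) (fun x _ y _ hxy => ?_)
    (fun y hy => ?_) (fun _ _ => rfl)
  · rw [Finset.mem_filter, mem_simplex, sum_incr]
    rw [mem_simplex] at hx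
    exact ⟨by omega, by rw [incr_self]; omega⟩
  · funext i
    have := congrFun hxy i
    unfold incr at this
    omega
  · rw [Finset.mem_filter, mem_simplex] at hy
    have hyk : incr (fun i => y i - if i = k then 1 else 0) k = y := by
      funext i
      unfold incr
      by_cases hi : i = k
      · subst hi; simp only [if_true]; omega
      · simp [hi]
    refine ⟨fun i => y i - if i = k then 1 else 0, ?_, hyk⟩
    rw [mem_simplex]
    have := sum_incr (fun i => y i - if i = k then 1 else 0) k
    rw [hyk] at this
    omega

variable (s h)

/-- The contribution of a pair of indices. -/
def pairWeight (z : Fin n → ℂ) (x : Fin n → ℕ) (i j : Fin n) : ℂ :=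
  s (z i - z j + (x i - x j) * h) / (s (z i - z j) * sp s h (h + z i - z j) (x i)
    * sp s h (h + z j - z i) (x j)) * sp s h (z i + z j) (x i + x j)

/-- The part of the summands that depends on `z` and `x` only. -/
def baseWeight (z : Fin n → ℂ) (x : Fin n → ℕ) : ℂ :=
  (∏ i, ∏ j ∈ Finset.Ioi i, pairWeight s h z x i j) * ∏ i, (sp s h h (x i))⁻¹

/-- The contribution of one index to the part of the left-hand side depending on `a`. -/
def wellPoised (a : ℂ) (z : Fin n → ℂ) (x : Fin n → ℕ) (X : ℕ) (i : Fin n) : ℂ :=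
  s (a + z i + (X + x i) * h) * sp s h (a + z i) X / (s (a + z i) * sp s h (a + h - z i) (X - x i))

/-- The part of the left-hand side that depends on `a`, `z` and `x` only. -/
def coreWeight (a : ℂ) (z : Fin n → ℂ) (x : Fin n → ℕ) : ℂ :=
  baseWeight s h z x * ∏ i, wellPoised s h a z x (∑ l, x l) i

/-- Genericity of the variables. -/
def GenericVars (z : Fin n → ℂ) : Prop :=
  (∀ m : ℤ, m ≠ 0 → s (m * h) ≠ 0) ∧ ∀ i j, i ≠ j → NZ s h (z i - z j)

variable {s h}

theorem GenericVars.shift {z : Fin n → ℂ} (H : GenericVars s h z) (k : Fin n) :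
    GenericVars s h (shiftVar h z k) := by
  refine ⟨H.1, fun i j hij => ?_⟩
  by_cases hi : i = k
  · subst hi
    refine (H.2 i j hij).shift 1 ?_
    rw [shiftVar_self, shiftVar_of_ne z hij.symm]
    push_cast; ring
  · by_cases hj : j = k
    · subst hj
      refine (H.2 i j hij).shift (-1) ?_
      rw [shiftVar_self, shiftVar_of_ne z hij]
      push_cast; ring
    · rw [shiftVar_of_ne z hi, shiftVar_of_ne z hj]
      exact H.2 i j hij

theorem pairWeight_symm (hs : IsSigma s) (z : Fin n → ℂ) (x : Fin n → ℕ) (i j : Fin n) :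
    pairWeight s h z x i j = pairWeight s h z x j i := by
  unfold pairWeight
  have e1 : z i - z j + ((x i : ℂ) - x j) * h = -(z j - z i + ((x j : ℂ) - x i) * h) := by ring
  rw [e1, hs.odd, hs.sub_comm (z i) (z j), add_comm (z i) (z j), add_comm (x i) (x j), neg_mul,
    neg_mul, neg_div_neg_eq, mul_right_comm]

/-- Raising `x k` and shifting `z k` lead to the same point `z k + (x k + 1) * h`. Hence only pairs
through `k` change, and their change is telescoping. The product over `j` on the left is the partial
fraction numerator with which this is combined. -/
theorem baseWeight_shift (hs : IsSigma s) {z : Fin n → ℂ} (H : GenericVars s h z)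
    (x : Fin n → ℕ) (k : Fin n) :
    baseWeight s h z (incr x k) * ∏ j, s (z k - (z j + incr x k j * h))
      = -(baseWeight s h (shiftVar h z k) x * ∏ j, if j = k then 1 else s (z k + z j)) := by
  have h1 := prod_pairs_compare (W := pairWeight s h z (incr x k))
    (W' := pairWeight s h (shiftVar h z k) x) (fun i j _ => pairWeight_symm hs _ _ i j)
    (fun i j _ => pairWeight_symm hs _ _ i j) k (fun j => s (z k + z j))
    (fun j => s (z k - (z j + incr x k j * h))) (fun i j _ hi hj => by
      unfold pairWeight
      rw [shiftVar_of_ne z hi, shiftVar_of_ne z hj, incr_of_ne x hi, incr_of_ne x hj])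
    (fun j hj => by
      unfold pairWeight
      rw [shiftVar_self, shiftVar_of_ne z hj, incr_self, incr_of_ne x hj]
      have n1 := (H.2 k j hj.symm).at 0 (by simp : z k - z j = _)
      have n2 := (H.2 k j hj.symm).sp 1 (by push_cast; ring : h + z k - z j = _) (x k + 1)
      have n3 := (H.2 j k hj).sp 1 (by push_cast; ring : h + z j - z k = _) (x j)
      have n4 := (H.2 j k hj).sp 0 (by simp : z j - z k = _) (x j)
      have n5 := (H.2 k j hj.symm).at 1 (by push_cast; ring : z k + h - z j = _)
      have n6 := (H.2 k j hj.symm).sp 2 (by push_cast; ring : h + (z k + h) - z j = _) (x k)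
      have f1 : s (z k + z j) * sp s h (z k + h + z j) (x k + x j)
          = sp s h (z k + z j) (x k + 1 + x j) := by
        rw [show x k + 1 + x j = x k + x j + 1 by ring, sp_succ']
        congr 2; ring
      have f2 : sp s h (h + z k - z j) (x k + 1) = s (z k + h - z j) * sp s h (h + (z k + h) - z j) (x k) := by
        rw [sp_succ']
        congr 2 <;> ring
      have f3 := sp_shift (s := s) (h := h) (z j - z k) (x j)
      have e1 : z k + h - z j + ((x k : ℂ) - x j) * h = z k - z j + (((x k + 1 : ℕ) : ℂ) - x j) * h := by
        push_cast; ring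
      have e2 : h + z j - (z k + h) = z j - z k := by ring
      have e3 : z k - (z j + x j * h) = -(z j - z k + x j * h) := by ring
      have e4 : z j - z k + h = h + z j - z k := by ring
      rw [e4] at f3
      rw [e1, e2, e3, hs.odd, ← f1, f2, hs.sub_comm (z k) (z j)]
      rw [hs.sub_comm (z k) (z j)] at n1
      rw [f2] at n2
      have n7 := neg_ne_zero.1 n1
      field_simp
      linear_combination (s (z k - z j + (((x k + 1 : ℕ) : ℂ) - x j) * h)
        * sp s h (z k + h + z j) (x k + x j) * s (z k + z j)) * f3)
  unfold baseWeight
  have hd : ∏ i, (sp s h h (incr x k i))⁻¹ = (∏ i, (sp s h h (x i))⁻¹) * (s (h + x k * h))⁻¹ := by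
    rw [← Finset.mul_prod_erase _ _ (Finset.mem_univ k),
      ← Finset.mul_prod_erase _ (fun i => (sp s h h (x i))⁻¹) (Finset.mem_univ k), incr_self,
      sp_succ, mul_inv]
    have : ∏ i ∈ univ.erase k, (sp s h h (incr x k i))⁻¹ = ∏ i ∈ univ.erase k, (sp s h h (x i))⁻¹ :=
      Finset.prod_congr rfl fun i hi => by rw [incr_of_ne x (Finset.ne_of_mem_erase hi)]
    rw [this]; ring
  -- The diagonal factor `j = k` is `-s (h + x k * h)`. It cancels the last factor of `(h)_{x k +
  -- 1}` and accounts for the minus sign.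
  have hp : ∏ j, s (z k - (z j + incr x k j * h))
      = -s (h + x k * h) * ∏ j, if j = k then 1 else s (z k - (z j + incr x k j * h)) := by
    rw [← Finset.mul_prod_erase _ _ (Finset.mem_univ k),
      ← Finset.mul_prod_erase _ (fun j => if j = k then 1 else _) (Finset.mem_univ k), if_pos rfl,
      incr_self, one_mul, ← hs.odd]
    congr 1
    · congr 1; push_cast; ring
    · exact Finset.prod_congr rfl fun i hi => by rw [if_neg (Finset.ne_of_mem_erase hi)]
  have hk : s (h + x k * h) ≠ 0 := by
    have := H.1 (x k + 1) (by omega)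
    convert this using 2
    push_cast; ring
  rw [hd, hp, mul_right_comm (∏ i, ∏ j ∈ Finset.Ioi i, pairWeight s h (shiftVar h z k) x i j), h1]
  generalize s (h + x k * h) = S at hk
  generalize ∏ i, (sp s h h (x i))⁻¹ = P
  generalize (∏ j, if j = k then (1 : ℂ) else s (z k - (z j + incr x k j * h))) = R
  field_simp

/-- Here `a` and `z k` both move by `h`. Thus `a + z k` moves by `2h` and `a - z k` not at all,
while all other `a ± z i` move by `h`; this explains the exceptional factors at `k`. -/
theorem coreWeight_shift (hs : IsSigma s) {z : Fin n → ℂ} (H : GenericVars s h z) {a : ℂ}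
    (ha : ∀ i, NZ s h (a + z i)) (ha' : ∀ i, NZ s h (a - z i)) (x : Fin n → ℕ) (k : Fin n) :
    coreWeight s h a z (incr x k) * ((∏ j, s (z k - (z j + incr x k j * h)))
        * s (a + z k + (∑ l, x l + 1) * h))
      = -(coreWeight s h (a + h) (shiftVar h z k) x * ((∏ j, if j = k then 1 else s (z k + z j))
        * ((∏ i, s (a + h + z i)) * s (a + 2 * h + z k)
          / ∏ i, if i = k then 1 else s (a + h - z i)))) := by
  have hb := baseWeight_shift hs H x k
  set X := ∑ l, x l with hX
  have hw : (∏ i, wellPoised s h a z (incr x k) (X + 1) i) * s (a + z k + (X + 1) * h)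
      = (∏ i, wellPoised s h (a + h) (shiftVar h z k) x X i)
        * ((∏ i, s (a + h + z i)) * s (a + 2 * h + z k)
          / ∏ i, if i = k then 1 else s (a + h - z i)) := by
    have hxX : ∀ i, x i ≤ X := fun i =>
      Finset.single_le_sum (fun _ _ => Nat.zero_le _) (Finset.mem_univ i)
    have hk : wellPoised s h a z (incr x k) (X + 1) k * s (a + z k + (X + 1) * h)
        = wellPoised s h (a + h) (shiftVar h z k) x X k * (s (a + h + z k) * s (a + 2 * h + z k)) := by
      unfold wellPoised
      rw [shiftVar_self, incr_self]
      have e0 : X + 1 - (x k + 1) = X - x k := by omega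
      have e1 : a + h + (z k + h) + ((X : ℂ) + x k) * h
          = a + z k + (((X + 1 : ℕ) : ℂ) + ((x k + 1 : ℕ) : ℂ)) * h := by push_cast; ring
      have e2 : a + h + h - (z k + h) = a + h - z k := by ring
      have e3 : a + h + (z k + h) = a + 2 * h + z k := by ring
      have n1 := (ha k).at 0 (by simp : a + z k = _)
      have n2 := (ha k).at 2 (by push_cast; ring : a + 2 * h + z k = _)
      have n3 := (ha' k).sp 1 (by push_cast; ring : a + h - z k = _) (X - x k)
      have f := sp_shift (s := s) (h := h) (a + z k + h) X
      have e4 : a + z k + h + h = a + 2 * h + z k := by ring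
      have e5 : a + z k + h + X * h = a + z k + (X + 1) * h := by ring
      have e6 : a + h + z k = a + z k + h := by ring
      rw [e4, e5] at f
      rw [e0, e1, e2, e3, e6, sp_succ']
      generalize sp s h (a + 2 * h + z k) X = E at f ⊢
      generalize s (a + z k + (X + 1) * h) = A at f ⊢
      generalize s (a + 2 * h + z k) = B at n2 ⊢
      generalize s (a + z k + (((X + 1 : ℕ) : ℂ) + ((x k + 1 : ℕ) : ℂ)) * h) = C
      field_simp
      linear_combination (-C) * f
    have hi : ∀ i, i ≠ k → wellPoised s h a z (incr x k) (X + 1) i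
        = wellPoised s h (a + h) (shiftVar h z k) x X i * (s (a + h + z i) / s (a + h - z i)) := by
      intro i hi
      unfold wellPoised
      rw [shiftVar_of_ne z hi, incr_of_ne x hi]
      have e1 : a + h + z i + ((X : ℂ) + x i) * h = a + z i + (((X + 1 : ℕ) : ℂ) + x i) * h := by
        push_cast; ring
      have e2 : X + 1 - x i = X - x i + 1 := by have := hxX i; omega
      have e3 : a + h - z i + h = a + h + h - z i := by ring
      have e4 : a + z i + h = a + h + z i := by ring
      have n1 := (ha i).at 0 (by simp : a + z i = _)
      have n2 := (ha i).at 1 (by push_cast; ring : a + h + z i = _)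
      have n3 := (ha' i).at 1 (by push_cast; ring : a + h - z i = _)
      have n4 := (ha' i).sp 2 (by push_cast; ring : a + h + h - z i = _) (X - x i)
      rw [e1, e2, sp_succ', sp_succ', e3, e4]
      field_simp
    rw [← Finset.mul_prod_erase _ _ (Finset.mem_univ k),
      ← Finset.mul_prod_erase _ (fun i => wellPoised s h (a + h) (shiftVar h z k) x X i)
        (Finset.mem_univ k), ← Finset.mul_prod_erase _ (fun i => s (a + h + z i)) (Finset.mem_univ k),
      ← Finset.mul_prod_erase _ (fun i => if i = k then 1 else s (a + h - z i)) (Finset.mem_univ k),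
      if_pos rfl, mul_right_comm, hk, one_mul]
    have h3 : ∏ i ∈ univ.erase k, wellPoised s h a z (incr x k) (X + 1) i
        = (∏ i ∈ univ.erase k, wellPoised s h (a + h) (shiftVar h z k) x X i)
          * ((∏ i ∈ univ.erase k, s (a + h + z i))
            / ∏ i ∈ univ.erase k, if i = k then 1 else s (a + h - z i)) := by
      rw [← Finset.prod_div_distrib, ← Finset.prod_mul_distrib]
      refine Finset.prod_congr rfl fun i hi' => ?_
      have := Finset.ne_of_mem_erase hi'
      rw [hi i this, if_neg this]
    rw [h3]
    ring
  unfold coreWeight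
  rw [sum_incr, ← hX]
  rw [mul_mul_mul_comm, hb, hw]
  ring

variable (s h)

/-- The quotient `∏ (t + z_i)_{x_i} / (a + h - t)_X`. -/
def upFac (a t : ℂ) (z : Fin n → ℂ) (x : Fin n → ℕ) : ℂ :=
  (∏ i, sp s h (t + z i) (x i)) / sp s h (a + h - t) (∑ l, x l)

/-- The quotient `(a + h - t)_X / ∏ (t + z_i)_{x_i}`. -/
def downFac (a t : ℂ) (z : Fin n → ℂ) (x : Fin n → ℕ) : ℂ :=
  sp s h (a + h - t) (∑ l, x l) / ∏ i, sp s h (t + z i) (x i)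

variable {s h}

theorem prod_sp_incr (t : ℂ) (z : Fin n → ℂ) (x : Fin n → ℕ) (k : Fin n) :
    ∏ i, sp s h (t + z i) (incr x k i) = s (t + z k) * ∏ i, sp s h (t + shiftVar h z k i) (x i) := by
  rw [← Finset.mul_prod_erase _ _ (Finset.mem_univ k),
    ← Finset.mul_prod_erase _ (fun i => sp s h (t + shiftVar h z k i) (x i)) (Finset.mem_univ k),
    incr_self, shiftVar_self, sp_succ', add_assoc, mul_assoc]
  congr 2
  refine Finset.prod_congr rfl fun i hi => ?_
  rw [incr_of_ne x (Finset.ne_of_mem_erase hi), shiftVar_of_ne z (Finset.ne_of_mem_erase hi)]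

theorem upFac_shift (a t : ℂ) (z : Fin n → ℂ) (x : Fin n → ℕ) (k : Fin n) :
    upFac s h a t z (incr x k)
      = upFac s h (a + h) t (shiftVar h z k) x * (s (t + z k) / s (a + h - t)) := by
  unfold upFac
  rw [prod_sp_incr, sum_incr, sp_succ', show a + h - t + h = a + h + h - t by ring, mul_div_mul_comm,
    mul_comm]

theorem downFac_shift (a t : ℂ) (z : Fin n → ℂ) (x : Fin n → ℕ) (k : Fin n) :
    downFac s h a t z (incr x k)
      = downFac s h (a + h) t (shiftVar h z k) x * (s (a + h - t) / s (t + z k)) := by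
  unfold downFac
  rw [prod_sp_incr, sum_incr, sp_succ', show a + h - t + h = a + h + h - t by ring, mul_div_mul_comm,
    mul_comm]

/-- The summand at the vertex `k` of the partial fraction expansion of a difference of
well-poised quotients. -/
theorem wellPoised_difference (hs : IsSigma s) {z : Fin n → ℂ} (H : GenericVars s h z)
    (a c d : ℂ) (hc : ∀ i, s (c + z i) ≠ 0) (hd : ∀ i, s (d + z i) ≠ 0) (hcd : s (d - c) ≠ 0)
    (hac : s (a - c) ≠ 0) (had : s (a - d) ≠ 0) (x : Fin n → ℕ) :
    (∏ j, s (c + z j + x j * h) / s (c + z j)) * (s (a - c + (∑ l, x l) * h) / s (a - c))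
      - (∏ j, s (d + z j + x j * h) / s (d + z j)) * (s (a - d + (∑ l, x l) * h) / s (a - d))
      = s (d - c) / (s (a - c) * s (a - d))
        * ∑ k, (∏ j, s (z k - (z j + x j * h)) / (if j = k then 1 else s (z k - z j)))
          * (s (a + z k + (∑ l, x l) * h) * s (z k + c + d - a) / (s (c + z k) * s (d + z k))) := by
  have hz : ∀ i j, i ≠ j → s (z i - z j) ≠ 0 := fun i j hij => (H.2 i j hij).at 0 (by simp)
  set X : ℂ := (∑ l, (x l : ℂ)) with hX
  have hXc : ((∑ l, x l : ℕ) : ℂ) = X := by push_cast; rfl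
  -- Two poles `-c`, `-d` are added to the `z i`; their residues are the two products on the left.
  -- Among the added zeros, `-a - X*h` is the one wanted and `a - c - d` is then dictated by
  -- balancing.
  let zz : Option (Option (Fin n)) → ℂ := fun i => i.elim (-c) fun i => i.elim (-d) z
  let ww : Option (Option (Fin n)) → ℂ := fun i =>
    i.elim (-a - X * h) fun i => i.elim (a - c - d) fun i => z i + x i * h
  have hg := gustafsonSum_eq_zero hs (z := zz) (w := ww) (S := Finset.univ) (by
    intro i _ j _ hij
    rcases i with _ | _ | i <;> rcases j with _ | _ | j
    · exact absurd rfl hij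
    · simp only [zz, Option.elim]; rwa [show -c - -d = d - c by ring]
    · simp only [zz, Option.elim]
      rw [show -c - z j = -(c + z j) by ring, hs.odd]
      exact neg_ne_zero.2 (hc j)
    · simp only [zz, Option.elim]
      rw [show -d - -c = -(d - c) by ring, hs.odd]
      exact neg_ne_zero.2 hcd
    · exact absurd rfl hij
    · simp only [zz, Option.elim]
      rw [show -d - z j = -(d + z j) by ring, hs.odd]
      exact neg_ne_zero.2 (hd j)
    · simp only [zz, Option.elim]; rw [show z i - -c = c + z i by ring]; exact hc i
    · simp only [zz, Option.elim]; rw [show z i - -d = d + z i by ring]; exact hd i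
    · exact hz i j fun e => hij (by rw [e])) (by
    simp only [Fintype.sum_option, zz, ww, Option.elim]
    rw [Finset.sum_add_distrib, ← Finset.sum_mul, ← hX]
    ring)
  unfold gustafsonSum at hg
  simp only [Fintype.sum_option, Fintype.prod_option, zz, ww, Option.elim, Option.some.injEq,
    reduceCtorEq, if_true, if_false, div_one] at hg
  have p1 : ∀ t : ℂ, ∏ j, s (-t - (z j + x j * h)) / s (-t - z j)
      = ∏ j, s (t + z j + x j * h) / s (t + z j) := fun t => Finset.prod_congr rfl fun j _ => by
    rw [show -t - (z j + x j * h) = -(t + z j + x j * h) by ring,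
      show -t - z j = -(t + z j) by ring, hs.odd, hs.odd, neg_div_neg_eq]
  have p2 : ∀ k, (s (z k - (-a - X * h)) / s (z k - -c) * (s (z k - (a - c - d)) / s (z k - -d)
      * ∏ j, s (z k - (z j + x j * h)) / (if j = k then 1 else s (z k - z j))))
      = (∏ j, s (z k - (z j + x j * h)) / (if j = k then 1 else s (z k - z j)))
          * (s (a + z k + X * h) * s (z k + c + d - a) / (s (c + z k) * s (d + z k))) := fun k => by
    rw [show z k - (-a - X * h) = a + z k + X * h by ring, show z k - -c = c + z k by ring,
      show z k - -d = d + z k by ring, show z k - (a - c - d) = z k + c + d - a by ring]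
    ring
  rw [p1, p1, Finset.sum_congr rfl fun k _ => p2 k] at hg
  simp only [Nat.cast_sum, ← hX]
  rw [show -c - (-a - X * h) = a - c + X * h by ring, show -c - (a - c - d) = -(a - d) by ring,
    show -c - -d = d - c by ring, show -d - -c = -(d - c) by ring,
    show -d - (-a - X * h) = a - d + X * h by ring, show -d - (a - c - d) = -(a - c) by ring,
    hs.odd, hs.odd, hs.odd] at hg
  set S := ∑ k, (∏ j, s (z k - (z j + x j * h)) / (if j = k then 1 else s (z k - z j)))
          * (s (a + z k + X * h) * s (z k + c + d - a) / (s (c + z k) * s (d + z k)))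
  have hS : S = (∏ j, s (c + z j + x j * h) / s (c + z j)) * (s (a - c + X * h) * s (a - d) / s (d - c))
      - (∏ j, s (d + z j + x j * h) / s (d + z j)) * (s (a - d + X * h) * s (a - c) / s (d - c)) := by
    field_simp at hg ⊢
    linear_combination hg
  rw [hS]
  generalize (∏ j, s (c + z j + x j * h) / s (c + z j)) = P
  generalize (∏ j, s (d + z j + x j * h) / s (d + z j)) = Q
  generalize s (a - c + X * h) = A
  generalize s (a - d + X * h) = B
  field_simp

end Weights

end EllipticBailey
end

noncomputable section

namespace EllipticBailey

open Finset

/-! ### The Jackson-type sum and its contiguous relation. -/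

section Jackson

variable {s : ℂ → ℂ} {h : ℂ} {n : ℕ}

variable (s h) in
/-- The ratio of the sum and difference products at the vertex `k`. -/
def vertexRatio (z : Fin n → ℂ) (k : Fin n) : ℂ :=
  (∏ j, if j = k then 1 else s (z k + z j)) / ∏ j, if j = k then 1 else s (z k - z j)

variable (s h) in
/-- The constant in the residue of `coreWeight` at the vertex `k`. -/
def coreConst (a : ℂ) (z : Fin n → ℂ) (k : Fin n) : ℂ :=
  vertexRatio s z k * ((∏ i, s (a + h + z i)) * s (a + 2 * h + z k)
    / ∏ i, if i = k then 1 else s (a + h - z i))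

theorem coreWeight_residue (hs : IsSigma s) {z : Fin n → ℂ} (H : GenericVars s h z) {a : ℂ}
    (ha : ∀ i, NZ s h (a + z i)) (ha' : ∀ i, NZ s h (a - z i)) (x : Fin n → ℕ) (k : Fin n) :
    coreWeight s h a z (incr x k)
        * ((∏ j, s (z k - (z j + incr x k j * h)) / (if j = k then 1 else s (z k - z j)))
          * s (a + z k + (∑ l, incr x k l : ℕ) * h))
      = -(coreWeight s h (a + h) (shiftVar h z k) x * coreConst s h a z k) := by
  have h1 := coreWeight_shift hs H ha ha' x k
  rw [Finset.prod_div_distrib, sum_incr]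
  push_cast
  unfold coreConst vertexRatio
  push_cast at h1
  linear_combination (∏ j, if j = k then (1 : ℂ) else s (z k - z j))⁻¹ * h1

/-- Moving `t` by `h` multiplies by a well-poised quotient in `t`; for `downFac` the effect is the
opposite. Differences of neighbouring sums are thereby reduced to `wellPoised_difference`. -/
theorem upFac_step {z : Fin n → ℂ} (a t : ℂ) (ht : ∀ i, s (t + z i) ≠ 0) (hat : s (a - t) ≠ 0)
    (x : Fin n → ℕ) (hX : sp s h (a + h - t) (∑ l, x l) ≠ 0) (hX' : sp s h (a - t) (∑ l, x l) ≠ 0) :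
    upFac s h a (t + h) z x = upFac s h a t z x * ((∏ j, s (t + z j + x j * h) / s (t + z j))
      * (s (a - t + (∑ l, x l : ℕ) * h) / s (a - t))) := by
  unfold upFac
  have h1 : ∏ i, sp s h (t + h + z i) (x i)
      = (∏ i, sp s h (t + z i) (x i)) * ∏ j, s (t + z j + x j * h) / s (t + z j) := by
    rw [← Finset.prod_mul_distrib]
    refine Finset.prod_congr rfl fun i _ => ?_
    have := sp_shift (s := s) (h := h) (t + z i) (x i)
    rw [show t + h + z i = t + z i + h by ring, ← mul_div_assoc, ← this, mul_div_cancel_left₀ _ (ht i)]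
  have h2 := sp_shift (s := s) (h := h) (a - t) (∑ l, x l)
  rw [h1, show a + h - (t + h) = a - t by ring]
  rw [show a - t + h = a + h - t by ring] at h2
  generalize ∏ j, s (t + z j + x j * h) / s (t + z j) = P
  generalize ∏ i, sp s h (t + z i) (x i) = Q
  generalize sp s h (a + h - t) (∑ l, x l) = A at *
  generalize sp s h (a - t) (∑ l, x l) = B at *
  generalize s (a - t + (∑ l, x l : ℕ) * h) = C at *
  field_simp
  linear_combination Q * P * h2

theorem downFac_step {z : Fin n → ℂ} (a t : ℂ) (ht : ∀ i, NZ s h (t + z i)) (hat : s (a - t) ≠ 0)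
    (x : Fin n → ℕ) :
    downFac s h a t z x = downFac s h a (t + h) z x * ((∏ j, s (t + z j + x j * h) / s (t + z j))
      * (s (a - t + (∑ l, x l : ℕ) * h) / s (a - t))) := by
  unfold downFac
  have h0 : ∏ i, sp s h (t + z i) (x i) ≠ 0 :=
    Finset.prod_ne_zero_iff.2 fun i _ => (ht i).sp 0 (by simp) _
  have h0' : ∏ i, s (t + z i + x i * h) / s (t + z i) ≠ 0 :=
    Finset.prod_ne_zero_iff.2 fun i _ => div_ne_zero ((ht i).at (x i) (by push_cast; ring))
      ((ht i).at 0 (by simp))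
  have h1 : ∏ i, sp s h (t + h + z i) (x i)
      = (∏ i, sp s h (t + z i) (x i)) * ∏ j, s (t + z j + x j * h) / s (t + z j) := by
    rw [← Finset.prod_mul_distrib]
    refine Finset.prod_congr rfl fun i _ => ?_
    have := sp_shift (s := s) (h := h) (t + z i) (x i)
    rw [show t + h + z i = t + z i + h by ring, ← mul_div_assoc, ← this,
      mul_div_cancel_left₀ _ ((ht i).at 0 (by simp))]
  have h2 := sp_shift (s := s) (h := h) (a - t) (∑ l, x l)
  rw [h1, show a + h - (t + h) = a - t by ring]
  rw [show a - t + h = a + h - t by ring] at h2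
  generalize ∏ j, s (t + z j + x j * h) / s (t + z j) = P at *
  generalize ∏ i, sp s h (t + z i) (x i) = Q at *
  generalize sp s h (a + h - t) (∑ l, x l) = A at *
  generalize sp s h (a - t) (∑ l, x l) = B at *
  generalize s (a - t + (∑ l, x l : ℕ) * h) = C at *
  field_simp
  linear_combination h2

variable (s h) in
/-- The summand of the Jackson-type summation. -/
def jacksonTerm (a e f g u : ℂ) (z : Fin n → ℂ) (N : ℕ) (x : Fin n → ℕ) : ℂ :=
  coreWeight s h a z x * (upFac s h a u z x * (upFac s h a e z x * upFac s h a f z x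
    * upFac s h a g z x)) * downFac s h a (a + (N + 1) * h) z x

variable (s h) in
/-- The parity-dependent factor of the Jackson-type summation. -/
def jacksonParity (a e f g u Z : ℂ) (n N : ℕ) : ℂ :=
  if Odd n then sp s h (a + h - Z) N * (sp s h (a + h - u - e - Z) N * sp s h (a + h - u - f - Z) N
    * sp s h (a + h - u - g - Z) N)
  else sp s h (a + h - u - Z) N * (sp s h (a + h - e - Z) N * sp s h (a + h - f - Z) N
    * sp s h (a + h - g - Z) N)

variable (s h) in
/-- The value of the Jackson-type sum. -/
def jacksonValue (a e f g u : ℂ) (z : Fin n → ℂ) (N : ℕ) : ℂ :=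
  (∏ i, sp s h (a + h + z i) N) / (∏ i, sp s h (a + h - z i) N)
    / (sp s h (a + h - u) N * (sp s h (a + h - e) N * sp s h (a + h - f) N * sp s h (a + h - g) N))
    * jacksonParity s h a e f g u (∑ i, z i) n N

variable (s h) in
/-- Genericity of the parameters of the Jackson-type summation. -/
structure JacksonGeneric (a e f g u : ℂ) (z : Fin n → ℂ) : Prop where
  vars : GenericVars s h z
  az : ∀ i, NZ s h (a + z i)
  az' : ∀ i, NZ s h (a - z i)
  uz : ∀ i, NZ s h (u + z i)
  au : NZ s h (a - u)
  ae : NZ s h (a - e)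
  af : NZ s h (a - f)
  ag : NZ s h (a - g)

theorem JacksonGeneric.shift {a e f g u : ℂ} {z : Fin n → ℂ} (H : JacksonGeneric s h a e f g u z)
    (k : Fin n) : JacksonGeneric s h (a + h) e f g u (shiftVar h z k) where
  vars := H.vars.shift k
  az i := by
    by_cases hi : i = k
    · subst hi; exact (H.az i).shift 2 (by rw [shiftVar_self]; push_cast; ring)
    · exact (H.az i).shift 1 (by rw [shiftVar_of_ne z hi]; push_cast; ring)
  az' i := by
    by_cases hi : i = k
    · subst hi; exact (H.az' i).shift 0 (by rw [shiftVar_self]; push_cast; ring)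
    · exact (H.az' i).shift 1 (by rw [shiftVar_of_ne z hi]; push_cast; ring)
  uz i := by
    by_cases hi : i = k
    · subst hi; exact (H.uz i).shift 1 (by rw [shiftVar_self]; push_cast; ring)
    · exact (H.uz i).shift 0 (by rw [shiftVar_of_ne z hi]; push_cast; ring)
  au := H.au.shift 1 (by push_cast; ring)
  ae := H.ae.shift 1 (by push_cast; ring)
  af := H.af.shift 1 (by push_cast; ring)
  ag := H.ag.shift 1 (by push_cast; ring)

theorem JacksonGeneric.step {a e f g u u' : ℂ} {z : Fin n → ℂ} (H : JacksonGeneric s h a e f g u z)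
    (m : ℤ) (hu : u' = u + m * h) : JacksonGeneric s h a e f g u' z :=
  { H with
    uz := fun i => (H.uz i).shift m (by rw [hu]; ring)
    au := H.au.shift (-m) (by rw [hu]; push_cast; ring) }

variable (s h) in
/-- The coefficients of the contiguous relation. -/
def jacksonCoeff (a e f g u : ℂ) (z : Fin n → ℂ) (M : ℕ) (k : Fin n) : ℂ :=
  -coreConst s h a z k * (s (a + (M + 1) * h - u) / s (a - u)
    * (s (z k + u + (M + 1) * h) / (s (u + z k) * s (a + (M + 1) * h + z k))))
    * ((s (u + z k) / s (a + h - u)) * (s (e + z k) / s (a + h - e) * (s (f + z k) / s (a + h - f))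
      * (s (g + z k) / s (a + h - g)))) / s (a + (M + 2) * h + z k)

theorem mul_int_ne_zero (H : ∀ m : ℤ, m ≠ 0 → s (m * h) ≠ 0) {v : ℂ} (m : ℤ) (hm : m ≠ 0)
    (e : v = m * h) : s v ≠ 0 := e ▸ H m hm

/-- Relative to the common factor containing `(u, M+1)`, the two summands are the well-poised
quotients at `u` and at `d = a + (M+1)h`. Their difference expands over the `z k`, and since each
piece vanishes for `x k = 0`, lowering `x k` turns it into a sum of order `M`. -/
theorem jackson_contiguous (hs : IsSigma s) {a e f g u : ℂ} {z : Fin n → ℂ}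
    (H : JacksonGeneric s h a e f g u z) (M : ℕ) :
    ∑ x ∈ simplex n (M + 1), jacksonTerm s h a e f g (u + h) z (M + 1) x
      = ∑ x ∈ simplex n (M + 1), jacksonTerm s h a e f g u z M x
        + ∑ k, jacksonCoeff s h a e f g u z M k
          * ∑ x ∈ simplex n M, jacksonTerm s h (a + h) e f g u (shiftVar h z k) M x := by
  set d := a + (M + 1) * h with hd
  have e1 : a - d = -((M + 1) * h) := by rw [hd]; ring
  have hdh : a + (((M + 1 : ℕ) : ℂ) + 1) * h = d + h := by rw [hd]; push_cast; ring
  have had : s (a - d) ≠ 0 := mul_int_ne_zero H.vars.1 (-(M + 1)) (by omega) (by rw [e1]; push_cast; ring)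
  have hau : s (a - u) ≠ 0 := H.au.at 0 (by simp)
  have hdz : ∀ i, NZ s h (d + z i) := fun i => (H.az i).shift (M + 1) (by rw [hd]; push_cast; ring)
  let T : Fin n → (Fin n → ℕ) → ℂ := fun k x =>
    coreWeight s h a z x * (upFac s h a u z x * (upFac s h a e z x * upFac s h a f z x
      * upFac s h a g z x)) * downFac s h a (d + h) z x * (s (d - u) / (s (a - u) * s (a - d)))
      * ((∏ j, s (z k - (z j + x j * h)) / (if j = k then 1 else s (z k - z j)))
          * (s (a + z k + (∑ l, x l : ℕ) * h) * s (z k + u + d - a) / (s (u + z k) * s (d + z k))))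
  have hT : ∀ x, jacksonTerm s h a e f g (u + h) z (M + 1) x - jacksonTerm s h a e f g u z M x
      = ∑ k, T k x := by
    intro x
    have h1 := upFac_step (h := h) (z := z) a u (fun i => (H.uz i).at 0 (by simp)) hau x
      (H.au.sp 1 (by push_cast; ring) _) (H.au.sp 0 (by simp) _)
    have h2 := downFac_step (h := h) a d hdz had x
    have h3 := wellPoised_difference hs H.vars a u d (fun i => (H.uz i).at 0 (by simp))
      (fun i => (hdz i).at 0 (by simp)) (H.au.at (M + 1) (by rw [hd]; push_cast; ring)) hau had x
    unfold jacksonTerm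
    rw [hdh, ← hd, h1, h2]
    simp only [T]
    rw [← Finset.mul_sum]
    linear_combination (coreWeight s h a z x * (upFac s h a u z x * (upFac s h a e z x
      * upFac s h a f z x * upFac s h a g z x)) * downFac s h a (d + h) z x) * h3
  rw [← sub_eq_iff_eq_add', ← Finset.sum_sub_distrib, Finset.sum_congr rfl fun x _ => hT x,
    Finset.sum_comm]
  refine Finset.sum_congr rfl fun k _ => ?_
  rw [sum_simplex_succ, Finset.mul_sum]
  · refine Finset.sum_congr rfl fun x _ => ?_
    have h1 := coreWeight_residue hs H.vars H.az H.az' x k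
    simp only [T]
    unfold jacksonTerm jacksonCoeff
    have e2 : a + h + ((M : ℂ) + 1) * h = d + h := by rw [hd]; ring
    have e3 : z k + u + ((M : ℂ) + 1) * h = z k + u + d - a := by rw [hd]; ring
    have e4 : a + ((M : ℂ) + 2) * h + z k = d + h + z k := by rw [hd]; ring
    have e5 : a + h - (d + h) = a - d := by ring
    rw [upFac_shift, upFac_shift, upFac_shift, upFac_shift, downFac_shift, e2, e3, e4, e5, ← hd]
    generalize (∏ j, s (z k - (z j + incr x k j * h)) / (if j = k then 1 else s (z k - z j))) = P at *
    generalize s (a + z k + (∑ l, incr x k l : ℕ) * h) = A at *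
    generalize coreWeight s h a z (incr x k) = W at *
    rw [show ∀ B C D E F : ℂ, W * B * C * D * (P * (A * E / F)) = W * (P * A) * (B * C * D * E / F) by
      intros; ring, h1]
    have n1 : s (d + z k) ≠ 0 := (hdz k).at 0 (by simp)
    generalize s (a - d) = ad at *
    clear h1
    generalize coreConst s h a z k = CC
    generalize coreWeight s h (a + h) (shiftVar h z k) x = C''
    generalize upFac s h (a + h) u (shiftVar h z k) x = U1
    generalize upFac s h (a + h) e (shiftVar h z k) x = U2
    generalize upFac s h (a + h) f (shiftVar h z k) x = U3
    generalize upFac s h (a + h) g (shiftVar h z k) x = U4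
    generalize downFac s h (a + h) (d + h) (shiftVar h z k) x = D
    generalize s (z k + u + d - a) = Y
    generalize s (u + z k) / s (a + h - u) = Y1
    generalize s (e + z k) / s (a + h - e) = Y2
    generalize s (f + z k) / s (a + h - f) = Y3
    generalize s (g + z k) / s (a + h - g) = Y4
    generalize s (d + h + z k) = Y5
    generalize s (u + z k) * s (d + z k) = Y6
    rw [show s (d - u) / (s (a - u) * ad) = s (d - u) / s (a - u) * ad⁻¹ by
      rw [div_mul_eq_div_div, div_eq_mul_inv _ ad]]
    generalize s (d - u) / s (a - u) = Y7
    have hc : ad⁻¹ * ad = 1 := inv_mul_cancel₀ had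
    simp only [div_eq_mul_inv]
    linear_combination (-C'' * CC * (U1 * Y1 * (U2 * Y2 * (U3 * Y3) * (U4 * Y4)) * (D * Y5⁻¹) * Y7 * (Y * Y6⁻¹))) * hc
  · intro x hx
    simp only [T]
    rw [← Finset.mul_prod_erase _ _ (Finset.mem_univ k), hx]
    simp [hs.zero]

/-- The factor `(-M*h)_{M+1}` contains `s 0`. The extra layer of the simplex in the contiguous
relation is therefore harmless. -/
theorem jacksonTerm_eq_zero (hs : IsSigma s) {a e f g u : ℂ} {z : Fin n → ℂ} (M : ℕ)
    {x : Fin n → ℕ} (hx : ∑ i, x i = M + 1) : jacksonTerm s h a e f g u z M x = 0 := by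
  unfold jacksonTerm downFac
  rw [hx, sp_succ, show a + h - (a + ((M : ℂ) + 1) * h) + M * h = 0 by ring, hs.zero]
  ring

theorem sum_jacksonTerm_succ (hs : IsSigma s) {a e f g u : ℂ} {z : Fin n → ℂ} (M : ℕ) :
    ∑ x ∈ simplex n (M + 1), jacksonTerm s h a e f g u z M x
      = ∑ x ∈ simplex n M, jacksonTerm s h a e f g u z M x := by
  symm
  refine Finset.sum_subset (fun x hx => ?_) fun x hx hx' => ?_
  · rw [mem_simplex] at *; omega
  · rw [mem_simplex] at *
    exact jacksonTerm_eq_zero hs M (by omega)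

end Jackson

end EllipticBailey
end

noncomputable section

namespace EllipticBailey

open Finset

/-! ### The closed form of the Jackson-type sum. -/

section JacksonValue

variable {s : ℂ → ℂ} {h : ℂ} {n : ℕ}

theorem prod_mul_vertex (k : Fin n) {F G R : Fin n → ℂ} {c : ℂ} (hk : F k * c = G k)
    (hi : ∀ i, i ≠ k → F i * R i = G i) :
    (∏ i, F i) * ((∏ i, if i = k then 1 else R i) * c) = ∏ i, G i := by
  rw [← Finset.mul_prod_erase _ F (Finset.mem_univ k), ← Finset.mul_prod_erase _ G (Finset.mem_univ k),
    ← Finset.mul_prod_erase _ (fun i => if i = k then 1 else R i) (Finset.mem_univ k), if_pos rfl,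
    ← hk]
  have : ∏ i ∈ univ.erase k, G i
      = (∏ i ∈ univ.erase k, F i) * ∏ i ∈ univ.erase k, (if i = k then 1 else R i) := by
    rw [← Finset.prod_mul_distrib]
    refine Finset.prod_congr rfl fun i h' => ?_
    rw [if_neg (Finset.ne_of_mem_erase h'), hi i (Finset.ne_of_mem_erase h')]
  rw [this]
  ring

theorem prod_sp_add_shiftVar (a : ℂ) (z : Fin n → ℂ) (k : Fin n) (M : ℕ) :
    (∏ i, sp s h (a + h + h + shiftVar h z k i) M) * ((∏ i, s (a + h + z i)) * s (a + 2 * h + z k))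
      = (∏ i, sp s h (a + h + z i) (M + 1)) * s (a + (M + 2) * h + z k) := by
  have h1 := prod_mul_vertex k (F := fun i => sp s h (a + h + h + shiftVar h z k i) M)
    (G := fun i => sp s h (a + h + z i) (M + 1) * if i = k then s (a + (M + 2) * h + z k) else 1)
    (R := fun i => s (a + h + z i)) (c := s (a + h + z k) * s (a + 2 * h + z k))
    (by
      simp only [if_true]
      rw [shiftVar_self]
      have := sp_shift_two (s := s) (h := h) (a + h + z k) M
      rw [show a + h + z k + h = a + 2 * h + z k by ring,
        show a + h + z k + 2 * h = a + h + h + (z k + h) by ring,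
        show a + h + z k + ((M : ℂ) + 1) * h = a + (M + 2) * h + z k by ring] at this
      rw [← this]; ring)
    (fun i hi => by
      simp only [if_neg hi]
      rw [shiftVar_of_ne z hi, sp_succ', show a + h + z i + h = a + h + h + z i by ring]; ring)
  rw [Finset.prod_mul_distrib, Finset.prod_ite_eq' univ k, if_pos (Finset.mem_univ k)] at h1
  rw [← h1, ← Finset.mul_prod_erase _ (fun i => s (a + h + z i)) (Finset.mem_univ k),
    ← Finset.mul_prod_erase _ (fun i => if i = k then 1 else s (a + h + z i)) (Finset.mem_univ k),
    if_pos rfl]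
  have : ∏ i ∈ univ.erase k, (if i = k then 1 else s (a + h + z i))
      = ∏ i ∈ univ.erase k, s (a + h + z i) :=
    Finset.prod_congr rfl fun i h' => if_neg (Finset.ne_of_mem_erase h')
  rw [this]; ring

theorem prod_sp_sub_shiftVar (a : ℂ) (z : Fin n → ℂ) (k : Fin n) (M : ℕ) :
    (∏ i, sp s h (a + h + h - shiftVar h z k i) M)
        * ((∏ i, if i = k then 1 else s (a + h - z i)) * s (a + (M + 1) * h - z k))
      = ∏ i, sp s h (a + h - z i) (M + 1) :=
  prod_mul_vertex k (F := fun i => sp s h (a + h + h - shiftVar h z k i) M)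
    (G := fun i => sp s h (a + h - z i) (M + 1)) (R := fun i => s (a + h - z i))
    (by
      rw [shiftVar_self, sp_succ]
      congr 2 <;> ring)
    (fun i hi => by
      rw [shiftVar_of_ne z hi, sp_succ', show a + h - z i + h = a + h + h - z i by ring]; ring)

/-- The quadratic sum identity, with a distinguished point `-Q`. -/
theorem quadSum_vertex (hs : IsSigma s) {z : Fin n → ℂ} (hz : ∀ i j, i ≠ j → s (z i - z j) ≠ 0)
    {Q c e f g : ℂ} (hQ : ∀ i, s (Q + z i) ≠ 0) (hb : c + e + f + g + 2 * ∑ i, z i = 2 * Q) :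
    quadValue s c e f g (∑ i, z i - Q) (n + 1)
      = s (Q - c) * s (Q - g) * (s (Q - e) * s (Q - f)) * ∏ i, s (Q - z i) / s (Q + z i)
        - ∑ k, vertexRatio s z k * (s (Q - z k) / s (Q + z k))
          * (s (c + z k) * s (g + z k) * (s (e + z k) * s (f + z k))) := by
  -- Adjoining `-Q` to the variables makes `n + 1` points, so the parity in the value is opposite to
  -- that of `n`.
  let zz : Option (Fin n) → ℂ := fun i => i.elim (-Q) z
  have hg := quadSum_eq_quadValue hs (z := zz) (S := univ) (c := c) (e := e) (f := f) (g := g) (by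
    intro i _ j _ hij
    rcases i with _ | i <;> rcases j with _ | j
    · exact absurd rfl hij
    · simp only [zz, Option.elim]
      rw [show -Q - z j = -(Q + z j) by ring, hs.odd]
      exact neg_ne_zero.2 (hQ j)
    · simp only [zz, Option.elim]; rw [show z i - -Q = Q + z i by ring]; exact hQ i
    · exact hz i j fun e => hij (by rw [e])) (by
    simp only [Fintype.sum_option, zz, Option.elim]
    linear_combination hb)
  unfold quadSum at hg
  simp only [Fintype.sum_option, Fintype.prod_option, zz, Option.elim, Option.some.injEq,
    reduceCtorEq, if_true, if_false, one_mul, Finset.card_univ, Fintype.card_option,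
    Fintype.card_fin] at hg
  rw [show ∑ i, z i - Q = -Q + ∑ i, z i by ring, ← hg]
  have p1 : ∏ j, s (z j + -Q) / s (-Q - z j) = ∏ i, s (Q - z i) / s (Q + z i) :=
    Finset.prod_congr rfl fun j _ => by
      rw [show z j + -Q = -(Q - z j) by ring, show -Q - z j = -(Q + z j) by ring, hs.odd, hs.odd,
        neg_div_neg_eq]
  have p2 : ∀ t : ℂ, s (t + -Q) = -s (Q - t) := fun t => by
    rw [← hs.odd]; congr 1; ring
  rw [p1, p2, p2, p2, p2, sub_eq_add_neg _ (∑ k, _), ← Finset.sum_neg_distrib]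
  congr 1
  · ring
  · refine Finset.sum_congr rfl fun k _ => ?_
    unfold vertexRatio
    rw [show -Q + z k = -(Q - z k) by ring, show z k - -Q = Q + z k by ring, hs.odd]
    have : ∏ j, (if j = k then 1 else s (z j + z k) / s (z k - z j))
        = (∏ j, if j = k then 1 else s (z k + z j)) / ∏ j, if j = k then 1 else s (z k - z j) := by
      rw [← Finset.prod_div_distrib]
      refine Finset.prod_congr rfl fun j _ => ?_
      split_ifs
      · simp
      · rw [add_comm]
    rw [this]; ring

/-- The quotient of consecutive parity factors is exactly the value of the type D sum on `n + 1`
points. Four sign changes occur in either parity and cancel. -/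
theorem jacksonParity_step (hs : IsSigma s) {a e f g u Z : ℂ} (M : ℕ) :
    jacksonParity s h a e f g (u + h) Z n (M + 1) = jacksonParity s h a e f g u Z n M
      * quadValue s (u + (M + 1) * h) e f g (Z - (a + (M + 1) * h)) (n + 1) := by
  have p : ∀ {t v : ℂ}, t = -v → s t = -s v := fun {t v} e => by rw [e, hs.odd]
  unfold jacksonParity quadValue
  by_cases hn : Odd n
  · have hn' : ¬Odd (n + 1) := by
      rw [Nat.not_odd_iff_even]; exact hn.add_one
    rw [if_pos hn, if_pos hn, if_neg hn', sp_succ, sp_succ', sp_succ', sp_succ',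
      p (show a + h - Z + M * h = -(Z - (a + (M + 1) * h)) by ring),
      p (show a + h - (u + h) - e - Z = -(u + (M + 1) * h + e + (Z - (a + (M + 1) * h))) by ring),
      p (show a + h - (u + h) - f - Z = -(u + (M + 1) * h + f + (Z - (a + (M + 1) * h))) by ring),
      p (show a + h - (u + h) - g - Z = -(u + (M + 1) * h + g + (Z - (a + (M + 1) * h))) by ring)]
    simp only [show ∀ t, a + h - (u + h) - t - Z + h = a + h - u - t - Z by intros; ring]
    ring
  · have hn' : Odd (n + 1) := (Nat.not_odd_iff_even.1 hn).add_one
    rw [if_neg hn, if_neg hn, if_pos hn', sp_succ', sp_succ, sp_succ, sp_succ,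
      p (show a + h - (u + h) - Z = -(u + (M + 1) * h + (Z - (a + (M + 1) * h))) by ring),
      p (show a + h - e - Z + M * h = -(e + (Z - (a + (M + 1) * h))) by ring),
      p (show a + h - f - Z + M * h = -(f + (Z - (a + (M + 1) * h))) by ring),
      p (show a + h - g - Z + M * h = -(g + (Z - (a + (M + 1) * h))) by ring)]
    simp only [show a + h - (u + h) - Z + h = a + h - u - Z by ring]
    ring

theorem jacksonParity_shift {a e f g u Z : ℂ} (M : ℕ) :
    jacksonParity s h (a + h) e f g u (Z + h) n M = jacksonParity s h a e f g u Z n M := by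
  unfold jacksonParity
  simp only [show ∀ t, a + h + h - (t + h) = a + h - t by intros; ring,
    show ∀ t v, a + h + h - v - t - (Z + h) = a + h - v - t - Z by intros; ring,
    show ∀ v, a + h + h - v - (Z + h) = a + h - v - Z by intros; ring]

/-- All products over the variables telescope into a factor independent of `k`. What remains is the
`k`-th term of the type D sum with distinguished point `-(a + (M+1)h)`. -/
theorem jacksonCoeff_mul_value {a e f g u : ℂ} {z : Fin n → ℂ}
    (H : JacksonGeneric s h a e f g u z) (M : ℕ) (k : Fin n) :
    jacksonCoeff s h a e f g u z M k * jacksonValue s h (a + h) e f g u (shiftVar h z k) M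
      = -((∏ i, sp s h (a + h + z i) (M + 1)) / (∏ i, sp s h (a + h - z i) (M + 1))
        / (sp s h (a + h - u) M * s (a - u)
          * (sp s h (a + h - e) (M + 1) * sp s h (a + h - f) (M + 1) * sp s h (a + h - g) (M + 1)))
        * jacksonParity s h a e f g u (∑ i, z i) n M)
        * (vertexRatio s z k * (s (a + (M + 1) * h - z k) / s (a + (M + 1) * h + z k))
          * (s (u + (M + 1) * h + z k) * s (g + z k) * (s (e + z k) * s (f + z k)))) := by
  have h1 := prod_sp_add_shiftVar (s := s) (h := h) a z k M
  have h2 := prod_sp_sub_shiftVar (s := s) (h := h) a z k M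
  have q : ∀ t, sp s h (a + h - t) (M + 1) = s (a + h - t) * sp s h (a + h + h - t) M := fun t => by
    rw [sp_succ', show a + h - t + h = a + h + h - t by ring]
  have qu : s (a + h - u) * sp s h (a + h + h - u) M = sp s h (a + h - u) M * s (a + (M + 1) * h - u) := by
    rw [← q, sp_succ]; congr 2; ring
  unfold jacksonValue jacksonCoeff coreConst
  rw [sum_shiftVar, jacksonParity_shift, ← h2, q e, q f, q g]
  have n1 : s (a + (M + 2) * h + z k) ≠ 0 := (H.az k).at (M + 2) (by push_cast; ring)
  have n2 : s (a + (M + 1) * h - z k) ≠ 0 := (H.az' k).at (M + 1) (by push_cast; ring)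
  have n3 : s (u + z k) ≠ 0 := (H.uz k).at 0 (by simp)
  have n4 : s (a + (M + 1) * h - u) ≠ 0 := H.au.at (M + 1) (by push_cast; ring)
  have n5 : s (a + h - u) ≠ 0 := H.au.at 1 (by push_cast; ring)
  have n6 : sp s h (a + h + h - u) M ≠ 0 := H.au.sp 2 (by push_cast; ring) M
  have n7 : sp s h (a + h - u) M ≠ 0 := H.au.sp 1 (by push_cast; ring) M
  rw [show z k + u + (M + 1) * h = u + (M + 1) * h + z k by ring]
  have hP : ∏ i, sp s h (a + h + z i) (M + 1) = (∏ i, sp s h (a + h + h + shiftVar h z k i) M)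
      * ((∏ i, s (a + h + z i)) * s (a + 2 * h + z k)) / s (a + (M + 2) * h + z k) := by
    rw [h1, mul_div_cancel_right₀ _ n1]
  rw [hP]
  have hU : (sp s h (a + h + h - u) M)⁻¹ = s (a + h - u) * (sp s h (a + h - u) M)⁻¹
      * (s (a + (M + 1) * h - u))⁻¹ := by
    generalize s (a + (M + 1) * h - u) = x4 at *
    generalize sp s h (a + h + h - u) M = A at *
    generalize sp s h (a + h - u) M = B at *
    field_simp
    linear_combination -qu
  clear h1 h2 q hP qu
  rw [div_eq_mul_inv _ (sp s h (a + h + h - u) M * _), mul_inv, hU]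
  clear hU
  generalize s (a + (M + 1) * h - z k) = x2 at *
  generalize s (u + z k) = x3 at *
  generalize s (a + (M + 1) * h - u) = x4 at *
  generalize s (a + h - u) = x5 at *
  generalize (∏ i, sp s h (a + h + h + shiftVar h z k i) M) = A1
  generalize (∏ i, s (a + h + z i)) = A2
  generalize (∏ i, sp s h (a + h + h - shiftVar h z k i) M) = A3
  generalize (∏ i, if i = k then 1 else s (a + h - z i)) = A4
  generalize jacksonParity s h a e f g u (∑ i, z i) n M = P
  generalize vertexRatio s z k = R
  generalize sp s h (a + h - u) M = A5
  generalize sp s h (a + h + h - e) M = A6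
  generalize sp s h (a + h + h - f) M = A7
  generalize sp s h (a + h + h - g) M = A8
  generalize s (a + h - e) = A9
  generalize s (a + h - f) = A10
  generalize s (a + h - g) = A11
  generalize s (e + z k) = A12
  generalize s (f + z k) = A13
  generalize s (g + z k) = A14
  generalize s (a + 2 * h + z k) = A15
  generalize s (a + (M + 1) * h + z k) = A16
  generalize s (u + (M + 1) * h + z k) = A17
  generalize s (a - u) = A18
  generalize s (a + (M + 2) * h + z k) = A19 at *
  have c2 := mul_inv_cancel₀ n2
  have c3 := mul_inv_cancel₀ n3
  have c4 := mul_inv_cancel₀ n4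
  have c5 := mul_inv_cancel₀ n5
  clear n1 n2 n3 n4 n5 n6 n7
  refine (mul_one _).symm.trans (Eq.trans ?_ (mul_one _))
  refine (congrArg _ c2.symm).trans (Eq.trans ?_ (congrArg _ (show x3 * x3⁻¹ * (x4 * x4⁻¹) * (x5 * x5⁻¹) = 1 by
    rw [c3, c4, c5, mul_one, mul_one])))
  clear c2 c3 c4 c5
  simp only [div_eq_mul_inv, mul_inv]
  generalize x2⁻¹ = y2
  generalize x3⁻¹ = y3
  generalize x4⁻¹ = y4
  generalize x5⁻¹ = y5
  ring

/-- After removal of the common factor, this recursion is `quadSum_vertex` at `Q = a + (M+1)h` with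
first parameter `u + (M+1)h`. The left-hand side comes from the total value, the first term on the
right from the distinguished point, and the sum from the `z k`. -/
theorem jacksonValue_step (hs : IsSigma s) {a e f g u : ℂ} {z : Fin n → ℂ}
    (H : JacksonGeneric s h a e f g u z) (M : ℕ)
    (hb : 2 * a + (M + 1) * h = u + e + f + g + 2 * ∑ i, z i) :
    jacksonValue s h a e f g (u + h) z (M + 1) = jacksonValue s h a e f g u z M
      + ∑ k, jacksonCoeff s h a e f g u z M k
        * jacksonValue s h (a + h) e f g u (shiftVar h z k) M := by
  have hq := quadSum_vertex hs (z := z) (fun i j hij => (H.vars.2 i j hij).at 0 (by simp))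
    (Q := a + (M + 1) * h) (c := u + (M + 1) * h) (e := e) (f := f) (g := g)
    (fun i => (H.az i).at (M + 1) (by push_cast; ring)) (by linear_combination -hb)
  rw [Finset.sum_congr rfl fun k _ => jacksonCoeff_mul_value H M k, ← Finset.mul_sum]
  rw [show a + (M + 1) * h - (u + (M + 1) * h) = a - u by ring] at hq
  have q : ∀ t, sp s h (a + h - t) (M + 1) = sp s h (a + h - t) M * s (a + (M + 1) * h - t) :=
    fun t => by rw [sp_succ]; congr 2; ring
  have q' : ∀ t, sp s h (a + h + t) (M + 1) = sp s h (a + h + t) M * s (a + (M + 1) * h + t) :=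
    fun t => by rw [sp_succ]; congr 2; ring
  unfold jacksonValue
  rw [jacksonParity_step hs, hq, show a + h - (u + h) = a - u by ring, sp_succ',
    show a - u + h = a + h - u by ring]
  simp only [q, q', Finset.prod_mul_distrib, Finset.prod_div_distrib]
  have n1 : s (a - u) ≠ 0 := H.au.at 0 (by simp)
  have n2 : s (a + (M + 1) * h - e) ≠ 0 := H.ae.at (M + 1) (by push_cast; ring)
  have n3 : s (a + (M + 1) * h - f) ≠ 0 := H.af.at (M + 1) (by push_cast; ring)
  have n4 : s (a + (M + 1) * h - g) ≠ 0 := H.ag.at (M + 1) (by push_cast; ring)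
  have n5 : ∏ i, s (a + (M + 1) * h + z i) ≠ 0 :=
    Finset.prod_ne_zero_iff.2 fun i _ => (H.az i).at (M + 1) (by push_cast; ring)
  have n6 : ∏ i, s (a + (M + 1) * h - z i) ≠ 0 :=
    Finset.prod_ne_zero_iff.2 fun i _ => (H.az' i).at (M + 1) (by push_cast; ring)
  clear q q' hq
  generalize ∑ k, vertexRatio s z k * (s (a + (M + 1) * h - z k) / s (a + (M + 1) * h + z k))
    * (s (u + (M + 1) * h + z k) * s (g + z k) * (s (e + z k) * s (f + z k))) = S
  generalize s (a - u) = x1 at *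
  generalize s (a + (M + 1) * h - e) = x2 at *
  generalize s (a + (M + 1) * h - f) = x3 at *
  generalize s (a + (M + 1) * h - g) = x4 at *
  generalize ∏ i, s (a + (M + 1) * h + z i) = x5 at *
  generalize ∏ i, s (a + (M + 1) * h - z i) = x6 at *
  generalize ∏ i, sp s h (a + h + z i) M = x7
  generalize ∏ i, sp s h (a + h - z i) M = x8
  generalize jacksonParity s h a e f g u (∑ i, z i) n M = P
  generalize sp s h (a + h - u) M = x9
  generalize sp s h (a + h - e) M = x10
  generalize sp s h (a + h - f) M = x11
  generalize sp s h (a + h - g) M = x12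
  field_simp
  ring

/-- The sum and its closed form obey the same recursion, with the values of order `M` at `(a, u - h,
z)` and at `(a + h, u - h)` with one shifted variable as input. These parameters stay balanced, so
induction on `N` applies with `a`, `u`, `z` free. -/
theorem jackson_sum (hs : IsSigma s) {a e f g u : ℂ} {z : Fin n → ℂ}
    (H : JacksonGeneric s h a e f g u z) (N : ℕ)
    (hb : 2 * a + (N + 1) * h = u + e + f + g + 2 * ∑ i, z i) :
    ∑ x ∈ simplex n N, jacksonTerm s h a e f g u z N x = jacksonValue s h a e f g u z N := by
  induction N generalizing a u z with
  | zero =>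
    have h0 : simplex n 0 = {fun _ => 0} := by
      ext x
      rw [mem_simplex, Finset.mem_singleton, Nat.le_zero, Finset.sum_eq_zero_iff]
      exact ⟨fun hx => funext fun i => hx i (Finset.mem_univ i), fun hx i _ => by rw [hx]⟩
    rw [h0, Finset.sum_singleton]
    have hz : ∀ i j, i ≠ j → s (z i - z j) ≠ 0 := fun i j hij => (H.vars.2 i j hij).at 0 (by simp)
    have h1 : ∏ i, ∏ j ∈ Finset.Ioi i, pairWeight s h z (fun _ => 0) i j = 1 :=
      Finset.prod_eq_one fun i _ => Finset.prod_eq_one fun j hj => by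
        simp [pairWeight, sp_zero, div_self (hz i j (Finset.mem_Ioi.1 hj).ne)]
    have h2 : ∏ i, wellPoised s h a z (fun _ => 0) 0 i = 1 := Finset.prod_eq_one fun i _ => by
      simp [wellPoised, sp_zero, div_self ((H.az i).at 0 (by simp : a + z i = _))]
    simp [jacksonTerm, jacksonValue, jacksonParity, coreWeight, baseWeight, upFac, downFac, sp_zero,
      h1, h2]
  | succ M ih =>
    have H' : JacksonGeneric s h a e f g (u - h) z := H.step (-1) (by push_cast; ring)
    push_cast at hb
    have h1 := jackson_contiguous hs H' M
    have h2 := jacksonValue_step hs H' M (by linear_combination hb)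
    rw [sub_add_cancel] at h1 h2
    rw [h1, h2, sum_jacksonTerm_succ hs, ih H' (by linear_combination hb)]
    congr 1
    refine Finset.sum_congr rfl fun k _ => ?_
    rw [ih (H'.shift k) (by rw [sum_shiftVar]; linear_combination hb)]

end JacksonValue

end EllipticBailey
end

noncomputable section

namespace EllipticBailey

open Finset

/-! ### Contiguous relation for the left-hand side. -/

section LeftContiguity

variable {s : ℂ → ℂ} {h : ℂ} {n : ℕ}

variable (s h) in
/-- The summand of the left-hand side, in additive notation. -/
def leftSummand (a b c d e f g : ℂ) (z : Fin n → ℂ) (N : ℕ) (x : Fin n → ℕ) : ℂ :=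
  coreWeight s h a z x * (upFac s h a c z x * upFac s h a d z x
    * (upFac s h a e z x * upFac s h a f z x * upFac s h a g z x))
    * (downFac s h a (a + (N + 1) * h) z x * downFac s h a (a + h - b) z x)

variable (s h) in
/-- The coefficients of the contiguous relation for the left-hand side. -/
def leftCoeff (a b c d e f g : ℂ) (z : Fin n → ℂ) (M : ℕ) (k : Fin n) : ℂ :=
  -(coreConst s h a z k * (s (d - c) / (s (a - c) * s (a - d)) * (s (z k + c + d - a)
    / (s (c + z k) * s (d + z k))))
    * (s (c + z k) / s (a + h - c) * (s (d + z k) / s (a + h - d)) * (s (e + z k) / s (a + h - e)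
      * (s (f + z k) / s (a + h - f)) * (s (g + z k) / s (a + h - g))))
    * (s (-((M + 1) * h)) / s (a + (M + 2) * h + z k) * (s b / s (a + h - b + z k))))

/-- With the weight at `(c, d)` as common factor, the two summands are the well-poised quotients at
`c` and at `d`. The expansion over `z k` and the lowering of `x k` are as for the Jackson sum. -/
theorem left_contiguous (hs : IsSigma s) {a c d : ℂ} {z : Fin n → ℂ} (H : GenericVars s h z)
    (ha : ∀ i, NZ s h (a + z i)) (ha' : ∀ i, NZ s h (a - z i)) (hc : ∀ i, NZ s h (c + z i))
    (hd : ∀ i, NZ s h (d + z i)) (hac : NZ s h (a - c)) (had : NZ s h (a - d)) (hcd : s (d - c) ≠ 0)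
    (b e f g : ℂ) (M : ℕ) :
    ∑ x ∈ simplex n (M + 1), leftSummand s h a b (c + h) d e f g z (M + 1) x
      = ∑ x ∈ simplex n (M + 1), leftSummand s h a b c (d + h) e f g z (M + 1) x
        + ∑ k, leftCoeff s h a b c d e f g z M k
          * ∑ x ∈ simplex n M, leftSummand s h (a + h) (b + h) c d e f g (shiftVar h z k) M x := by
  have hac0 := hac.at 0 (by simp : a - c = _)
  have had0 := had.at 0 (by simp : a - d = _)
  have hM : a + (((M + 1 : ℕ) : ℂ) + 1) * h = a + (M + 2) * h := by push_cast; ring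
  let T : Fin n → (Fin n → ℕ) → ℂ := fun k x =>
    coreWeight s h a z x * (upFac s h a c z x * upFac s h a d z x
    * (upFac s h a e z x * upFac s h a f z x * upFac s h a g z x))
    * (downFac s h a (a + (M + 2) * h) z x * downFac s h a (a + h - b) z x)
    * (s (d - c) / (s (a - c) * s (a - d)))
      * ((∏ j, s (z k - (z j + x j * h)) / (if j = k then 1 else s (z k - z j)))
          * (s (a + z k + (∑ l, x l : ℕ) * h) * s (z k + c + d - a) / (s (c + z k) * s (d + z k))))
  have hT : ∀ x, leftSummand s h a b (c + h) d e f g z (M + 1) x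
      - leftSummand s h a b c (d + h) e f g z (M + 1) x = ∑ k, T k x := by
    intro x
    have h1 := upFac_step (h := h) (z := z) a c (fun i => (hc i).at 0 (by simp)) hac0 x
      (hac.sp 1 (by push_cast; ring) _) (hac.sp 0 (by simp) _)
    have h2 := upFac_step (h := h) (z := z) a d (fun i => (hd i).at 0 (by simp)) had0 x
      (had.sp 1 (by push_cast; ring) _) (had.sp 0 (by simp) _)
    have h3 := wellPoised_difference hs H a c d (fun i => (hc i).at 0 (by simp))
      (fun i => (hd i).at 0 (by simp)) hcd hac0 had0 x
    unfold leftSummand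
    rw [hM, h1, h2]
    simp only [T]
    rw [← Finset.mul_sum]
    linear_combination (coreWeight s h a z x * (upFac s h a c z x * upFac s h a d z x
      * (upFac s h a e z x * upFac s h a f z x * upFac s h a g z x))
      * (downFac s h a (a + (M + 2) * h) z x * downFac s h a (a + h - b) z x)) * h3
  rw [← sub_eq_iff_eq_add', ← Finset.sum_sub_distrib, Finset.sum_congr rfl fun x _ => hT x,
    Finset.sum_comm]
  refine Finset.sum_congr rfl fun k _ => ?_
  rw [sum_simplex_succ, Finset.mul_sum]
  · refine Finset.sum_congr rfl fun x _ => ?_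
    have h1 := coreWeight_residue hs H ha ha' x k
    simp only [T]
    unfold leftSummand leftCoeff
    rw [upFac_shift, upFac_shift, upFac_shift, upFac_shift, upFac_shift, downFac_shift, downFac_shift,
      show a + h + ((M : ℂ) + 1) * h = a + (M + 2) * h by ring,
      show a + h + h - (b + h) = a + h - b by ring,
      show a + h - (a + (M + 2) * h) = -((M + 1) * h) by ring, show a + h - (a + h - b) = b by ring]
    generalize (∏ j, s (z k - (z j + incr x k j * h)) / (if j = k then 1 else s (z k - z j))) = P at *
    generalize s (a + z k + (∑ l, incr x k l : ℕ) * h) = A at *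
    generalize coreWeight s h a z (incr x k) = W at *
    rw [show ∀ B C D E F : ℂ, W * B * C * D * (P * (A * E / F)) = W * (P * A) * (B * C * D * E / F) by
      intros; ring, h1]
    ring
  · intro x hx
    simp only [T]
    rw [← Finset.mul_prod_erase _ _ (Finset.mem_univ k), hx]
    simp [hs.zero]

end LeftContiguity

/-! ### Contiguous relation for the right-hand side. -/

section RightContiguity

variable {s : ℂ → ℂ} {h : ℂ} {n : ℕ}

variable (s h) in
/-- The quotient `∏ (w - z_i)_X / (w - z_i)_{X - x_i}`. -/
def complFac (w : ℂ) (z : Fin n → ℂ) (x : Fin n → ℕ) : ℂ :=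
  ∏ i, sp s h (w - z i) (∑ l, x l) / sp s h (w - z i) (∑ l, x l - x i)

variable (s h) in
/-- The factors of the right-hand summand that depend on the individual indices. -/
def vertexFac (a b e f g : ℂ) (z : Fin n → ℂ) (N : ℕ) (x : Fin n → ℕ) : ℂ :=
  (∏ i, sp s h (e + z i) (x i)) * (∏ i, sp s h (f + z i) (x i)) * (∏ i, sp s h (g + z i) (x i))
    * (∏ i, sp s h (-(N * h) - a + z i) (x i)) / ∏ i, sp s h (a + h - b + z i) (x i)

variable (s h) in
/-- The very-well-poised factor of the right-hand summand. -/
def radialFac (lam : ℂ) (N X : ℕ) : ℂ :=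
  s (lam + 2 * X * h) / s lam * sp s h lam X * sp s h (-(N * h)) X / sp s h (lam + (N + 1) * h) X

variable (s h) in
/-- The factor of the right-hand summand that depends on `c` and `d`. -/
def cdFac (a c d lam : ℂ) (X : ℕ) : ℂ :=
  sp s h (lam + c - a) X * sp s h (lam + d - a) X / (sp s h (a + h - c) X * sp s h (a + h - d) X)

variable (s h) in
/-- The denominator of the parity-dependent factor. -/
def parityDen (a e f g lam Z : ℂ) (n N X : ℕ) : ℂ :=
  if Odd n then sp s h (-(N * h) + Z - a) X * (sp s h (lam + h - e - Z) X * sp s h (lam + h - f - Z) X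
    * sp s h (lam + h - g - Z) X)
  else sp s h (lam + h - Z) X * (sp s h (lam + h - e - f - Z) X * sp s h (lam + h - e - g - Z) X
    * sp s h (lam + h - f - g - Z) X)

variable (s h) in
/-- The numerator of the parity-dependent factor. -/
def parityNum (a e f g lam Z : ℂ) (n N : ℕ) : ℂ :=
  if Odd n then sp s h (a + h - Z) N * (sp s h (lam + h - e - Z) N * sp s h (lam + h - f - Z) N
    * sp s h (lam + h - g - Z) N)
  else sp s h (lam + h - Z) N * (sp s h (a + h - e - Z) N * sp s h (a + h - f - Z) N
    * sp s h (a + h - g - Z) N)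

variable (s h) in
/-- The summand of the right-hand side, in additive notation, up to a constant. -/
def rightSummand (a b c d e f g lam : ℂ) (z : Fin n → ℂ) (N : ℕ) (x : Fin n → ℕ) : ℂ :=
  baseWeight s h z x * complFac s h (lam + b - a) z x * vertexFac s h a b e f g z N x
    * radialFac s h lam N (∑ l, x l) * cdFac s h a c d lam (∑ l, x l)
    / parityDen s h a e f g lam (∑ i, z i) n N (∑ l, x l)

/-- After cancellation of common factorials this is a single three-term relation. The factor `s
((Y+1) * h)`, that is `s (X * h)` with `X = Y + 1`, prepares the expansion over the variables. -/
theorem cdFac_contiguous (hs : IsSigma s) {a b c d lam : ℂ} (hac : NZ s h (a - c))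
    (had : NZ s h (a - d)) (hb : c + d + b + lam = 2 * a) (Y : ℕ) :
    cdFac s h a (c + h) d lam (Y + 1) - cdFac s h a c (d + h) lam (Y + 1)
      = cdFac s h (a + h) c d (lam + 2 * h) Y * (s ((Y + 1) * h) * s (lam + (Y + 1) * h)
        * (s b * s (d - c) / (s (a - c) * s (a - d) * (s (a + h - c) * s (a + h - d))))) := by
  -- Arguments are centred at `lam / 2`; the second and fourth add up to `-b` by balancing, which is
  -- how `b` enters the coefficient.
  have h3 := hs.three_term (lam / 2 + (Y + 1) * h) (lam / 2 + c - a) (lam / 2) (lam / 2 + d - a)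
  rw [show lam / 2 + c - a + (lam / 2 + d - a) = -b by linear_combination hb, hs.odd b] at h3
  have key : ∀ t, sp s h (a - t) (Y + 1) * s (a - t + (Y + 1) * h)
      = s (a - t) * s (a + h - t) * sp s h (a + h + h - t) Y := fun t => by
    rw [← sp_shift_two, show a - t + h = a + h - t by ring,
      show a - t + 2 * h = a + h + h - t by ring]
  have key' : ∀ t, sp s h (a + h - t) (Y + 1) = s (a + h - t) * sp s h (a + h + h - t) Y := fun t => by
    rw [sp_succ', show a + h - t + h = a + h + h - t by ring]
  have num : ∀ t, sp s h (lam + t - a) (Y + 1) = s (lam + t - a) * sp s h (lam + 2 * h + t - (a + h)) Y :=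
    fun t => by rw [sp_succ', show lam + t - a + h = lam + 2 * h + t - (a + h) by ring]
  have num' : ∀ t, sp s h (lam + (t + h) - a) (Y + 1)
      = sp s h (lam + 2 * h + t - (a + h)) Y * s (lam + t - a + (Y + 1) * h) := fun t => by
    rw [sp_succ, show lam + (t + h) - a = lam + 2 * h + t - (a + h) by ring]
    congr 2; ring
  have kc := key c
  have kd := key d
  unfold cdFac
  rw [show a + h - (c + h) = a - c by ring, show a + h - (d + h) = a - d by ring, num' c, num' d, num, num,
    key', key']
  have n1 := hac.at 0 (by simp : a - c = _)
  have n2 := had.at 0 (by simp : a - d = _)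
  have n3 := hac.at 1 (by push_cast; ring : a + h - c = _)
  have n4 := had.at 1 (by push_cast; ring : a + h - d = _)
  have n5 := hac.at (Y + 1) (by push_cast; ring : a - c + (Y + 1) * h = _)
  have n6 := had.at (Y + 1) (by push_cast; ring : a - d + (Y + 1) * h = _)
  have n7 := hac.sp 2 (by push_cast; ring : a + h + h - c = _) Y
  have n8 := had.sp 2 (by push_cast; ring : a + h + h - d = _) Y
  rw [← eq_div_iff n5] at kc
  rw [← eq_div_iff n6] at kd
  rw [kc, kd]
  rw [show lam / 2 + (Y + 1) * h + (lam / 2 + c - a) = lam + c - a + (Y + 1) * h by ring,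
    show lam / 2 + (Y + 1) * h - (lam / 2 + c - a) = a - c + (Y + 1) * h by ring,
    show lam / 2 + (Y + 1) * h + (lam / 2 + d - a) = lam + d - a + (Y + 1) * h by ring,
    show lam / 2 + (Y + 1) * h - (lam / 2 + d - a) = a - d + (Y + 1) * h by ring,
    show lam / 2 + (lam / 2 + c - a) = lam + c - a by ring,
    show lam / 2 - (lam / 2 + c - a) = a - c by ring,
    show lam / 2 + (lam / 2 + d - a) = lam + d - a by ring,
    show lam / 2 - (lam / 2 + d - a) = a - d by ring,
    show lam / 2 + c - a - (lam / 2 + d - a) = -(d - c) by ring, hs.odd (d - c),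
    show lam / 2 + (Y + 1) * h + lam / 2 = lam + (Y + 1) * h by ring,
    show lam / 2 + (Y + 1) * h - lam / 2 = (Y + 1) * h by ring] at h3
  clear kc kd key key' num num'
  generalize sp s h (a + h + h - c) Y = D1 at *
  generalize sp s h (a + h + h - d) Y = D2 at *
  generalize sp s h (lam + 2 * h + c - (a + h)) Y = E1 at *
  generalize sp s h (lam + 2 * h + d - (a + h)) Y = E2 at *
  generalize s (lam + c - a + (Y + 1) * h) = x1 at *
  generalize s (a - c + (Y + 1) * h) = x2 at *
  generalize s (lam + d - a + (Y + 1) * h) = x3 at *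
  generalize s (a - d + (Y + 1) * h) = x4 at *
  generalize s (lam + c - a) = x5 at *
  generalize s (lam + d - a) = x6 at *
  generalize s (a - c) = x7 at *
  generalize s (a - d) = x8 at *
  generalize s (d - c) = x9 at *
  generalize s (lam + (Y + 1) * h) = x10 at *
  generalize s ((Y + 1) * h) = x11 at *
  generalize s b = x12 at *
  generalize s (a + h - c) = x13 at *
  generalize s (a + h - d) = x14 at *
  field_simp
  linear_combination E1 * E2 * h3

/-- On the right the `c, d` part depends on the total `X` only, so the expansion over variables has
to come from `s (X * h)`. This is the residue at `w + X*h` in the partial fraction identity with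
additional pole `w + X*h` and additional zero `w`. -/
theorem complFac_expansion (hs : IsSigma s) {w : ℂ} {z : Fin n → ℂ} (H : GenericVars s h z)
    (hw : ∀ i, NZ s h (w - z i)) (x : Fin n → ℕ) :
    s ((∑ l, x l : ℕ) * h) * complFac s h w z x
      = ∑ k, -((∏ j, s (z k - (z j + x j * h)) / (if j = k then 1 else s (z k - z j)))
        * (s (z k - w) / s (z k - (w + (∑ l, x l : ℕ) * h)))
        * (complFac s h w z x * ∏ j, s (w + (∑ l, x l : ℕ) * h - z j)
          / s (w + (∑ l, x l : ℕ) * h - (z j + x j * h)))) := by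
  set X := ∑ l, x l with hX
  set W := w + (X : ℂ) * h with hW
  have hWz : ∀ i, s (W - z i) ≠ 0 := fun i => (hw i).at X (by rw [hW]; push_cast; ring)
  have hxX : ∀ i, x i ≤ X := fun i =>
    Finset.single_le_sum (fun _ _ => Nat.zero_le _) (Finset.mem_univ i)
  have hWy : ∀ i, s (W - (z i + x i * h)) ≠ 0 := fun i =>
    (hw i).at ((X : ℤ) - x i) (by rw [hW]; push_cast; ring)
  let zz : Option (Fin n) → ℂ := fun i => i.elim W z
  let ww : Option (Fin n) → ℂ := fun i => i.elim w fun i => z i + x i * h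
  have hg := gustafsonSum_eq_zero hs (z := zz) (w := ww) (S := Finset.univ) (by
    intro i _ j _ hij
    rcases i with _ | i <;> rcases j with _ | j
    · exact absurd rfl hij
    · exact hWz j
    · simp only [zz, Option.elim]
      rw [show z i - W = -(W - z i) by ring, hs.odd]
      exact neg_ne_zero.2 (hWz i)
    · exact (H.2 i j fun e => hij (by rw [e])).at 0 (by simp [zz])) (by
    simp only [Fintype.sum_option, zz, ww, Option.elim]
    rw [Finset.sum_add_distrib, ← Finset.sum_mul, hW, hX]
    push_cast
    ring)
  unfold gustafsonSum at hg
  simp only [Fintype.sum_option, Fintype.prod_option, zz, ww, Option.elim, Option.some.injEq,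
    reduceCtorEq, if_true, if_false, div_one] at hg
  rw [show W - w = X * h by rw [hW]; ring] at hg
  have h1 : (∏ j, s (W - (z j + x j * h)) / s (W - z j))
      * ∏ j, s (W - z j) / s (W - (z j + x j * h)) = 1 := by
    rw [← Finset.prod_mul_distrib]
    exact Finset.prod_eq_one fun j _ => by
      rw [div_mul_div_cancel₀ (hWz j), div_self (hWy j)]
  rw [Finset.sum_neg_distrib, ← Finset.sum_mul]
  have h2 : ∀ k, s (z k - w) / s (z k - W)
      * ∏ j, s (z k - (z j + x j * h)) / (if j = k then 1 else s (z k - z j))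
      = (∏ j, s (z k - (z j + x j * h)) / (if j = k then 1 else s (z k - z j)))
        * (s (z k - w) / s (z k - W)) := fun k => mul_comm _ _
  rw [Finset.sum_congr rfl fun k _ => h2 k] at hg
  linear_combination (complFac s h w z x * ∏ j, s (W - z j) / s (W - (z j + x j * h))) * hg
    - s (X * h) * complFac s h w z x * h1

/-- The base point moves by `2h` because `w = lam + b - a`. For `i ≠ k` both factorials lose their
first two entries; at `k` the shift of `z k` leaves one unmatched factor, which then cancels the
pole in `complFac_expansion`. -/
theorem complFac_shift (hs : IsSigma s) {w : ℂ} {z : Fin n → ℂ}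
    (hw : ∀ i, NZ s h (w - z i)) (x : Fin n → ℕ) (k : Fin n) :
    complFac s h w z (incr x k) * ∏ j, s (w + (∑ l, incr x k l : ℕ) * h - z j)
          / s (w + (∑ l, incr x k l : ℕ) * h - (z j + incr x k j * h))
      = -(complFac s h (w + 2 * h) (shiftVar h z k) x
        * s (z k - (w + (∑ l, incr x k l : ℕ) * h))) := by
  unfold complFac
  rw [sum_incr]
  set X := ∑ l, x l with hX
  have hxX : ∀ i, x i ≤ X := fun i =>
    Finset.single_le_sum (fun _ _ => Nat.zero_le _) (Finset.mem_univ i)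
  have hi : ∀ i, i ≠ k → sp s h (w - z i) (X + 1) / sp s h (w - z i) (X + 1 - incr x k i)
      * (s (w + ((X + 1 : ℕ) : ℂ) * h - z i) / s (w + ((X + 1 : ℕ) : ℂ) * h - (z i + incr x k i * h)))
      = sp s h (w + 2 * h - shiftVar h z k i) X / sp s h (w + 2 * h - shiftVar h z k i) (X - x i) := by
    intro i hi
    rw [incr_of_ne x hi, shiftVar_of_ne z hi]
    have e := hxX i
    have h1 := sp_shift_two (s := s) (h := h) (w - z i) X
    have h2 := sp_shift_two (s := s) (h := h) (w - z i) (X - x i)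
    rw [show w - z i + 2 * h = w + 2 * h - z i by ring] at h1 h2
    rw [show X + 1 - x i = X - x i + 1 by omega,
      show w + ((X + 1 : ℕ) : ℂ) * h - z i = w - z i + (X + 1) * h by push_cast; ring,
      show w + ((X + 1 : ℕ) : ℂ) * h - (z i + x i * h) = w - z i + (((X - x i : ℕ) : ℂ) + 1) * h by
        push_cast [Nat.cast_sub e]; ring, div_mul_div_comm, ← h1, ← h2]
    refine mul_div_mul_left _ _ (mul_ne_zero ((hw i).at 0 (by simp)) ((hw i).at 1 (by push_cast; ring)))
  have hk : sp s h (w - z k) (X + 1) / sp s h (w - z k) (X + 1 - incr x k k)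
      * (s (w + ((X + 1 : ℕ) : ℂ) * h - z k) / s (w + ((X + 1 : ℕ) : ℂ) * h - (z k + incr x k k * h)))
      = sp s h (w + 2 * h - shiftVar h z k k) X / sp s h (w + 2 * h - shiftVar h z k k) (X - x k)
        * s (w + ((X + 1 : ℕ) : ℂ) * h - z k) := by
    rw [incr_self, shiftVar_self]
    have e := hxX k
    have h2 := sp_shift (s := s) (h := h) (w - z k) (X - x k)
    rw [show X + 1 - (x k + 1) = X - x k by omega,
      show w + ((X + 1 : ℕ) : ℂ) * h - (z k + ((x k + 1 : ℕ) : ℂ) * h)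
        = w - z k + ((X - x k : ℕ) : ℂ) * h by push_cast [Nat.cast_sub e]; ring, div_mul_div_comm, ← h2,
      show w + 2 * h - (z k + h) = w - z k + h by ring, sp_succ', mul_assoc,
      mul_div_mul_left _ _ ((hw k).at 0 (by simp))]
    ring
  rw [← Finset.prod_mul_distrib, ← Finset.mul_prod_erase _ _ (Finset.mem_univ k), hk,
    Finset.prod_congr rfl fun i h' => hi i (Finset.ne_of_mem_erase h'),
    ← Finset.mul_prod_erase _ (fun i => sp s h (w + 2 * h - shiftVar h z k i) X
      / sp s h (w + 2 * h - shiftVar h z k i) (X - x i)) (Finset.mem_univ k),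
    show z k - (w + ((X + 1 : ℕ) : ℂ) * h) = -(w + ((X + 1 : ℕ) : ℂ) * h - z k) by ring, hs.odd]
  ring

theorem parityDen_succ (a e f g lam Z : ℂ) (M X : ℕ) :
    parityDen s h a e f g lam Z n (M + 1) (X + 1) = parityDen s h a e f g lam Z n (M + 1) 1
      * parityDen s h (a + h) e f g (lam + 2 * h) (Z + h) n M X := by
  have q : ∀ {t v : ℂ}, v = t + h → sp s h t (X + 1) = sp s h t 1 * sp s h v X := fun {t v} e => by
    rw [sp_succ', sp_succ', sp_zero, mul_one, e]
  unfold parityDen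
  split_ifs
  · rw [q (show -(M * h) + (Z + h) - (a + h) = -(((M + 1 : ℕ) : ℂ) * h) + Z - a + h by push_cast; ring),
      q (show lam + 2 * h + h - e - (Z + h) = lam + h - e - Z + h by ring),
      q (show lam + 2 * h + h - f - (Z + h) = lam + h - f - Z + h by ring),
      q (show lam + 2 * h + h - g - (Z + h) = lam + h - g - Z + h by ring)]
    ring
  · rw [q (show lam + 2 * h + h - (Z + h) = lam + h - Z + h by ring),
      q (show lam + 2 * h + h - e - f - (Z + h) = lam + h - e - f - Z + h by ring),
      q (show lam + 2 * h + h - e - g - (Z + h) = lam + h - e - g - Z + h by ring),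
      q (show lam + 2 * h + h - f - g - (Z + h) = lam + h - f - g - Z + h by ring)]
    ring

theorem vertexFac_shift (a b e f g : ℂ) (z : Fin n → ℂ) (M : ℕ) (x : Fin n → ℕ) (k : Fin n) :
    vertexFac s h a b e f g z (M + 1) (incr x k)
      = vertexFac s h (a + h) (b + h) e f g (shiftVar h z k) M x
        * (s (e + z k) * s (f + z k) * s (g + z k) * s (-((M + 1) * h) - a + z k)
          / s (a + h - b + z k)) := by
  unfold vertexFac
  simp only [prod_sp_incr]
  rw [show a + h + h - (b + h) = a + h - b by ring,
    show -(((M + 1 : ℕ) : ℂ) * h) - a = -((M + 1) * h) - a by push_cast; ring,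
    show -(M * h) - (a + h) = -((M + 1) * h) - a by ring, div_mul_div_comm]
  ring

theorem radialFac_shift {lam : ℂ} (hl : NZ s h lam) (M X : ℕ) :
    radialFac s h lam (M + 1) (X + 1) * s (lam + (X + 1) * h)
      = radialFac s h (lam + 2 * h) M X * (s (lam + h) * s (lam + 2 * h)
        * (s (-((M + 1) * h)) / s (lam + (M + 2) * h))) := by
  have h1 := sp_shift_two (s := s) (h := h) lam X
  have n1 := hl.at 0 (by simp : lam = _)
  have n2 := hl.at 2 (by push_cast; ring : lam + 2 * h = _)
  unfold radialFac
  rw [sp_succ' (-(((M + 1 : ℕ) : ℂ) * h)), sp_succ' (lam + (((M + 1 : ℕ) : ℂ) + 1) * h),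
    show -(((M + 1 : ℕ) : ℂ) * h) + h = -(M * h) by push_cast; ring,
    show -(((M + 1 : ℕ) : ℂ) * h) = -((M + 1) * h) by push_cast; ring,
    show lam + (((M + 1 : ℕ) : ℂ) + 1) * h + h = lam + 2 * h + (M + 1) * h by push_cast; ring,
    show lam + (((M + 1 : ℕ) : ℂ) + 1) * h = lam + (M + 2) * h by push_cast; ring,
    show lam + 2 * ((X + 1 : ℕ) : ℂ) * h = lam + 2 * h + 2 * X * h by push_cast; ring]
  generalize sp s h (lam + 2 * h + (M + 1) * h) X = A at *
  generalize sp s h (-(M * h)) X = B at *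
  generalize s (lam + 2 * h + 2 * X * h) = C at *
  generalize s (-((M + 1) * h)) = D at *
  generalize s (lam + (M + 2) * h) = E at *
  generalize sp s h lam (X + 1) = F at *
  generalize s (lam + (X + 1) * h) = G at *
  generalize sp s h (lam + 2 * h) X = I at *
  generalize s (lam + 2 * h) = J at *
  generalize s lam = K at *
  generalize s (lam + h) = L at *
  rw [show C / K * F * (D * B) / (E * A) * G = C / K * (F * G) * (D * B) / (E * A) by ring, ← h1]
  have c1 := mul_inv_cancel₀ n1
  have c2 := mul_inv_cancel₀ n2
  simp only [div_eq_mul_inv, mul_inv]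
  linear_combination (C * L * I * D * B * E⁻¹ * A⁻¹) * (c1 - c2)

variable (s h) in
/-- The coefficients of the contiguous relation for the right-hand side. -/
def rightCoeff (a b c d e f g lam : ℂ) (z : Fin n → ℂ) (M : ℕ) (k : Fin n) : ℂ :=
  -(vertexRatio s z k * s (z k - (lam + b - a))
    * (s (e + z k) * s (f + z k) * s (g + z k) * s (-((M + 1) * h) - a + z k) / s (a + h - b + z k))
    * (s (lam + h) * s (lam + 2 * h) * (s (-((M + 1) * h)) / s (lam + (M + 2) * h)))
    * (s b * s (d - c) / (s (a - c) * s (a - d) * (s (a + h - c) * s (a + h - d))))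
    / parityDen s h a e f g lam (∑ i, z i) n (M + 1) 1)

theorem right_contiguous (hs : IsSigma s) {a b c d lam : ℂ} {z : Fin n → ℂ} (H : GenericVars s h z)
    (hw : ∀ i, NZ s h (lam + b - a - z i)) (hl : NZ s h lam) (hac : NZ s h (a - c))
    (had : NZ s h (a - d)) (hb : c + d + b + lam = 2 * a) (e f g : ℂ) (M : ℕ) :
    ∑ x ∈ simplex n (M + 1), rightSummand s h a b (c + h) d e f g lam z (M + 1) x
      = ∑ x ∈ simplex n (M + 1), rightSummand s h a b c (d + h) e f g lam z (M + 1) x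
        + ∑ k, rightCoeff s h a b c d e f g lam z M k
          * ∑ x ∈ simplex n M, rightSummand s h (a + h) (b + h) c d e f g (lam + 2 * h)
            (shiftVar h z k) M x := by
  set w := lam + b - a with hwd
  let T : Fin n → (Fin n → ℕ) → ℂ := fun k x =>
    -((∏ j, s (z k - (z j + x j * h)) / (if j = k then 1 else s (z k - z j)))
        * (s (z k - w) / s (z k - (w + (∑ l, x l : ℕ) * h)))
        * (complFac s h w z x * ∏ j, s (w + (∑ l, x l : ℕ) * h - z j)
          / s (w + (∑ l, x l : ℕ) * h - (z j + x j * h))))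
    * (baseWeight s h z x * vertexFac s h a b e f g z (M + 1) x
      * radialFac s h lam (M + 1) (∑ l, x l)
      * (s (lam + (∑ l, x l : ℕ) * h) * cdFac s h (a + h) c d (lam + 2 * h) (∑ l, x l - 1)
        * (s b * s (d - c) / (s (a - c) * s (a - d) * (s (a + h - c) * s (a + h - d)))))
      / parityDen s h a e f g lam (∑ i, z i) n (M + 1) (∑ l, x l))
  have hT : ∀ x, rightSummand s h a b (c + h) d e f g lam z (M + 1) x
      - rightSummand s h a b c (d + h) e f g lam z (M + 1) x = ∑ k, T k x := by
    intro x
    have h1 := complFac_expansion hs H hw x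
    simp only [T]
    rw [← Finset.sum_mul, ← h1]
    unfold rightSummand
    rw [← hwd]
    generalize ∑ l, x l = X
    -- For `X = 0` the `c, d` factors are empty products and the difference is zero. The expansion
    -- carries `s 0`, so the truncated `X - 1` in `T` does not matter.
    rcases X with _ | Y
    · simp only [Nat.cast_zero, zero_mul, hs.zero, cdFac, sp_zero]
      ring
    · have h2 := cdFac_contiguous hs hac had hb Y
      rw [Nat.add_sub_cancel]
      push_cast
      linear_combination (baseWeight s h z x * complFac s h w z x * vertexFac s h a b e f g z (M + 1) x
        * radialFac s h lam (M + 1) (Y + 1)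
        / parityDen s h a e f g lam (∑ i, z i) n (M + 1) (Y + 1)) * h2
  rw [← sub_eq_iff_eq_add', ← Finset.sum_sub_distrib, Finset.sum_congr rfl fun x _ => hT x,
    Finset.sum_comm]
  refine Finset.sum_congr rfl fun k _ => ?_
  rw [sum_simplex_succ, Finset.mul_sum]
  · refine Finset.sum_congr rfl fun x _ => ?_
    have h1 := baseWeight_shift hs H x k
    have h2 := complFac_shift hs hw x k
    have h3 := radialFac_shift hl M (∑ l, x l)
    have n1 : s (z k - (w + (∑ l, incr x k l : ℕ) * h)) ≠ 0 :=
      ((hw k).neg hs (by ring : z k - w = _)).at (-(∑ l, incr x k l : ℕ)) (by push_cast; ring)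
    simp only [T]
    rw [h2, vertexFac_shift]
    unfold rightSummand rightCoeff
    rw [sum_shiftVar, show lam + 2 * h + (b + h) - (a + h) = w + 2 * h by rw [hwd]; ring, ← hwd]
    rw [Finset.prod_div_distrib]
    have h4 : (∏ j, s (z k - (z j + incr x k j * h))) / (∏ j, if j = k then 1 else s (z k - z j))
        * baseWeight s h z (incr x k)
        = -(baseWeight s h (shiftVar h z k) x * vertexRatio s z k) := by
      unfold vertexRatio
      linear_combination (∏ j, if j = k then (1 : ℂ) else s (z k - z j))⁻¹ * h1
    generalize (∏ j, s (z k - (z j + incr x k j * h))) / (∏ j, if j = k then 1 else s (z k - z j))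
      = P at *
    generalize s (z k - (w + (∑ l, incr x k l : ℕ) * h)) = A at *
    rw [sum_incr, Nat.add_sub_cancel, parityDen_succ]
    generalize ∑ l, x l = X at *
    push_cast at h3 ⊢
    generalize baseWeight s h z (incr x k) = B at *
    generalize baseWeight s h (shiftVar h z k) x = B' at *
    generalize radialFac s h lam (M + 1) (X + 1) = R at *
    generalize s (lam + ((X : ℂ) + 1) * h) = S at *
    generalize radialFac s h (lam + 2 * h) M X = R' at *
    generalize s (lam + h) * s (lam + 2 * h) * (s (-((M + 1) * h)) / s (lam + (M + 2) * h)) = Q at *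
    generalize complFac s h (w + 2 * h) (shiftVar h z k) x = C at *
    generalize vertexFac s h (a + h) (b + h) e f g (shiftVar h z k) M x = V at *
    generalize s (e + z k) * s (f + z k) * s (g + z k) * s (-((M + 1) * h) - a + z k)
          / s (a + h - b + z k) = V' at *
    generalize cdFac s h (a + h) c d (lam + 2 * h) X = F at *
    generalize s b * s (d - c) / (s (a - c) * s (a - d) * (s (a + h - c) * s (a + h - d))) = K at *
    generalize parityDen s h a e f g lam (∑ i, z i) n (M + 1) 1 = D at *
    generalize parityDen s h (a + h) e f g (lam + 2 * h) (∑ i, z i + h) n M X = D' at *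
    generalize vertexRatio s z k = v at *
    generalize s (z k - w) = u at *
    have c1 : A⁻¹ * A = 1 := inv_mul_cancel₀ n1
    simp only [div_eq_mul_inv, mul_inv]
    rw [show -(P * (u * A⁻¹) * -(C * A)) * (B * (V * V') * R * (S * F * K) * (D⁻¹ * D'⁻¹))
      = (P * B) * (R * S) * (A⁻¹ * A) * (u * C * V * V' * F * K * D⁻¹ * D'⁻¹) by ring, h4, h3, c1]
    ring
  · intro x hx
    simp only [T]
    rw [← Finset.mul_prod_erase _ _ (Finset.mem_univ k), hx]
    simp [hs.zero]

end RightContiguity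

end EllipticBailey
end

noncomputable section

namespace EllipticBailey

open Finset

/-! ### Agreement of the two sets of coefficients. -/

section Coefficients

variable {s : ℂ → ℂ} {h : ℂ} {n : ℕ}

variable (s h) in
/-- The constant in front of the right-hand side, in additive notation. -/
def rightConst (a e f g lam : ℂ) (z : Fin n → ℂ) (N : ℕ) : ℂ :=
  (∏ i, sp s h (a + h + z i) N) / (∏ i, sp s h (a + h - z i) N)
    / (sp s h (lam + h) N * (sp s h (a + h - e) N * sp s h (a + h - f) N * sp s h (a + h - g) N))
    * parityNum s h a e f g lam (∑ i, z i) n N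

/-- Balancing identifies the last factors of the numerator, up to sign, with the first factors of
the denominator. One sign changes for odd `n` and three for even `n`, so the total sign is the same.
-/
theorem parityNum_succ (hs : IsSigma s) {a e f g lam Z : ℂ} (M : ℕ)
    (hb : a + (M + 2) * h + lam = e + f + g + 2 * Z) :
    parityNum s h a e f g lam Z n (M + 1) = -(parityDen s h a e f g lam Z n (M + 1) 1
      * parityNum s h (a + h) e f g (lam + 2 * h) (Z + h) n M) := by
  have p : ∀ {t v : ℂ}, t = -v → s t = -s v := fun {t v} e => by rw [e, hs.odd]
  have q : ∀ {t v : ℂ}, v = t + h → sp s h t (M + 1) = s t * sp s h v M := fun {t v} e => by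
    rw [sp_succ', e]
  have q1 : ∀ t, sp s h t 1 = s t := fun t => by rw [sp_succ', sp_zero, mul_one]
  unfold parityNum parityDen
  simp only [q1]
  split_ifs
  · rw [sp_succ, q (show lam + 2 * h + h - e - (Z + h) = lam + h - e - Z + h by ring),
      q (show lam + 2 * h + h - f - (Z + h) = lam + h - f - Z + h by ring),
      q (show lam + 2 * h + h - g - (Z + h) = lam + h - g - Z + h by ring),
      p (show a + h - Z + M * h = -(-(((M + 1 : ℕ) : ℂ) * h) + Z - a) by push_cast; ring),
      show a + h + h - (Z + h) = a + h - Z by ring]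
    ring
  · have k : ∀ t, a + h + h - t - (Z + h) = a + h - t - Z := fun t => by ring
    rw [q (show lam + 2 * h + h - (Z + h) = lam + h - Z + h by ring), sp_succ, sp_succ, sp_succ,
      p (show a + h - e - Z + M * h = -(lam + h - f - g - Z) by linear_combination hb),
      p (show a + h - f - Z + M * h = -(lam + h - e - g - Z) by linear_combination hb),
      p (show a + h - g - Z + M * h = -(lam + h - e - f - Z) by linear_combination hb), k, k, k]
    ring

/-- The decisive compatibility: with the constant of the right-hand side included, the two
contiguous relations have identical coefficients. The factors coming from `c` and `d` match because
`c + d - a = -(lam + b - a)`. -/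
theorem rightConst_mul_rightCoeff (hs : IsSigma s) {a b c d e f g lam : ℂ} {z : Fin n → ℂ} {M : ℕ}
    (hb : a + (M + 2) * h + lam = e + f + g + 2 * ∑ i, z i) (hcd : c + d + b + lam = 2 * a)
    (k : Fin n) (az : NZ s h (a + z k)) (az' : NZ s h (a - z k)) (cz : NZ s h (c + z k))
    (dz : NZ s h (d + z k)) (hl : NZ s h lam)
    (hden : parityDen s h a e f g lam (∑ i, z i) n (M + 1) 1 ≠ 0) :
    rightConst s h a e f g lam z (M + 1) * rightCoeff s h a b c d e f g lam z M k
      = leftCoeff s h a b c d e f g z M k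
        * rightConst s h (a + h) e f g (lam + 2 * h) (shiftVar h z k) M := by
  have h1 := prod_sp_add_shiftVar (s := s) (h := h) a z k M
  have h2 := prod_sp_sub_shiftVar (s := s) (h := h) a z k M
  have h3 := sp_shift_two (s := s) (h := h) (lam + h) M
  have q : ∀ t, sp s h (a + h - t) (M + 1) = s (a + h - t) * sp s h (a + h + h - t) M := fun t => by
    rw [sp_succ', show a + h - t + h = a + h + h - t by ring]
  rw [show lam + h + h = lam + 2 * h by ring, show lam + h + 2 * h = lam + 2 * h + h by ring,
    show lam + h + (M + 1) * h = lam + (M + 2) * h by ring] at h3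
  unfold rightConst leftCoeff rightCoeff coreConst
  rw [sum_shiftVar, parityNum_succ hs M hb, ← h2, q e, q f, q g,
    show z k + c + d - a = z k - (lam + b - a) by linear_combination hcd,
    show -((M + 1) * h) - a + z k = -(a + (M + 1) * h - z k) by ring, hs.odd (a + (M + 1) * h - z k)]
  have n1 : s (a + (M + 2) * h + z k) ≠ 0 := az.at (M + 2) (by push_cast; ring)
  have n2 : s (a + (M + 1) * h - z k) ≠ 0 := az'.at (M + 1) (by push_cast; ring)
  have n3 : s (c + z k) ≠ 0 := cz.at 0 (by simp)
  have n4 : s (d + z k) ≠ 0 := dz.at 0 (by simp)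
  have n5 : s (lam + (M + 2) * h) ≠ 0 := hl.at (M + 2) (by push_cast; ring)
  have n6 : sp s h (lam + h) (M + 1) ≠ 0 := hl.sp 1 (by push_cast; ring) _
  have n7 : sp s h (lam + 2 * h + h) M ≠ 0 := hl.sp 3 (by push_cast; ring) _
  have h1' : (∏ i, sp s h (a + h + z i) (M + 1)) = (∏ i, sp s h (a + h + h + shiftVar h z k i) M)
      * ((∏ i, s (a + h + z i)) * s (a + 2 * h + z k)) * (s (a + (M + 2) * h + z k))⁻¹ := by
    rw [h1, mul_inv_cancel_right₀ n1]
  have h3' : s (lam + h) * s (lam + 2 * h) * (sp s h (lam + h) (M + 1))⁻¹ * (s (lam + (M + 2) * h))⁻¹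
      = (sp s h (lam + 2 * h + h) M)⁻¹ := by
    generalize sp s h (lam + 2 * h + h) M = A at *
    generalize sp s h (lam + h) (M + 1) = B at *
    generalize s (lam + (M + 2) * h) = C at *
    generalize s (lam + 2 * h) = D at *
    field_simp
    linear_combination h3
  rw [h1']
  have c2 := mul_inv_cancel₀ n2
  have c3 := mul_inv_cancel₀ n3
  have c4 := mul_inv_cancel₀ n4
  have c5 := mul_inv_cancel₀ hden
  clear h1 h2 h3 h1' q
  simp only [div_eq_mul_inv, mul_inv]
  rw [← h3']
  generalize (sp s h (lam + h) (M + 1))⁻¹ = B at *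
  generalize (s (lam + (M + 2) * h))⁻¹ = C at *
  generalize parityDen s h a e f g lam (∑ i, z i) n (M + 1) 1 = x5 at *
  generalize s (a + (M + 1) * h - z k) = x2 at *
  generalize s (c + z k) = x3 at *
  generalize s (d + z k) = x4 at *
  generalize parityNum s h (a + h) e f g (lam + 2 * h) (∑ i, z i + h) n M = P
  generalize (∏ i, sp s h (a + h + h + shiftVar h z k i) M) = A1
  generalize (∏ i, s (a + h + z i)) = A2
  generalize (∏ i, sp s h (a + h + h - shiftVar h z k i) M)⁻¹ = A3
  generalize (∏ i, if i = k then 1 else s (a + h - z i))⁻¹ = A4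
  generalize vertexRatio s z k = R
  generalize s (a + 2 * h + z k) = A5
  generalize s (e + z k) = A6
  generalize s (f + z k) = A7
  generalize s (g + z k) = A8
  generalize (s (a + h - b + z k))⁻¹ = A9
  generalize (s (a + (M + 2) * h + z k))⁻¹ = A10
  generalize s (-((M + 1) * h)) = A11
  generalize s b = A12
  generalize s (d - c) = A13
  generalize (s (a - c))⁻¹ = A14
  generalize (s (a - d))⁻¹ = A15
  generalize (s (a + h - c))⁻¹ = A16
  generalize (s (a + h - d))⁻¹ = A17
  generalize (s (a + h - e))⁻¹ = A18
  generalize (s (a + h - f))⁻¹ = A19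
  generalize (s (a + h - g))⁻¹ = A20
  generalize (sp s h (a + h + h - e) M)⁻¹ = A21
  generalize (sp s h (a + h + h - f) M)⁻¹ = A22
  generalize (sp s h (a + h + h - g) M)⁻¹ = A23
  generalize s (z k - (lam + b - a)) = A24
  generalize s (lam + h) = A25
  generalize s (lam + 2 * h) = A26
  refine Eq.trans (b := -(R * (A1 * A2 * A5 * A10) * A3 * A4 * P * (A24 * A6 * A7 * A8 * A9)
    * (A11 * A12 * A13 * A14 * A15 * A16 * A17) * (A18 * A19 * A20 * A21 * A22 * A23)
    * (A25 * A26 * B * C))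
    * ((x2 * x2⁻¹) * (x5 * x5⁻¹))) (by ring) (Eq.trans (b := -(R * (A1 * A2 * A5 * A10) * A3 * A4 * P
    * (A24 * A6 * A7 * A8 * A9)
    * (A11 * A12 * A13 * A14 * A15 * A16 * A17) * (A18 * A19 * A20 * A21 * A22 * A23)
    * (A25 * A26 * B * C))
    * ((x3 * x3⁻¹) * (x4 * x4⁻¹))) (by rw [c2, c3, c4, c5]) (by ring))

end Coefficients

end EllipticBailey
end

noncomputable section

namespace EllipticBailey

open Finset

/-! ### Interpolation of products symmetric under `c ↦ B - c`. -/

section Interpolation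

variable {s : ℂ → ℂ} {B : ℂ}

variable (s B) in
/-- Products of `m` functions of the form `s (c + u) * s (B - c + u)`. -/
inductive SymmProd : ℕ → (ℂ → ℂ) → Prop
  | one : SymmProd 0 fun _ => 1
  | mul_factor (u : ℂ) {m : ℕ} {F : ℂ → ℂ} (hF : SymmProd m F) :
      SymmProd (m + 1) fun c => F c * (s (c + u) * s (B - c + u))

theorem SymmProd.mul {m k : ℕ} {F G : ℂ → ℂ} (hF : SymmProd s B m F) (hG : SymmProd s B k G) :
    SymmProd s B (m + k) fun c => F c * G c := by
  induction hG with
  | one => simpa using hF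
  | mul_factor u _ ih =>
    rw [← add_assoc]
    simpa only [mul_assoc] using ih.mul_factor u

theorem SymmProd.sp (h u : ℂ) (k : ℕ) :
    SymmProd s B k fun c => sp s h (c + u) k * sp s h (B - c + u) k := by
  induction k with
  | zero => simpa [sp_zero] using SymmProd.one
  | succ k ih =>
    have := ih.mul_factor (u + k * h)
    convert this using 2 with c
    rw [sp_succ, sp_succ, add_assoc, add_assoc]
    ring

theorem SymmProd.prod {ι : Type*} (S : Finset ι) (m : ι → ℕ) (F : ι → ℂ → ℂ)
    (hF : ∀ i, SymmProd s B (m i) (F i)) :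
    SymmProd s B (∑ i ∈ S, m i) fun c => ∏ i ∈ S, F i c := by
  classical
  induction S using Finset.induction_on with
  | empty => simpa using SymmProd.one
  | insert i S hi ih =>
    simp only [Finset.sum_insert hi, Finset.prod_insert hi]
    exact (hF i).mul ih

variable (s B) in
/-- The kernel `s (x - y) s (x + y - B)`. -/
def symmKer (x y : ℂ) : ℂ := s (x - y) * s (x + y - B)

variable (s B) in
/-- The interpolation operator at the points `c 0, …, c m`. -/
def interpolant (c : ℕ → ℂ) (m : ℕ) (F : ℂ → ℂ) (x : ℂ) : ℂ :=
  ∑ i ∈ range (m + 1), (∏ j ∈ (range (m + 1)).erase i, symmKer s B x (c j) / symmKer s B (c i) (c j))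
    * F (c i)

/-- The three-term relation centred at `B / 2`; it is the case of one factor, where two nodes
suffice. -/
theorem symmKer_two_point (hs : IsSigma s) (u x c c' : ℂ) :
    s (x + u) * s (B - x + u) * symmKer s B c c'
      = s (c + u) * s (B - c + u) * symmKer s B x c'
        - s (c' + u) * s (B - c' + u) * symmKer s B x c := by
  have h := hs.three_term (u + B / 2) (x - B / 2) (c - B / 2) (c' - B / 2)
  rw [show u + B / 2 + (x - B / 2) = x + u by ring, show u + B / 2 - (x - B / 2) = B - x + u by ring,
    show c - B / 2 + (c' - B / 2) = c + c' - B by ring, show c - B / 2 - (c' - B / 2) = c - c' by ring,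
    show u + B / 2 + (c' - B / 2) = c' + u by ring, show u + B / 2 - (c' - B / 2) = B - c' + u by ring,
    show c - B / 2 + (x - B / 2) = x + c - B by ring, show c - B / 2 - (x - B / 2) = -(x - c) by ring,
    show x - B / 2 + (c' - B / 2) = x + c' - B by ring, show x - B / 2 - (c' - B / 2) = x - c' by ring,
    show u + B / 2 + (c - B / 2) = c + u by ring, show u + B / 2 - (c - B / 2) = B - c + u by ring,
    hs.odd] at h
  unfold symmKer
  linear_combination h

theorem symmKer_antisymm (hs : IsSigma s) (x y : ℂ) : symmKer s B x y = -symmKer s B y x := by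
  unfold symmKer
  rw [show x - y = -(y - x) by ring, hs.odd, add_comm x y]
  ring

/-- A product of `m` factors is recovered from `m + 1` nodes. A further factor is interpolated, in
the term of node `c i`, between `c i` and the new node. -/
theorem SymmProd.eq_interpolant (hs : IsSigma s) {m : ℕ} {F : ℂ → ℂ} (hF : SymmProd s B m F)
    (c : ℕ → ℂ) (hc : ∀ i ≤ m, ∀ j ≤ m, i ≠ j → symmKer s B (c i) (c j) ≠ 0) (x : ℂ) :
    F x = interpolant s B c m F x := by
  induction hF generalizing x with
  | one => simp [interpolant]
  | @mul_factor u m F _ ih =>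
    have ih' := fun x => ih (fun i hi j hj hij => hc i (by omega) j (by omega) hij) x
    unfold interpolant at ih' ⊢
    rw [Finset.sum_range_succ]
    have hlast : (range (m + 1 + 1)).erase (m + 1) = range (m + 1) := by
      ext j; simp only [Finset.mem_erase, Finset.mem_range]; omega
    have hone : ∀ i ∈ range (m + 1), (range (m + 1 + 1)).erase i
        = insert (m + 1) ((range (m + 1)).erase i) := by
      intro i hi
      ext j
      simp only [Finset.mem_erase, Finset.mem_range, Finset.mem_insert] at *
      omega
    -- The first part is the term of the larger interpolant at `c i`. The second parts, summed over
    -- `i`, reassemble `F (c (m+1))` by the induction hypothesis at the new node.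
    have hterm : ∀ i ∈ range (m + 1),
        (∏ j ∈ (range (m + 1)).erase i, symmKer s B x (c j) / symmKer s B (c i) (c j)) * F (c i)
          * (s (x + u) * s (B - x + u))
        = (∏ j ∈ (range (m + 1 + 1)).erase i, symmKer s B x (c j) / symmKer s B (c i) (c j))
            * (F (c i) * (s (c i + u) * s (B - c i + u)))
          + (∏ j ∈ range (m + 1), symmKer s B x (c j) / symmKer s B (c (m + 1)) (c j))
            * ((∏ j ∈ (range (m + 1)).erase i, symmKer s B (c (m + 1)) (c j) / symmKer s B (c i) (c j))
              * F (c i)) * (s (c (m + 1) + u) * s (B - c (m + 1) + u)) := by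
      intro i hi
      have hi' : i < m + 1 := Finset.mem_range.1 hi
      have h2 := symmKer_two_point (B := B) hs u x (c i) (c (m + 1))
      have n1 := hc i (by omega) (m + 1) le_rfl (by omega)
      have n2 := hc (m + 1) le_rfl i (by omega) (by omega)
      have h3 : (∏ j ∈ (range (m + 1)).erase i, symmKer s B x (c j) / symmKer s B (c (m + 1)) (c j))
          * (∏ j ∈ (range (m + 1)).erase i, symmKer s B (c (m + 1)) (c j) / symmKer s B (c i) (c j))
          = ∏ j ∈ (range (m + 1)).erase i, symmKer s B x (c j) / symmKer s B (c i) (c j) := by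
        rw [← Finset.prod_mul_distrib]
        refine Finset.prod_congr rfl fun j hj => ?_
        rw [Finset.mem_erase, Finset.mem_range] at hj
        exact div_mul_div_cancel₀ (hc (m + 1) le_rfl j (by omega) (by omega))
      rw [hone i hi, Finset.prod_insert (by simp), ← Finset.mul_prod_erase (range (m + 1))
        (fun j => symmKer s B x (c j) / symmKer s B (c (m + 1)) (c j)) hi]
      rw [← h3]
      rw [symmKer_antisymm hs (c (m + 1)) (c i)]
      generalize (∏ j ∈ (range (m + 1)).erase i, symmKer s B x (c j) / symmKer s B (c (m + 1)) (c j)) = P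
      generalize (∏ j ∈ (range (m + 1)).erase i,
        symmKer s B (c (m + 1)) (c j) / symmKer s B (c i) (c j)) = Q
      generalize symmKer s B (c i) (c (m + 1)) = K at *
      field_simp
      linear_combination (P * Q * F (c i)) * h2
    beta_reduce
    rw [ih' x, Finset.sum_mul, Finset.sum_congr rfl hterm, Finset.sum_add_distrib, hlast]
    congr 1
    rw [← Finset.sum_mul, ← Finset.mul_sum, ← ih' (c (m + 1))]
    ring

theorem sum_symmProd_eq_zero (hs : IsSigma s) {ι : Type*} (S : Finset ι) {m : ℕ} (k : ι → ℂ)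
    (F : ι → ℂ → ℂ) (hF : ∀ i ∈ S, SymmProd s B m (F i)) (c : ℕ → ℂ)
    (hc : ∀ i ≤ m, ∀ j ≤ m, i ≠ j → symmKer s B (c i) (c j) ≠ 0)
    (h0 : ∀ i ≤ m, ∑ l ∈ S, k l * F l (c i) = 0) (x : ℂ) : ∑ l ∈ S, k l * F l x = 0 := by
  have h1 : ∀ l ∈ S, k l * F l x = ∑ i ∈ range (m + 1),
      (∏ j ∈ (range (m + 1)).erase i, symmKer s B x (c j) / symmKer s B (c i) (c j))
        * (k l * F l (c i)) := fun l hl => by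
    rw [(hF l hl).eq_interpolant hs c hc x, interpolant, Finset.mul_sum]
    exact Finset.sum_congr rfl fun i _ => by ring
  rw [Finset.sum_congr rfl h1, Finset.sum_comm]
  refine Finset.sum_eq_zero fun i hi => ?_
  rw [← Finset.mul_sum, h0 i (by rw [Finset.mem_range] at hi; omega), mul_zero]

end Interpolation

end EllipticBailey
end

noncomputable section

namespace EllipticBailey

open Finset

/-! ### The transformation for generic parameters. -/

section GenericTransformation

variable {s : ℂ → ℂ} {h : ℂ} {n : ℕ}

variable (s h) in
/-- Genericity of the parameters other than `c` and `d`. -/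
structure BaileyGeneric (a b e f g lam : ℂ) (z : Fin n → ℂ) : Prop where
  vars : GenericVars s h z
  az : ∀ i, NZ s h (a + z i)
  az' : ∀ i, NZ s h (a - z i)
  ae : NZ s h (a - e)
  af : NZ s h (a - f)
  ag : NZ s h (a - g)
  lm : NZ s h lam
  bb : NZ s h b
  bl : NZ s h (b - lam)
  abz : ∀ i, NZ s h (a - b + z i)
  wz : ∀ i, NZ s h (lam + b - a - z i)
  laz : ∀ i, NZ s h (a - lam + z i)
  za : NZ s h (∑ i, z i - a)
  le : NZ s h (lam - e - ∑ i, z i)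
  lf : NZ s h (lam - f - ∑ i, z i)
  lg : NZ s h (lam - g - ∑ i, z i)
  lz : NZ s h (lam - ∑ i, z i)
  lef : NZ s h (lam - e - f - ∑ i, z i)
  leg : NZ s h (lam - e - g - ∑ i, z i)
  lfg : NZ s h (lam - f - g - ∑ i, z i)

theorem NZ.add_shiftVar {t t' : ℂ} {z : Fin n → ℂ} (H : ∀ i, NZ s h (t + z i)) (k : Fin n) (m : ℤ)
    (e : t' = t + m * h) (i : Fin n) : NZ s h (t' + shiftVar h z k i) := by
  by_cases hi : i = k
  · subst hi; exact (H i).shift (m + 1) (by rw [shiftVar_self, e]; push_cast; ring)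
  · exact (H i).shift m (by rw [shiftVar_of_ne z hi, e]; ring)

theorem NZ.sub_shiftVar {t t' : ℂ} {z : Fin n → ℂ} (H : ∀ i, NZ s h (t - z i)) (k : Fin n) (m : ℤ)
    (e : t' = t + m * h) (i : Fin n) : NZ s h (t' - shiftVar h z k i) := by
  by_cases hi : i = k
  · subst hi; exact (H i).shift (m - 1) (by rw [shiftVar_self, e]; push_cast; ring)
  · exact (H i).shift m (by rw [shiftVar_of_ne z hi, e]; ring)

theorem BaileyGeneric.shift {a b e f g lam : ℂ} {z : Fin n → ℂ}
    (H : BaileyGeneric s h a b e f g lam z) (k : Fin n) :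
    BaileyGeneric s h (a + h) (b + h) e f g (lam + 2 * h) (shiftVar h z k) where
  vars := H.vars.shift k
  az := NZ.add_shiftVar H.az k 1 (by push_cast; ring)
  az' := NZ.sub_shiftVar H.az' k 1 (by push_cast; ring)
  ae := H.ae.shift 1 (by push_cast; ring)
  af := H.af.shift 1 (by push_cast; ring)
  ag := H.ag.shift 1 (by push_cast; ring)
  lm := H.lm.shift 2 (by push_cast; ring)
  bb := H.bb.shift 1 (by push_cast; ring)
  bl := H.bl.shift (-1) (by push_cast; ring)
  abz := NZ.add_shiftVar H.abz k 0 (by push_cast; ring)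
  wz := NZ.sub_shiftVar H.wz k 2 (by push_cast; ring)
  laz := NZ.add_shiftVar H.laz k (-1) (by push_cast; ring)
  za := H.za.shift 0 (by rw [sum_shiftVar]; push_cast; ring)
  le := H.le.shift 1 (by rw [sum_shiftVar]; push_cast; ring)
  lf := H.lf.shift 1 (by rw [sum_shiftVar]; push_cast; ring)
  lg := H.lg.shift 1 (by rw [sum_shiftVar]; push_cast; ring)
  lz := H.lz.shift 1 (by rw [sum_shiftVar]; push_cast; ring)
  lef := H.lef.shift 1 (by rw [sum_shiftVar]; push_cast; ring)
  leg := H.leg.shift 1 (by rw [sum_shiftVar]; push_cast; ring)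
  lfg := H.lfg.shift 1 (by rw [sum_shiftVar]; push_cast; ring)

theorem BaileyGeneric.parityDen_ne_zero {a b e f g lam : ℂ} {z : Fin n → ℂ}
    (H : BaileyGeneric s h a b e f g lam z) (N X : ℕ) :
    parityDen s h a e f g lam (∑ i, z i) n N X ≠ 0 := by
  unfold parityDen
  split_ifs
  · exact mul_ne_zero (H.za.sp (-N) (by push_cast; ring) X) (mul_ne_zero (mul_ne_zero
      (H.le.sp 1 (by push_cast; ring) X) (H.lf.sp 1 (by push_cast; ring) X))
      (H.lg.sp 1 (by push_cast; ring) X))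
  · exact mul_ne_zero (H.lz.sp 1 (by push_cast; ring) X) (mul_ne_zero (mul_ne_zero
      (H.lef.sp 1 (by push_cast; ring) X) (H.leg.sp 1 (by push_cast; ring) X))
      (H.lfg.sp 1 (by push_cast; ring) X))

theorem upFac_mul_downFac {a t : ℂ} {z : Fin n → ℂ} (h1 : ∀ i, NZ s h (t + z i))
    (h2 : NZ s h (a - t)) (x : Fin n → ℕ) : upFac s h a t z x * downFac s h a t z x = 1 := by
  unfold upFac downFac
  rw [div_mul_div_cancel₀ (h2.sp 1 (by push_cast; ring) _), div_self]
  exact Finset.prod_ne_zero_iff.2 fun i _ => (h1 i).sp 0 (by simp) _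

theorem baseWeight_zero {z : Fin n → ℂ} (H : GenericVars s h z) :
    baseWeight s h z (fun _ => 0) = 1 := by
  have h1 : ∏ i, ∏ j ∈ Finset.Ioi i, pairWeight s h z (fun _ => 0) i j = 1 :=
    Finset.prod_eq_one fun i _ => Finset.prod_eq_one fun j hj => by
      simp [pairWeight, sp_zero, div_self ((H.2 i j (Finset.mem_Ioi.1 hj).ne).at 0
        (by simp : z i - z j = _))]
  simp [baseWeight, sp_zero, h1]

theorem rightConst_eq_jacksonValue {a e f g lam : ℂ} (z : Fin n → ℂ) (N : ℕ) :
    rightConst s h a e f g lam z N = jacksonValue s h a e f g (a - lam) z N := by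
  have k : ∀ t, a + h - (a - lam) - t = lam + h - t := fun t => by ring
  unfold rightConst jacksonValue parityNum jacksonParity
  simp only [k]
  rw [show a + h - (a - lam) = lam + h by ring]

/-- The transformation at the point where the right-hand side reduces to one term. -/
theorem bailey_initial (hs : IsSigma s) {a b e f g lam : ℂ} {z : Fin n → ℂ}
    (H : BaileyGeneric s h a b e f g lam z) (N : ℕ)
    (hb : a + (N + 1) * h + lam = e + f + g + 2 * ∑ i, z i) :
    ∑ x ∈ simplex n N, leftSummand s h a b (a - lam) (a + h - b) e f g z N x
      = rightConst s h a e f g lam z N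
        * ∑ x ∈ simplex n N, rightSummand s h a b (a - lam) (a + h - b) e f g lam z N x := by
  have HJ : JacksonGeneric s h a e f g (a - lam) z :=
    { vars := H.vars, az := H.az, az' := H.az', ae := H.ae, af := H.af, ag := H.ag
      uz := H.laz
      au := H.lm.shift 0 (by push_cast; ring) }
  -- Since `d = a + h - b`, the numerator factor of `d` cancels the denominator factor of `b`, and
  -- `u = a - lam` is left.
  have h1 : ∀ x, leftSummand s h a b (a - lam) (a + h - b) e f g z N x
      = jacksonTerm s h a e f g (a - lam) z N x := fun x => by
    have := upFac_mul_downFac (a := a) (t := a + h - b) (z := z) (s := s) (h := h)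
      (fun i => (H.abz i).shift 1 (by push_cast; ring)) (H.bb.shift (-1) (by push_cast; ring)) x
    unfold leftSummand jacksonTerm
    linear_combination (coreWeight s h a z x * upFac s h a (a - lam) z x * (upFac s h a e z x
      * upFac s h a f z x * upFac s h a g z x) * downFac s h a (a + (N + 1) * h) z x) * this
  have h2 : ∑ x ∈ simplex n N, rightSummand s h a b (a - lam) (a + h - b) e f g lam z N x = 1 := by
    rw [Finset.sum_eq_single (fun _ => 0)]
    · unfold rightSummand
      rw [baseWeight_zero H.vars]
      simp [complFac, vertexFac, radialFac, cdFac, parityDen, sp_zero,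
        div_self (H.lm.at 0 (by simp : lam = _))]
    · intro x _ hx
      have hX : ∑ l, x l ≠ 0 := fun h0 => hx (funext fun i => by
        rw [Finset.sum_eq_zero_iff] at h0
        exact h0 i (Finset.mem_univ i))
      obtain ⟨Y, hY⟩ := Nat.exists_eq_succ_of_ne_zero hX
      unfold rightSummand cdFac
      -- For `c = a - lam` the factorial `(lam + c - a)_X` starts with `s 0`, so only `x = 0`
      -- survives.
      rw [hY, Nat.succ_eq_add_one, sp_succ', show lam + (a - lam) - a = 0 by ring, hs.zero]
      simp
    · intro h0
      exact absurd (mem_simplex.2 (by simp)) h0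
  rw [Finset.sum_congr rfl fun x _ => h1 x, h2, mul_one, rightConst_eq_jacksonValue]
  exact jackson_sum hs HJ N (by linear_combination hb)

/-- The transformation at `(c, d + h)`, together with its shifted instances of lower order, implies the
transformation at `(c + h, d)`. -/
theorem bailey_contiguous (hs : IsSigma s) {a b c d e f g lam : ℂ} {z : Fin n → ℂ} {M : ℕ}
    (H : BaileyGeneric s h a b e f g lam z)
    (hb : a + (M + 2) * h + lam = e + f + g + 2 * ∑ i, z i) (hcd : c + d + b + lam = 2 * a)
    (hc : ∀ i, NZ s h (c + z i)) (hd : ∀ i, NZ s h (d + z i)) (hac : NZ s h (a - c))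
    (had : NZ s h (a - d)) (hdc : s (d - c) ≠ 0)
    (ih : ∀ k, ∑ x ∈ simplex n M, leftSummand s h (a + h) (b + h) c d e f g (shiftVar h z k) M x
      = rightConst s h (a + h) e f g (lam + 2 * h) (shiftVar h z k) M * ∑ x ∈ simplex n M,
        rightSummand s h (a + h) (b + h) c d e f g (lam + 2 * h) (shiftVar h z k) M x)
    (h0 : ∑ x ∈ simplex n (M + 1), leftSummand s h a b c (d + h) e f g z (M + 1) x
      = rightConst s h a e f g lam z (M + 1)
        * ∑ x ∈ simplex n (M + 1), rightSummand s h a b c (d + h) e f g lam z (M + 1) x) :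
    ∑ x ∈ simplex n (M + 1), leftSummand s h a b (c + h) d e f g z (M + 1) x
      = rightConst s h a e f g lam z (M + 1)
        * ∑ x ∈ simplex n (M + 1), rightSummand s h a b (c + h) d e f g lam z (M + 1) x := by
  rw [left_contiguous hs H.vars H.az H.az' hc hd hac had hdc,
    right_contiguous hs H.vars H.wz H.lm hac had hcd, h0, mul_add]
  congr 1
  rw [Finset.mul_sum]
  refine Finset.sum_congr rfl fun k _ => ?_
  rw [ih k, ← mul_assoc, ← mul_assoc, rightConst_mul_rightCoeff hs hb hcd k (H.az k) (H.az' k) (hc k)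
    (hd k) H.lm (H.parityDen_ne_zero _ _)]

theorem sp_split (u : ℂ) {X N : ℕ} (hX : X ≤ N) :
    sp s h u N = sp s h u X * sp s h (u + X * h) (N - X) := by
  obtain ⟨m, rfl⟩ := Nat.exists_eq_add_of_le hX
  rw [Nat.add_sub_cancel_left]
  unfold sp
  rw [Finset.prod_range_add]
  congr 1
  refine Finset.prod_congr rfl fun j _ => ?_
  congr 1
  push_cast
  ring

variable (s h) in
/-- The part of the left-hand summand that depends on `c`, cleared of denominators. -/
def leftNumerator (a B : ℂ) (z : Fin n → ℂ) (N : ℕ) (x : Fin n → ℕ) (c : ℂ) : ℂ :=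
  (∏ i, sp s h (c + z i) (x i) * sp s h (B - c + z i) (x i))
    * (sp s h (c + (a + h + (∑ l, x l : ℕ) * h - B)) (N - ∑ l, x l)
      * sp s h (B - c + (a + h + (∑ l, x l : ℕ) * h - B)) (N - ∑ l, x l))

variable (s h) in
/-- The part of the right-hand summand that depends on `c`, cleared of denominators. -/
def rightNumerator (a lam B : ℂ) (N X : ℕ) (c : ℂ) : ℂ :=
  sp s h (c + (lam - a)) X * sp s h (B - c + (lam - a)) X
    * (sp s h (c + (a + h + X * h - B)) (N - X) * sp s h (B - c + (a + h + X * h - B)) (N - X))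

/-- There are `x i` factors for each variable and `N - X` factors from the unused tails of
`(a+h-c)_N` and `(a+h-d)_N`: always `N` in all, whatever `x` is. -/
theorem leftNumerator_symmProd (a B : ℂ) (z : Fin n → ℂ) {N : ℕ} {x : Fin n → ℕ}
    (hx : x ∈ simplex n N) : SymmProd s B N (leftNumerator s h a B z N x) := by
  have h1 := (SymmProd.prod (s := s) (B := B) univ x _ fun i => SymmProd.sp h (z i) (x i)).mul
    (SymmProd.sp h (a + h + (∑ l, x l : ℕ) * h - B) (N - ∑ l, x l))
  rwa [Nat.add_sub_cancel' (mem_simplex.1 hx)] at h1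

theorem rightNumerator_symmProd (a lam B : ℂ) {N X : ℕ} (hX : X ≤ N) :
    SymmProd s B N (rightNumerator s h a lam B N X) := by
  have h1 := (SymmProd.sp (s := s) (B := B) h (lam - a) X).mul
    (SymmProd.sp h (a + h + X * h - B) (N - X))
  rwa [Nat.add_sub_cancel' hX] at h1

variable (s h) in
/-- The part of the left-hand summand that is independent of `c` and `d`. -/
def leftRest (a b e f g : ℂ) (z : Fin n → ℂ) (N : ℕ) (x : Fin n → ℕ) : ℂ :=
  coreWeight s h a z x * (upFac s h a e z x * upFac s h a f z x * upFac s h a g z x)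
    * (downFac s h a (a + (N + 1) * h) z x * downFac s h a (a + h - b) z x)

variable (s h) in
/-- The part of the right-hand summand that is independent of `c` and `d`. -/
def rightRest (a b e f g lam : ℂ) (z : Fin n → ℂ) (N : ℕ) (x : Fin n → ℕ) : ℂ :=
  baseWeight s h z x * complFac s h (lam + b - a) z x * vertexFac s h a b e f g z N x
    * radialFac s h lam N (∑ l, x l) / parityDen s h a e f g lam (∑ i, z i) n N (∑ l, x l)

theorem leftRest_mul_numerator (a b e f g B c d : ℂ) (hB : c + d = B) (z : Fin n → ℂ) {N : ℕ}
    {x : Fin n → ℕ} (hx : x ∈ simplex n N)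
    (hc : sp s h (a + h - c) N ≠ 0) (hd : sp s h (a + h - d) N ≠ 0) :
    leftRest s h a b e f g z N x * leftNumerator s h a B z N x c
      = leftSummand s h a b c d e f g z N x * (sp s h (a + h - c) N * sp s h (a + h - d) N) := by
  rw [sp_split _ (mem_simplex.1 hx)] at hc hd ⊢
  rw [sp_split (a + h - d) (mem_simplex.1 hx)]
  unfold leftRest leftSummand leftNumerator
  rw [Finset.prod_mul_distrib,
    show upFac s h a c z x = (∏ i, sp s h (c + z i) (x i)) / sp s h (a + h - c) (∑ l, x l) from rfl,
    show upFac s h a d z x = (∏ i, sp s h (d + z i) (x i)) / sp s h (a + h - d) (∑ l, x l) from rfl,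
    show B - c = d by rw [← hB]; ring,
    show c + (a + h + (∑ l, x l : ℕ) * h - B) = a + h - d + (∑ l, x l : ℕ) * h by rw [← hB]; ring,
    show d + (a + h + (∑ l, x l : ℕ) * h - B) = a + h - c + (∑ l, x l : ℕ) * h by rw [← hB]; ring]
  have n1 := left_ne_zero_of_mul hc
  have n2 := left_ne_zero_of_mul hd
  generalize sp s h (a + h - c) (∑ l, x l) = A1 at *
  generalize sp s h (a + h - d) (∑ l, x l) = A2 at *
  have c1 := inv_mul_cancel₀ n1
  have c2 := inv_mul_cancel₀ n2
  generalize sp s h (a + h - c + (∑ l, x l : ℕ) * h) (N - ∑ l, x l) = A3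
  generalize sp s h (a + h - d + (∑ l, x l : ℕ) * h) (N - ∑ l, x l) = A4
  generalize ∏ i, sp s h (c + z i) (x i) = A5
  generalize ∏ i, sp s h (d + z i) (x i) = A6
  generalize upFac s h a e z x * upFac s h a f z x * upFac s h a g z x = A7
  generalize downFac s h a (a + (N + 1) * h) z x * downFac s h a (a + h - b) z x = A8
  generalize coreWeight s h a z x = A9
  rw [show A9 * (A5 / A1 * (A6 / A2) * A7) * A8 * (A1 * A3 * (A2 * A4))
    = A9 * A7 * A8 * (A5 * A6 * (A4 * A3)) * ((A1⁻¹ * A1) * (A2⁻¹ * A2)) by ring, c1, c2]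
  ring

theorem rightRest_mul_numerator (a b e f g lam B c d : ℂ) (hB : c + d = B) (z : Fin n → ℂ) {N : ℕ}
    {x : Fin n → ℕ} (hx : x ∈ simplex n N)
    (hc : sp s h (a + h - c) N ≠ 0) (hd : sp s h (a + h - d) N ≠ 0) :
    rightRest s h a b e f g lam z N x * rightNumerator s h a lam B N (∑ l, x l) c
      = rightSummand s h a b c d e f g lam z N x
        * (sp s h (a + h - c) N * sp s h (a + h - d) N) := by
  rw [sp_split _ (mem_simplex.1 hx)] at hc hd ⊢
  rw [sp_split (a + h - d) (mem_simplex.1 hx)]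
  unfold rightRest rightSummand rightNumerator cdFac
  rw [show B - c = d by rw [← hB]; ring,
    show c + (a + h + (∑ l, x l : ℕ) * h - B) = a + h - d + (∑ l, x l : ℕ) * h by rw [← hB]; ring,
    show d + (a + h + (∑ l, x l : ℕ) * h - B) = a + h - c + (∑ l, x l : ℕ) * h by rw [← hB]; ring,
    show c + (lam - a) = lam + c - a by ring, show d + (lam - a) = lam + d - a by ring]
  have n1 := left_ne_zero_of_mul hc
  have n2 := left_ne_zero_of_mul hd
  generalize sp s h (a + h - c) (∑ l, x l) = A1 at *
  generalize sp s h (a + h - d) (∑ l, x l) = A2 at *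
  have c1 := inv_mul_cancel₀ n1
  have c2 := inv_mul_cancel₀ n2
  generalize sp s h (a + h - c + (∑ l, x l : ℕ) * h) (N - ∑ l, x l) = A3
  generalize sp s h (a + h - d + (∑ l, x l : ℕ) * h) (N - ∑ l, x l) = A4
  generalize sp s h (lam + c - a) (∑ l, x l) = A5
  generalize sp s h (lam + d - a) (∑ l, x l) = A6
  generalize baseWeight s h z x * complFac s h (lam + b - a) z x * vertexFac s h a b e f g z N x
    * radialFac s h lam N (∑ l, x l) = A7
  generalize parityDen s h a e f g lam (∑ i, z i) n N (∑ l, x l) = A8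
  rw [show A7 * (A5 * A6 / (A1 * A2)) / A8 * (A1 * A3 * (A2 * A4))
    = A7 / A8 * (A5 * A6 * (A4 * A3)) * ((A1⁻¹ * A1) * (A2⁻¹ * A2)) by field_simp, c1, c2]
  ring

/-- The transformation, given its validity at sufficiently many special points. -/
theorem bailey_interpolation (hs : IsSigma s) (N : ℕ) {a b c d e f g lam : ℂ} {z : Fin n → ℂ}
    (H : BaileyGeneric s h a b e f g lam z) (hac : NZ s h (a - c)) (had : NZ s h (a - d))
    (hcd : c + d = 2 * a + h - b - lam)
    (hpt : ∀ k ≤ N, ∑ x ∈ simplex n N,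
        leftSummand s h a b (a - lam + k * h) (a + h - b - k * h) e f g z N x
        = rightConst s h a e f g lam z N * ∑ x ∈ simplex n N,
          rightSummand s h a b (a - lam + k * h) (a + h - b - k * h) e f g lam z N x) :
    ∑ x ∈ simplex n N, leftSummand s h a b c d e f g z N x
      = rightConst s h a e f g lam z N
        * ∑ x ∈ simplex n N, rightSummand s h a b c d e f g lam z N x := by
  set B := 2 * a + h - b - lam with hB
  -- Both sides are placed in one family indexed by a disjoint union, the right one with negative
  -- weights. The transformation becomes the vanishing of a single combination of symmetric
  -- products.
  have hD : ∀ c d, c + d = B → NZ s h (a - c) → NZ s h (a - d) →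
      ∑ l ∈ (simplex n N).disjSum (simplex n N), Sum.elim (leftRest s h a b e f g z N)
        (fun x => -rightConst s h a e f g lam z N * rightRest s h a b e f g lam z N x) l
        * Sum.elim (leftNumerator s h a B z N)
          (fun x => rightNumerator s h a lam B N (∑ l, x l)) l c
      = (∑ x ∈ simplex n N, leftSummand s h a b c d e f g z N x
        - rightConst s h a e f g lam z N
          * ∑ x ∈ simplex n N, rightSummand s h a b c d e f g lam z N x)
        * (sp s h (a + h - c) N * sp s h (a + h - d) N) := by
    intro c d hcd hac had
    have m1 := hac.sp 1 (by push_cast; ring : a + h - c = _) N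
    have m2 := had.sp 1 (by push_cast; ring : a + h - d = _) N
    rw [Finset.sum_disjSum]
    simp only [Sum.elim_inl, Sum.elim_inr, mul_assoc]
    have e1 := Finset.sum_congr rfl fun x (hx : x ∈ simplex n N) =>
      leftRest_mul_numerator a b e f g B c d hcd z hx m1 m2
    have e2 := Finset.sum_congr rfl fun x (hx : x ∈ simplex n N) =>
      rightRest_mul_numerator a b e f g lam B c d hcd z hx m1 m2
    rw [← Finset.mul_sum, e1, e2, ← Finset.sum_mul, ← Finset.sum_mul]
    ring
  have h0 := sum_symmProd_eq_zero hs ((simplex n N).disjSum (simplex n N)) (m := N) (B := B)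
    (Sum.elim (leftRest s h a b e f g z N)
        (fun x => -rightConst s h a e f g lam z N * rightRest s h a b e f g lam z N x))
    (Sum.elim (leftNumerator s h a B z N)
          (fun x => rightNumerator s h a lam B N (∑ l, x l)))
    (by
      intro l hl
      rcases l with x | x
      · exact leftNumerator_symmProd a B z (Finset.inl_mem_disjSum.1 hl)
      · exact rightNumerator_symmProd a lam B (mem_simplex.1 (Finset.inr_mem_disjSum.1 hl)))
    (fun k => a - lam + k * h)
    (by
      intro i _ j _ hij
      refine mul_ne_zero (mul_int_ne_zero H.vars.1 ((i : ℤ) - j) (by omega) (by push_cast; ring))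
        (H.bl.at ((i : ℤ) + j - 1) ?_)
      rw [hB]; push_cast; ring)
    (by
      intro k hk
      rw [hD (a - lam + k * h) (a + h - b - k * h) (by rw [hB]; ring)
        (H.lm.shift (-k) (by push_cast; ring)) (H.bb.shift (k - 1) (by push_cast; ring)), hpt k hk]
      ring) c
  rw [hD c d hcd hac had] at h0
  exact sub_eq_zero.1 ((mul_eq_zero.1 h0).resolve_right
    (mul_ne_zero (hac.sp 1 (by push_cast; ring) N) (had.sp 1 (by push_cast; ring) N)))

/-- The transformation for generic parameters. -/
theorem bailey_generic (hs : IsSigma s) (N : ℕ) {a b c d e f g lam : ℂ} {z : Fin n → ℂ}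
    (H : BaileyGeneric s h a b e f g lam z) (hac : NZ s h (a - c)) (had : NZ s h (a - d))
    (hb : a + (N + 1) * h + lam = e + f + g + 2 * ∑ i, z i) (hcd : c + d = 2 * a + h - b - lam) :
    ∑ x ∈ simplex n N, leftSummand s h a b c d e f g z N x
      = rightConst s h a e f g lam z N
        * ∑ x ∈ simplex n N, rightSummand s h a b c d e f g lam z N x := by
  induction N generalizing a b c d lam z with
  | zero =>
    refine bailey_interpolation hs 0 H hac had hcd fun k hk => ?_
    obtain rfl := Nat.le_zero.1 hk
    simpa using bailey_initial hs H 0 hb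
  | succ M ih =>
    have hpt : ∀ k : ℕ, ∑ x ∈ simplex n (M + 1),
        leftSummand s h a b (a - lam + k * h) (a + h - b - k * h) e f g z (M + 1) x
        = rightConst s h a e f g lam z (M + 1) * ∑ x ∈ simplex n (M + 1),
          rightSummand s h a b (a - lam + k * h) (a + h - b - k * h) e f g lam z (M + 1) x := by
      intro k
      induction k with
      | zero =>
        have := bailey_initial hs H (M + 1) hb
        simpa using this
      | succ k ihk =>
        have n1 : NZ s h (a - (a - lam + k * h)) := H.lm.shift (-k) (by push_cast; ring)
        have n2 : NZ s h (a - (a - b - k * h)) := H.bb.shift k (by push_cast; ring)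
        -- With this `d`, the pair `(c, d + h)` is the node `k` and `(c + h, d)` the node `k + 1`;
        -- the shifted sums have order `M` and fall under the outer induction hypothesis.
        have := bailey_contiguous hs (c := a - lam + k * h) (d := a - b - k * h) (M := M) H
          (by push_cast at hb; linear_combination hb) (by ring)
          (fun i => (H.laz i).shift k (by push_cast; ring))
          (fun i => (H.abz i).shift (-k) (by push_cast; ring)) n1 n2
          (((H.bl.neg hs rfl).shift (-2 * k) (by push_cast; ring :
            a - b - k * h - (a - lam + k * h) = _)).at 0 (by simp))
          (fun j => ih (H.shift j) (n1.shift 1 (by push_cast; ring)) (n2.shift 1 (by push_cast; ring))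
            (by rw [sum_shiftVar]; push_cast at hb; linear_combination hb) (by ring))
          (by rw [show a - b - k * h + h = a + h - b - k * h by ring]; exact ihk)
        rw [show a - lam + ((k + 1 : ℕ) : ℂ) * h = a - lam + k * h + h by push_cast; ring,
          show a + h - b - ((k + 1 : ℕ) : ℂ) * h = a - b - k * h by push_cast; ring]
        exact this
    exact bailey_interpolation hs (M + 1) H hac had hcd fun k _ => hpt k

end GenericTransformation

end EllipticBailey
end

noncomputable section

namespace EllipticBailey

open Finset Filter Topology

/-! ### Continuity of both sides at a point without vanishing denominators. -/

section Continuity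

variable {s : ℂ → ℂ} {n : ℕ}

@[fun_prop]
theorem continuous_sp (hs : Continuous s) {h u : ℂ → ℂ} (hh : Continuous h) (hu : Continuous u)
    (k : ℕ) : Continuous fun t => sp s (h t) (u t) k := by
  unfold sp
  exact continuous_finsetProd _ fun j _ => hs.comp (hu.add (continuous_const.mul hh))

theorem sp_ne_zero_of_le {h u : ℂ} {k N : ℕ} (hk : k ≤ N) (H : sp s h u N ≠ 0) :
    sp s h u k ≠ 0 := by
  rw [sp_split u hk] at H
  exact left_ne_zero_of_mul H

theorem le_of_mem_simplex {N : ℕ} {x : Fin n → ℕ} (hx : x ∈ simplex n N) (i : Fin n) : x i ≤ N :=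
  (Finset.single_le_sum (fun _ _ => Nat.zero_le _) (Finset.mem_univ i)).trans (mem_simplex.1 hx)

variable (s) in
/-- No denominator of the two sides of the transformation vanishes. -/
structure BaileyRegular (h a b c d e f g lam : ℂ) (z : Fin n → ℂ) (N : ℕ) : Prop where
  zz : ∀ i j, i ≠ j → s (z i - z j) ≠ 0
  az : ∀ i, s (a + z i) ≠ 0
  lm : s lam ≠ 0
  ac : sp s h (a + h - c) N ≠ 0
  ad : sp s h (a + h - d) N ≠ 0
  ae : sp s h (a + h - e) N ≠ 0
  af : sp s h (a + h - f) N ≠ 0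
  ag : sp s h (a + h - g) N ≠ 0
  lh : sp s h (lam + h) N ≠ 0
  lN : sp s h (lam + (N + 1) * h) N ≠ 0
  az' : ∀ i, sp s h (a + h - z i) N ≠ 0
  aNz : ∀ i, sp s h (a + (N + 1) * h + z i) N ≠ 0
  abz : ∀ i, sp s h (a + h - b + z i) N ≠ 0
  hzz : ∀ i j, sp s h (h + z i - z j) N ≠ 0
  wz : ∀ x ∈ simplex n N, ∀ i, sp s h (lam + b - a - z i) (∑ l, x l - x i) ≠ 0
  den : parityDen s h a e f g lam (∑ i, z i) n N N ≠ 0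

variable {h a b c d e f g lam : ℂ → ℂ} {z : ℂ → Fin n → ℂ} {N : ℕ}

theorem continuousAt_baseWeight (hs : Continuous s) (ch : Continuous h)
    (cz : ∀ i, Continuous fun t => z t i) {t₀ : ℂ}
    (zz : ∀ i j, i ≠ j → s (z t₀ i - z t₀ j) ≠ 0)
    (hzz : ∀ i j, sp s (h t₀) (h t₀ + z t₀ i - z t₀ j) N ≠ 0) {x : Fin n → ℕ}
    (hx : ∀ i, x i ≤ N) : ContinuousAt (fun t => baseWeight s (h t) (z t) x) t₀ := by
  -- The diagonal case controls `(h)_{x i}`; the index `i` is kept because `n` may be zero.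
  have hh : ∀ i : Fin n, sp s (h t₀) (h t₀) N ≠ 0 := fun i => by simpa using hzz i i
  unfold baseWeight
  refine ContinuousAt.mul ?_ ?_
  · refine tendsto_finsetProd _ fun i _ => tendsto_finsetProd _ fun j hj => ?_
    unfold pairWeight
    refine ContinuousAt.mul (ContinuousAt.div ?_ ?_ ?_) ?_
    · exact Continuous.continuousAt (by fun_prop)
    · exact Continuous.continuousAt (by fun_prop)
    · exact mul_ne_zero (mul_ne_zero (zz i j (Finset.mem_Ioi.1 hj).ne)
        (sp_ne_zero_of_le (hx i) (hzz i j))) (sp_ne_zero_of_le (hx j) (hzz j i))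
    · exact Continuous.continuousAt (by fun_prop)
  · refine tendsto_finsetProd _ fun i _ => ?_
    exact ContinuousAt.inv₀ (Continuous.continuousAt (by fun_prop)) (sp_ne_zero_of_le (hx i) (hh i))

theorem continuousAt_upFac (hs : Continuous s) (ch : Continuous h) (ca : Continuous a)
    (cc : Continuous c) (cz : ∀ i, Continuous fun t => z t i) {t₀ : ℂ}
    (ac : sp s (h t₀) (a t₀ + h t₀ - c t₀) N ≠ 0) {x : Fin n → ℕ} (hx : x ∈ simplex n N) :
    ContinuousAt (fun t => upFac s (h t) (a t) (c t) (z t) x) t₀ := by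
  unfold upFac
  exact ContinuousAt.div (Continuous.continuousAt (by fun_prop)) (Continuous.continuousAt (by fun_prop))
    (sp_ne_zero_of_le (mem_simplex.1 hx) ac)

theorem continuousAt_downFac (hs : Continuous s) (ch : Continuous h) (ca : Continuous a)
    (cc : Continuous c) (cz : ∀ i, Continuous fun t => z t i) {t₀ : ℂ}
    (cz' : ∀ i, sp s (h t₀) (c t₀ + z t₀ i) N ≠ 0) {x : Fin n → ℕ} (hx : x ∈ simplex n N) :
    ContinuousAt (fun t => downFac s (h t) (a t) (c t) (z t) x) t₀ := by
  unfold downFac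
  exact ContinuousAt.div (Continuous.continuousAt (by fun_prop)) (Continuous.continuousAt (by fun_prop))
    (Finset.prod_ne_zero_iff.2 fun i _ => sp_ne_zero_of_le (le_of_mem_simplex hx i) (cz' i))

theorem continuousAt_leftSummand (hs : Continuous s) (ch : Continuous h) (ca : Continuous a)
    (cb : Continuous b) (cc : Continuous c) (cd : Continuous d) (ce : Continuous e)
    (cf : Continuous f) (cg : Continuous g) (cz : ∀ i, Continuous fun t => z t i) {t₀ : ℂ}
    (R : BaileyRegular s (h t₀) (a t₀) (b t₀) (c t₀) (d t₀) (e t₀) (f t₀) (g t₀) (lam t₀) (z t₀) N)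
    {x : Fin n → ℕ} (hx : x ∈ simplex n N) :
    ContinuousAt (fun t => leftSummand s (h t) (a t) (b t) (c t) (d t) (e t) (f t) (g t) (z t) N x)
      t₀ := by
  unfold leftSummand
  refine ContinuousAt.mul (ContinuousAt.mul ?_ (ContinuousAt.mul (ContinuousAt.mul ?_ ?_)
    (ContinuousAt.mul (ContinuousAt.mul ?_ ?_) ?_))) (ContinuousAt.mul ?_ ?_)
  · unfold coreWeight
    refine ContinuousAt.mul (continuousAt_baseWeight hs ch cz R.zz R.hzz (le_of_mem_simplex hx))
      (tendsto_finsetProd _ fun i _ => ?_)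
    unfold wellPoised
    exact ContinuousAt.div (Continuous.continuousAt (by fun_prop))
      (Continuous.continuousAt (by fun_prop)) (mul_ne_zero (R.az i)
        (sp_ne_zero_of_le ((Nat.sub_le _ _).trans (mem_simplex.1 hx)) (R.az' i)))
  · exact continuousAt_upFac hs ch ca cc cz R.ac hx
  · exact continuousAt_upFac hs ch ca cd cz R.ad hx
  · exact continuousAt_upFac hs ch ca ce cz R.ae hx
  · exact continuousAt_upFac hs ch ca cf cz R.af hx
  · exact continuousAt_upFac hs ch ca cg cz R.ag hx
  · exact continuousAt_downFac hs ch ca (by fun_prop) cz R.aNz hx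
  · exact continuousAt_downFac hs ch ca (by fun_prop) cz R.abz hx

theorem continuous_parityDen (hs : Continuous s) (ch : Continuous h) (ca : Continuous a)
    (ce : Continuous e) (cf : Continuous f) (cg : Continuous g) (cl : Continuous lam)
    (cz : ∀ i, Continuous fun t => z t i) (N X : ℕ) :
    Continuous fun t => parityDen s (h t) (a t) (e t) (f t) (g t) (lam t) (∑ i, z t i) n N X := by
  unfold parityDen
  split_ifs <;> fun_prop

theorem continuous_parityNum (hs : Continuous s) (ch : Continuous h) (ca : Continuous a)
    (ce : Continuous e) (cf : Continuous f) (cg : Continuous g) (cl : Continuous lam)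
    (cz : ∀ i, Continuous fun t => z t i) (N : ℕ) :
    Continuous fun t => parityNum s (h t) (a t) (e t) (f t) (g t) (lam t) (∑ i, z t i) n N := by
  unfold parityNum
  split_ifs <;> fun_prop

theorem parityDen_ne_zero_of_le {h a e f g lam Z : ℂ} {M X N : ℕ} (hX : X ≤ N)
    (H : parityDen s h a e f g lam Z n M N ≠ 0) : parityDen s h a e f g lam Z n M X ≠ 0 := by
  unfold parityDen at *
  split_ifs at * <;>
  · simp only [mul_ne_zero_iff] at H ⊢
    exact ⟨sp_ne_zero_of_le hX H.1, ⟨sp_ne_zero_of_le hX H.2.1.1, sp_ne_zero_of_le hX H.2.1.2⟩,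
      sp_ne_zero_of_le hX H.2.2⟩

theorem continuousAt_rightSummand (hs : Continuous s) (ch : Continuous h) (ca : Continuous a)
    (cb : Continuous b) (cc : Continuous c) (cd : Continuous d) (ce : Continuous e)
    (cf : Continuous f) (cg : Continuous g) (cl : Continuous lam)
    (cz : ∀ i, Continuous fun t => z t i) {t₀ : ℂ}
    (R : BaileyRegular s (h t₀) (a t₀) (b t₀) (c t₀) (d t₀) (e t₀) (f t₀) (g t₀) (lam t₀) (z t₀) N)
    {x : Fin n → ℕ} (hx : x ∈ simplex n N) :
    ContinuousAt (fun t => rightSummand s (h t) (a t) (b t) (c t) (d t) (e t) (f t) (g t) (lam t)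
      (z t) N x) t₀ := by
  have hX := mem_simplex.1 hx
  unfold rightSummand
  refine ContinuousAt.div (ContinuousAt.mul (ContinuousAt.mul (ContinuousAt.mul (ContinuousAt.mul
    (continuousAt_baseWeight hs ch cz R.zz R.hzz (le_of_mem_simplex hx)) ?_) ?_) ?_) ?_)
    (continuous_parityDen hs ch ca ce cf cg cl cz N _).continuousAt (parityDen_ne_zero_of_le hX R.den)
  · unfold complFac
    refine tendsto_finsetProd _ fun i _ => ?_
    exact ContinuousAt.div (Continuous.continuousAt (by fun_prop))
      (Continuous.continuousAt (by fun_prop)) (R.wz x hx i)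
  · unfold vertexFac
    exact ContinuousAt.div (Continuous.continuousAt (by fun_prop))
      (Continuous.continuousAt (by fun_prop)) (Finset.prod_ne_zero_iff.2 fun i _ =>
        sp_ne_zero_of_le (le_of_mem_simplex hx i) (R.abz i))
  · unfold radialFac
    refine ContinuousAt.div (ContinuousAt.mul (ContinuousAt.mul (ContinuousAt.div ?_ ?_ R.lm) ?_) ?_)
      ?_ (sp_ne_zero_of_le hX R.lN) <;> exact Continuous.continuousAt (by fun_prop)
  · unfold cdFac
    exact ContinuousAt.div (Continuous.continuousAt (by fun_prop))
      (Continuous.continuousAt (by fun_prop))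
      (mul_ne_zero (sp_ne_zero_of_le hX R.ac) (sp_ne_zero_of_le hX R.ad))

theorem continuousAt_rightConst (hs : Continuous s) (ch : Continuous h) (ca : Continuous a)
    (ce : Continuous e) (cf : Continuous f) (cg : Continuous g) (cl : Continuous lam)
    (cz : ∀ i, Continuous fun t => z t i) {t₀ : ℂ}
    (R : BaileyRegular s (h t₀) (a t₀) (b t₀) (c t₀) (d t₀) (e t₀) (f t₀) (g t₀) (lam t₀) (z t₀) N) :
    ContinuousAt (fun t => rightConst s (h t) (a t) (e t) (f t) (g t) (lam t) (z t) N) t₀ := by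
  unfold rightConst
  refine ContinuousAt.mul (ContinuousAt.div (ContinuousAt.div ?_ ?_
    (Finset.prod_ne_zero_iff.2 fun i _ => R.az' i)) ?_ (mul_ne_zero R.lh
      (mul_ne_zero (mul_ne_zero R.ae R.af) R.ag)))
    (continuous_parityNum hs ch ca ce cf cg cl cz N).continuousAt
    <;> exact Continuous.continuousAt (by fun_prop)

end Continuity

/-! ### Genericity outside a countable set of the perturbation parameter. -/

section Perturbation

variable {s : ℂ → ℂ} {n : ℕ}

theorem eq_zero_of_eventually_cocountable {F : ℂ → ℂ} {t₀ : ℂ} (hF : ContinuousAt F t₀)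
    (h : ∀ᶠ t in cocountable, F t = 0) : F t₀ = 0 := by
  have h1 : Set.Countable {t | F t = 0}ᶜ := mem_cocountable.1 h
  have h2 : Dense {t | F t = 0} := by simpa using h1.dense_compl ℝ
  have h3 : (𝓝[{t | F t = 0}] t₀).NeBot := mem_closure_iff_nhdsWithin_neBot.1 (h2 t₀)
  refine tendsto_nhds_unique (l := 𝓝[{t | F t = 0}] t₀) (hF.tendsto.mono_left nhdsWithin_le_nhds)
    (Filter.Tendsto.congr' ?_ tendsto_const_nhds)
  filter_upwards [self_mem_nhdsWithin] with t ht
  exact ht.symm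

theorem eventually_ne_zero (hs : IsSigma s) (u : ℂ → ℂ) (hu : ∀ t, u t = u 0 + t * (u 1 - u 0))
    (h1 : u 1 - u 0 ≠ 0) : ∀ᶠ t in cocountable, s (u t) ≠ 0 := by
  refine mem_cocountable.2 ((hs.countable_zeros_comp h1 (u 0)).mono fun t ht => ?_)
  simp only [Set.mem_compl_iff, Set.mem_ofPred_eq, not_not] at ht ⊢
  rw [← hu]; exact ht

/-- The step `h` moves in the imaginary direction. If `u` moves with non-zero real part, then `u +
m*h` is non-constant for every integer `m`, so each condition fails on a countable set only, and a
countable union remains countable. -/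
theorem eventually_NZ (hs : IsSigma s) {h₀ : ℂ} (u : ℂ → ℂ) (hu : ∀ t, u t = u 0 + t * (u 1 - u 0))
    (h1 : (u 1 - u 0).re ≠ 0) : ∀ᶠ t in cocountable, NZ s (h₀ + t * Complex.I) (u t) := by
  refine mem_cocountable.2 ((Set.countable_iUnion fun m : ℤ => mem_cocountable.1
    (eventually_ne_zero hs (fun t => u t + m * (h₀ + t * Complex.I))
      (fun t => by rw [hu t]; ring) fun h0 => h1 ?_)).mono fun t ht => ?_)
  · have : u 1 - u 0 = -(m * Complex.I) := by linear_combination h0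
    rw [this]; simp
  · simp only [Set.mem_compl_iff, Set.mem_ofPred_eq, Set.mem_iUnion, NZ, not_forall] at ht ⊢
    exact ht

end Perturbation

end EllipticBailey
end

noncomputable section

namespace EllipticBailey

open Finset Filter Topology

/-! ### Removal of the genericity assumptions. -/

section Additive

variable {s : ℂ → ℂ} {n : ℕ}

/-- The transformation in additive notation. -/
theorem bailey_additive (hs : IsSigma s) {h a b c d e f g lam : ℂ} {z : Fin n → ℂ} {N : ℕ}
    (R : BaileyRegular s h a b c d e f g lam z N)
    (hb : a + (N + 1) * h + lam = e + f + g + 2 * ∑ i, z i) (hcd : c + d = 2 * a + h - b - lam) :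
    ∑ x ∈ simplex n N, leftSummand s h a b c d e f g z N x
      = rightConst s h a e f g lam z N
        * ∑ x ∈ simplex n N, rightSummand s h a b c d e f g lam z N x := by
  -- The speeds of the `z i` are distinct and positive with sum `ζ`, and `T = ζ + 1` exceeds them
  -- all. Speeds `T`, `10 T`, `100 T`, `1000 T` of `a, b, e, f` are spread so widely that no
  -- combination in `BaileyGeneric` has speed with zero real part.
  obtain ⟨ε, hε⟩ : ∃ ε : Fin n → ℝ, ε = fun i : Fin n => ((i : ℕ) : ℝ) + 1 := ⟨_, rfl⟩
  obtain ⟨ζ, hζ⟩ : ∃ ζ : ℝ, ζ = ∑ i, ε i := ⟨_, rfl⟩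
  have hε0 : ∀ i, 0 < ε i := fun i => by rw [hε]; positivity
  have hεζ : ∀ i, ε i ≤ ζ := fun i => by
    rw [hζ]; exact Finset.single_le_sum (fun j _ => (hε0 j).le) (Finset.mem_univ i)
  have hζ0 : 0 ≤ ζ := by rw [hζ]; exact Finset.sum_nonneg fun j _ => (hε0 j).le
  obtain ⟨T, hT⟩ : ∃ T : ℝ, T = ζ + 1 := ⟨_, rfl⟩
  have hεne : ∀ i j, i ≠ j → ε i - ε j ≠ 0 := fun i j hij h0 => hij (by
    rw [hε] at h0
    have : ((i : ℕ) : ℝ) = (j : ℕ) := by linarith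
    exact Fin.ext (by exact_mod_cast this))
  set I := Complex.I with hI
  let h' : ℂ → ℂ := fun t => h + t * I
  let a' : ℂ → ℂ := fun t => a + t * T
  let b' : ℂ → ℂ := fun t => b + t * (10 * T)
  let e' : ℂ → ℂ := fun t => e + t * (100 * T)
  let f' : ℂ → ℂ := fun t => f + t * (1000 * T)
  -- With `c` and `d` fixed, the speeds of `lam` and `g` are forced by the two balancing conditions.
  let lam' : ℂ → ℂ := fun t => lam + t * (I - 8 * T)
  let g' : ℂ → ℂ := fun t => g + t * ((N + 2) * I - 1107 * T - 2 * ζ)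
  let z' : ℂ → Fin n → ℂ := fun t i => z i + t * ε i
  have hz' : ∀ t, ∑ i, z' t i = ∑ i, z i + t * ζ := fun t => by
    simp only [z']
    rw [Finset.sum_add_distrib, ← Finset.mul_sum, hζ]
    push_cast; rfl
  have R0 : BaileyRegular s (h' 0) (a' 0) (b' 0) c d (e' 0) (f' 0) (g' 0) (lam' 0) (z' 0) N := by
    simpa [h', a', b', e', f', g', lam', z'] using R
  have key := eq_zero_of_eventually_cocountable (t₀ := 0)
    (F := fun t => ∑ x ∈ simplex n N, leftSummand s (h' t) (a' t) (b' t) c d (e' t) (f' t) (g' t)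
      (z' t) N x - rightConst s (h' t) (a' t) (e' t) (f' t) (g' t) (lam' t) (z' t) N
        * ∑ x ∈ simplex n N, rightSummand s (h' t) (a' t) (b' t) c d (e' t) (f' t) (g' t) (lam' t)
          (z' t) N x) ?_ ?_
  · simp only [h', a', b', e', f', g', lam', z', zero_mul, add_zero] at key
    exact sub_eq_zero.1 key
  · have ch : Continuous h' := by fun_prop
    have ca : Continuous a' := by fun_prop
    have cb : Continuous b' := by fun_prop
    have cc : Continuous fun _ : ℂ => c := by fun_prop
    have cd : Continuous fun _ : ℂ => d := by fun_prop
    have ce : Continuous e' := by fun_prop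
    have cf : Continuous f' := by fun_prop
    have cg : Continuous g' := by fun_prop
    have cl : Continuous lam' := by fun_prop
    have cz : ∀ i, Continuous fun t => z' t i := fun i => by fun_prop
    refine ContinuousAt.sub (tendsto_finsetSum _ fun x hx => ?_) (ContinuousAt.mul ?_
      (tendsto_finsetSum _ fun x hx => ?_))
    · exact continuousAt_leftSummand (lam := lam') hs.cont ch ca cb cc cd ce cf cg cz R0 hx
    · exact continuousAt_rightConst (b := b') (c := fun _ => c) (d := fun _ => d) hs.cont ch ca ce cf cg
        cl cz R0
    · exact continuousAt_rightSummand hs.cont ch ca cb cc cd ce cf cg cl cz R0 hx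
  · have A : ∀ (u : ℂ → ℂ) (v α : ℂ), (∀ t, u t = v + t * α) → α.re ≠ 0 →
        ∀ᶠ t in cocountable, NZ s (h' t) (u t) := fun u v α hu hα => by
      refine eventually_NZ hs u (fun t => ?_) ?_
      · rw [hu t, hu 0, hu 1]; ring
      · rwa [hu 0, hu 1, show v + 1 * α - (v + 0 * α) = α by ring]
    have v1 : ∀ᶠ t in cocountable, ∀ m : ℤ, m ≠ 0 → s (m * h' t) ≠ 0 := by
      have : ∀ m : ℤ, ∀ᶠ t in cocountable, m ≠ 0 → s (m * h' t) ≠ 0 := fun m => by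
        by_cases hm : m = 0
        · simp [hm]
        · filter_upwards [eventually_ne_zero hs (fun t => m * h' t) (fun t => by simp only [h']; ring)
            (by
              simp only [h', hI]
              rw [show m * (h + 1 * Complex.I) - m * (h + 0 * Complex.I) = m * Complex.I by ring]
              exact mul_ne_zero (by exact_mod_cast hm) Complex.I_ne_zero)] with t ht _
          exact ht
      refine mem_cocountable.2 ((Set.countable_iUnion fun m : ℤ =>
        mem_cocountable.1 (this m)).mono fun t ht => ?_)
      simp only [Set.mem_compl_iff, Set.mem_ofPred_eq, Set.mem_iUnion, not_forall] at ht ⊢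
      exact ht
    have v2 : ∀ᶠ t in cocountable, ∀ i j, i ≠ j → NZ s (h' t) (z' t i - z' t j) :=
      eventually_all.2 fun i => eventually_all.2 fun j => by
        by_cases hij : i = j
        · simp [hij]
        · filter_upwards [A (fun t => z' t i - z' t j) (z i - z j) (ε i - ε j)
            (fun t => by simp only [z']; ring) (by simpa using hεne i j hij)] with t ht _
          exact ht
    have w1 : ∀ᶠ t in cocountable, ∀ i, NZ s (h' t) (a' t + z' t i) := eventually_all.2 fun i =>
      A _ (a + z i) (T + ε i) (fun t => by simp only [a', z']; ring)
        (by simp; linarith [hε0 i])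
    have w2 : ∀ᶠ t in cocountable, ∀ i, NZ s (h' t) (a' t - z' t i) := eventually_all.2 fun i =>
      A _ (a - z i) (T - ε i) (fun t => by simp only [a', z']; ring)
        (by simp; linarith [hεζ i])
    have w3 := A (fun t => a' t - e' t) (a - e) (-99 * T) (fun t => by simp only [a', e']; ring)
      (by simp; linarith)
    have w4 := A (fun t => a' t - f' t) (a - f) (-999 * T) (fun t => by simp only [a', f']; ring)
      (by simp; linarith)
    have w5 := A (fun t => a' t - g' t) (a - g) (1108 * T + 2 * ζ - (N + 2) * I)
      (fun t => by simp only [a', g']; ring) (by simp [hI]; linarith)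
    have w6 := A (fun t => lam' t) lam (I - 8 * T) (fun t => by simp only [lam'])
      (by simp [hI]; linarith)
    have w7 := A (fun t => b' t) b (10 * T) (fun t => by simp only [b']) (by simp; linarith)
    have w8 := A (fun t => b' t - lam' t) (b - lam) (18 * T - I)
      (fun t => by simp only [b', lam']; ring) (by simp [hI]; linarith)
    have w9 : ∀ᶠ t in cocountable, ∀ i, NZ s (h' t) (a' t - b' t + z' t i) :=
      eventually_all.2 fun i => A _ (a - b + z i) (-9 * T + ε i)
        (fun t => by simp only [a', b', z']; ring) (by simp; linarith [hεζ i])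
    have w10 : ∀ᶠ t in cocountable, ∀ i, NZ s (h' t) (lam' t + b' t - a' t - z' t i) :=
      eventually_all.2 fun i => A _ (lam + b - a - z i) (T - ε i + I)
        (fun t => by simp only [a', b', z', lam']; ring) (by simp [hI]; linarith [hεζ i])
    have w11 : ∀ᶠ t in cocountable, ∀ i, NZ s (h' t) (a' t - lam' t + z' t i) :=
      eventually_all.2 fun i => A _ (a - lam + z i) (9 * T + ε i - I)
        (fun t => by simp only [a', z', lam']; ring) (by simp [hI]; linarith [hε0 i])
    have B : ∀ (u : ℂ → ℂ → ℂ) (v α : ℂ), (∀ t, u t (∑ i, z i + t * ζ) = v + t * α) → α.re ≠ 0 →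
        ∀ᶠ t in cocountable, NZ s (h' t) (u t (∑ i, z' t i)) := fun u v α hu hα =>
      A _ v α (fun t => by rw [hz', hu]) hα
    generalize hZ : ∑ i, z i = Z at B
    have w12 := B (fun t y => y - a' t) (Z - a) (ζ - T) (fun t => by simp only [a']; ring)
      (by simp; linarith)
    have w13 := B (fun t y => lam' t - e' t - y) (lam - e - Z) (I - 108 * T - ζ)
      (fun t => by simp only [lam', e']; ring) (by simp [hI]; linarith)
    have w14 := B (fun t y => lam' t - f' t - y) (lam - f - Z) (I - 1008 * T - ζ)
      (fun t => by simp only [lam', f']; ring) (by simp [hI]; linarith)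
    have w15 := B (fun t y => lam' t - g' t - y) (lam - g - Z) (I - (N + 2) * I + 1099 * T + ζ)
      (fun t => by simp only [lam', g']; ring) (by simp [hI]; linarith)
    have w16 := B (fun t y => lam' t - y) (lam - Z) (I - 8 * T - ζ)
      (fun t => by simp only [lam']; ring) (by simp [hI]; linarith)
    have w17 := B (fun t y => lam' t - e' t - f' t - y) (lam - e - f - Z) (I - 1108 * T - ζ)
      (fun t => by simp only [lam', e', f']; ring) (by simp [hI]; linarith)
    have w18 := B (fun t y => lam' t - e' t - g' t - y) (lam - e - g - Z)
      (I - (N + 2) * I + 999 * T + ζ)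
      (fun t => by simp only [lam', e', g']; ring) (by simp [hI]; linarith)
    have w19 := B (fun t y => lam' t - f' t - g' t - y) (lam - f - g - Z)
      (I - (N + 2) * I + 99 * T + ζ)
      (fun t => by simp only [lam', f', g']; ring) (by simp [hI]; linarith)
    have w20 := A (fun t => a' t - c) (a - c) T (fun t => by simp only [a']; ring)
      (by simp; linarith)
    have w21 := A (fun t => a' t - d) (a - d) T (fun t => by simp only [a']; ring)
      (by simp; linarith)
    filter_upwards [v1, v2, w1, w2, w3, w4, w5, w6, w7, w8, w9, w10, w11, w12, w13, w14, w15, w16, w17,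
      w18, w19, w20, w21] with t v1 v2 w1 w2 w3 w4 w5 w6 w7 w8 w9 w10 w11 w12 w13 w14 w15 w16 w17 w18
      w19 w20 w21
    refine sub_eq_zero.2 (bailey_generic hs N ⟨⟨v1, v2⟩, w1, w2, w3, w4, w5, w6, w7, w8, w9, w10, w11,
      w12, w13, w14, w15, w16, w17, w18, w19⟩ w20 w21 ?_ ?_)
    · rw [hz']
      simp only [h', a', e', f', g', lam']
      rw [hZ] at hb ⊢
      linear_combination hb
    · simp only [h', a', b', lam']
      linear_combination hcd

end Additive

end EllipticBailey
end

noncomputable section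

namespace EllipticBailey

open Finset

/-! ### Bookkeeping of the exponential factors between `theta` and `sigma`. -/

section Twist

/-- `u` and `v` differ by the factor `exp (α / 2)`. -/
def Twist (α u v : ℂ) : Prop := u = Complex.exp (α / 2) * v

theorem Twist.mul {α β u v u' v' : ℂ} (h1 : Twist α u v) (h2 : Twist β u' v') :
    Twist (α + β) (u * u') (v * v') := by
  unfold Twist at *
  rw [h1, h2, add_div, Complex.exp_add]
  ring

theorem Twist.div {α β u v u' v' : ℂ} (h1 : Twist α u v) (h2 : Twist β u' v') :
    Twist (α - β) (u / u') (v / v') := by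
  unfold Twist at *
  rw [h1, h2, sub_div, Complex.exp_sub, mul_div_mul_comm]

theorem Twist.prod {ι : Type*} {S : Finset ι} {α u v : ι → ℂ} (h : ∀ i ∈ S, Twist (α i) (u i) (v i)) :
    Twist (∑ i ∈ S, α i) (∏ i ∈ S, u i) (∏ i ∈ S, v i) := by
  unfold Twist at *
  rw [Finset.prod_congr rfl h, Finset.prod_mul_distrib, ← Complex.exp_sum, Finset.sum_div]

theorem Twist.eq {α u v : ℂ} (h : Twist α u v) (h0 : α = 0) : u = v := by
  unfold Twist at h
  rw [h, h0, zero_div, Complex.exp_zero, one_mul]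

theorem Twist.exp {α u w : ℂ} (hu : u = Complex.exp w) (hα : α = 2 * w) : Twist α u 1 := by
  unfold Twist
  rw [hu, hα, mul_one]
  congr 1
  ring

theorem Twist.theta {p u U : ℂ} (hu : u = Complex.exp U) : Twist U (theta p u) (sigma p U) := by
  unfold Twist
  rw [hu, theta_exp]

/-- The exponent of a shifted factorial. -/
def wt (h u : ℂ) (k : ℕ) : ℂ := k * u + k * (k - 1) / 2 * h

theorem Twist.poch {p h u U : ℂ} (hu : u = Complex.exp U) (k : ℕ) :
    Twist (wt h U k) (poch p (Complex.exp h) u k) (sp (sigma p) h U k) := by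
  induction k with
  | zero => simp [Twist, wt, EllipticBailey.poch, sp_zero]
  | succ k ih =>
    have h1 : EllipticBailey.poch p (Complex.exp h) u (k + 1)
        = EllipticBailey.poch p (Complex.exp h) u k * EllipticBailey.theta p (Complex.exp h ^ k * u) := by
      rw [EllipticBailey.poch, Finset.prod_range_succ]; rfl
    rw [h1, sp_succ]
    have h2 := ih.mul (Twist.theta (p := p) (u := Complex.exp h ^ k * u) (U := U + k * h)
      (by rw [hu, ← Complex.exp_nat_mul, ← Complex.exp_add, add_comm]))
    convert h2 using 1
    unfold wt
    push_cast
    ring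

theorem sum_polynomial {n : ℕ} (z y : Fin n → ℂ) (α β γ δ ε : ℂ) :
    ∑ i, (α + β * y i + γ * z i + δ * (y i * z i) + ε * (y i) ^ 2)
      = n * α + β * ∑ i, y i + γ * ∑ i, z i + δ * ∑ i, y i * z i + ε * ∑ i, (y i) ^ 2 := by
  simp only [Finset.sum_add_distrib, ← Finset.mul_sum, Finset.sum_const, Finset.card_univ,
    Fintype.card_fin, nsmul_eq_mul]

theorem two_mul_sum_pairs {n : ℕ} (F : Fin n → Fin n → ℂ) (hF : ∀ i j, F i j = F j i) :
    2 * ∑ i, ∑ j ∈ Finset.Ioi i, F i j = ∑ i, ∑ j, F i j - ∑ i, F i i := by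
  have h1 : ∀ i, ∑ j, F i j = F i i + ∑ j ∈ Finset.Ioi i, F i j + ∑ j ∈ Finset.Iio i, F i j := by
    intro i
    rw [← Finset.sum_filter_add_sum_filter_not univ (fun j => i ≤ j)]
    congr 1
    · rw [show univ.filter (fun j => i ≤ j) = insert i (Finset.Ioi i) by
        ext j; simp [le_iff_eq_or_lt], Finset.sum_insert (by simp)]
    · refine Finset.sum_congr ?_ fun _ _ => rfl
      ext j; simp
  have h2 : ∑ i, ∑ j ∈ Finset.Iio i, F i j = ∑ i, ∑ j ∈ Finset.Ioi i, F i j := by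
    rw [Finset.sum_comm' (t' := univ) (s' := fun j => Finset.Ioi j) (by simp)]
    exact Finset.sum_congr rfl fun i _ => Finset.sum_congr rfl fun j _ => hF _ _
  rw [Finset.sum_congr rfl fun i _ => h1 i, Finset.sum_add_distrib, Finset.sum_add_distrib, h2]
  ring

variable {p h : ℂ} {n : ℕ}

theorem deltaRatio_twist (z : Fin n → ℂ) (x : Fin n → ℕ) :
    Twist (∑ i, ∑ j ∈ Finset.Ioi i, (x i + x j) * h)
      (deltaRatio p (Complex.exp h) (fun i => Complex.exp (z i)) x)
      (∏ i, ∏ j ∈ Finset.Ioi i,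
        sigma p (z j - z i + (x j - x i) * h) / sigma p (z j - z i)) := by
  unfold deltaRatio
  refine Twist.prod fun i _ => Twist.prod fun j _ => ?_
  have h1 := ((Twist.exp (α := 2 * (x i * h)) (u := Complex.exp h ^ x i)
    (by rw [Complex.exp_nat_mul]) rfl).mul (Twist.theta (p := p)
    (u := Complex.exp h ^ ((x j : ℤ) - (x i : ℤ)) * (Complex.exp (z j) / Complex.exp (z i)))
    (U := z j - z i + (x j - x i) * h) (by
      rw [← Complex.exp_int_mul, ← Complex.exp_sub, ← Complex.exp_add]
      push_cast
      rw [add_comm]))).div (Twist.theta (p := p) (u := Complex.exp (z j) / Complex.exp (z i))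
      (U := z j - z i) (by rw [Complex.exp_sub]))
  convert h1 using 1
  · ring
  · rw [one_mul]

theorem pairProd_twist (z : Fin n → ℂ) (x : Fin n → ℕ) :
    Twist (∑ i, ∑ j ∈ Finset.Ioi i, wt h (z i + z j) (x i + x j))
      (pairProd p (Complex.exp h) (fun i => Complex.exp (z i)) x)
      (∏ i, ∏ j ∈ Finset.Ioi i, sp (sigma p) h (z i + z j) (x i + x j)) := by
  unfold pairProd
  exact Twist.prod fun i _ => Twist.prod fun j _ => Twist.poch (by rw [Complex.exp_add]) _

/-- In the double product the diagonal contributes the `(h)_{x i}`, and the entries `(i, j)` and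
`(j, i)` are assigned to one unordered pair. This yields a weight symmetric in the pair, as the
shift lemmas need. -/
theorem baseWeight_eq (hs : IsSigma (sigma p)) (z : Fin n → ℂ) (x : Fin n → ℕ) :
    (∏ i, ∏ j ∈ Finset.Ioi i, sigma p (z j - z i + (x j - x i) * h) / sigma p (z j - z i))
      * (∏ i, ∏ j ∈ Finset.Ioi i, sp (sigma p) h (z i + z j) (x i + x j))
      / ∏ i, ∏ j, sp (sigma p) h (h + z i - z j) (x i) = baseWeight (sigma p) h z x := by
  have h1 := Finset.prod_prod_Ioi_mul_eq_prod_prod_off_diag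
    (fun j i => sp (sigma p) h (h + z i - z j) (x i))
  have h2 : ∀ i, ∏ j, sp (sigma p) h (h + z i - z j) (x i)
      = sp (sigma p) h h (x i) * ∏ j ∈ {i}ᶜ, sp (sigma p) h (h + z i - z j) (x i) := fun i => by
    rw [← Finset.mul_prod_erase univ _ (Finset.mem_univ i), Finset.compl_singleton,
      show h + z i - z i = h by ring]
  rw [Finset.prod_congr rfl fun i _ => h2 i, Finset.prod_mul_distrib, ← h1]
  have h3 : ∀ i j, pairWeight (sigma p) h z x i j
      = sigma p (z j - z i + (x j - x i) * h) / sigma p (z j - z i) * sp (sigma p) h (z i + z j) (x i + x j)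
        / (sp (sigma p) h (h + z i - z j) (x i) * sp (sigma p) h (h + z j - z i) (x j)) := fun i j => by
    unfold pairWeight
    rw [show z i - z j + ((x i : ℂ) - x j) * h = -(z j - z i + (x j - x i) * h) by ring, hs.odd,
      hs.sub_comm (z i) (z j)]
    rw [neg_mul, neg_mul, neg_div_neg_eq, mul_assoc, div_mul_eq_div_div]
    ring
  unfold baseWeight
  simp only [h3, Finset.prod_mul_distrib, Finset.prod_div_distrib, Finset.prod_inv_distrib]
  simp only [div_eq_mul_inv, mul_inv]
  ring

/-- The exponent of the part of the summands that depends on `z` and `x` only. -/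
theorem base_exponent (z : Fin n → ℂ) (x : Fin n → ℕ) :
    ∑ i, ∑ j ∈ Finset.Ioi i, ((x i : ℂ) + x j) * h
      + ∑ i, ∑ j ∈ Finset.Ioi i, wt h (z i + z j) (x i + x j)
      - ∑ i, ∑ j, wt h (h + z i - z j) (x i)
      = 2 * (∑ i, (x i : ℂ)) * (∑ i, z i) - 2 * ∑ i, (x i : ℂ) * z i - (∑ i, (x i : ℂ) ^ 2) * h
        + (∑ i, (x i : ℂ)) * (∑ i, (x i : ℂ) - 1) / 2 * h := by
  have e : ∀ i j, ((x i : ℂ) + x j) * h + wt h (z i + z j) (x i + x j)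
      = (x i * h + x i * z i + (x i ^ 2 - x i) / 2 * h + (x j * h + x j * z j
        + (x j ^ 2 - x j) / 2 * h)) + x i * z j + x j * z i + x i * x j * h := fun i j => by
    unfold wt; push_cast; ring
  have h1 := two_mul_sum_pairs (fun i j => ((x i : ℂ) + x j) * h + wt h (z i + z j) (x i + x j))
    (fun i j => by rw [e, e]; ring)
  have h2 : ∀ i, ∑ j, (((x i : ℂ) + x j) * h + wt h (z i + z j) (x i + x j))
      = 0 + (n * (h / 2) + ∑ j, z j + (∑ j, (x j : ℂ)) * h) * x i + (∑ j, (x j : ℂ)) * z i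
        + n * (x i * z i) + n * h / 2 * x i ^ 2 + ((∑ j, (x j : ℂ)) * (h / 2) + ∑ j, x j * z j
        + (∑ j, (x j : ℂ) ^ 2) * (h / 2)) := fun i => by
    have := sum_polynomial z (fun j => (x j : ℂ)) (x i * h + x i * z i + (x i ^ 2 - x i) / 2 * h)
      (h / 2 + z i + x i * h) (x i) 1 (h / 2)
    rw [Finset.sum_congr rfl fun j _ => show ((x i : ℂ) + x j) * h + wt h (z i + z j) (x i + x j)
      = x i * h + x i * z i + (x i ^ 2 - x i) / 2 * h + (h / 2 + z i + x i * h) * x j + x i * z j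
        + 1 * (x j * z j) + h / 2 * x j ^ 2 by rw [e]; ring, this]
    ring
  have h3 := sum_polynomial z (fun j => (x j : ℂ)) 0 (n * (h / 2) + ∑ j, z j + (∑ j, (x j : ℂ)) * h)
    (∑ j, (x j : ℂ)) n (n * h / 2)
  have h4 := sum_polynomial z (fun j => (x j : ℂ)) 0 h 0 4 (2 * h)
  have h5 : ∀ i, ((x i : ℂ) + x i) * h + wt h (z i + z i) (x i + x i)
      = 0 + h * x i + 0 * z i + 4 * (x i * z i) + 2 * h * x i ^ 2 := fun i => by
    unfold wt; push_cast; ring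
  have h6 : ∀ i, ∑ j, wt h (h + z i - z j) (x i)
      = 0 + (n * (h / 2) - ∑ j, z j) * x i + 0 * z i + n * (x i * z i) + n * h / 2 * x i ^ 2 := fun i => by
    have := sum_polynomial z (fun j => (x j : ℂ)) (x i * h + x i * z i + (x i ^ 2 - x i) / 2 * h)
      0 (-x i) 0 0
    rw [Finset.sum_congr rfl fun j _ => show wt h (h + z i - z j) (x i)
      = x i * h + x i * z i + (x i ^ 2 - x i) / 2 * h + 0 * x j + -x i * z j
        + 0 * (x j * z j) + 0 * x j ^ 2 by unfold wt; ring, this]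
    ring
  have h7 := sum_polynomial z (fun j => (x j : ℂ)) 0 (n * (h / 2) - ∑ j, z j) 0 n (n * h / 2)
  rw [Finset.sum_congr rfl fun i _ => h2 i, Finset.sum_add_distrib, h3,
    Finset.sum_congr rfl fun i _ => h5 i, h4, Finset.sum_const, Finset.card_univ, Fintype.card_fin,
    nsmul_eq_mul] at h1
  rw [Finset.sum_congr rfl fun i _ => h6 i, h7, ← Finset.sum_add_distrib,
    Finset.sum_congr rfl fun i _ => (Finset.sum_add_distrib (s := Finset.Ioi i)).symm]
  linear_combination h1 / 2

end Twist

end EllipticBailey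
end

noncomputable section

namespace EllipticBailey

open Finset

/-! ### Identification of the left-hand summands with their additive form. -/

section Exponential

variable {p h : ℂ} {n : ℕ}

theorem exp_add_nat_mul (u v : ℂ) (k : ℕ) :
    Complex.exp (u + k * v) = Complex.exp u * Complex.exp v ^ k := by
  rw [Complex.exp_add, Complex.exp_nat_mul]

theorem exp_add_succ_mul (u v : ℂ) (k : ℕ) :
    Complex.exp (u + (k + 1) * v) = Complex.exp u * Complex.exp v ^ (k + 1) := by
  rw [← exp_add_nat_mul]; push_cast; rfl

theorem exp_neg_nat_mul (v : ℂ) (k : ℕ) :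
    Complex.exp (-(k * v)) = Complex.exp v ^ (-(k : ℤ)) := by
  rw [Complex.exp_neg, Complex.exp_nat_mul, zpow_neg, zpow_natCast]

theorem leftTerm_exp (hs : IsSigma (sigma p)) {a b c d e f g : ℂ} {z : Fin n → ℂ} {N : ℕ}
    (hbal : 3 * a + (N + 2) * h = b + c + d + e + f + g + 2 * ∑ i, z i) (x : Fin n → ℕ) :
    leftTerm p (Complex.exp h) (Complex.exp a) (Complex.exp b) (Complex.exp c) (Complex.exp d)
      (Complex.exp e) (Complex.exp f) (Complex.exp g) (fun i => Complex.exp (z i)) N x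
      = leftSummand (sigma p) h a b c d e f g z N x := by
  have hxX : ∀ i, x i ≤ ∑ l, x l := fun i =>
    Finset.single_le_sum (fun _ _ => Nat.zero_le _) (Finset.mem_univ i)
  unfold leftTerm
  simp only [pochs, List.map_cons, List.map_nil, List.prod_cons, List.prod_nil, mul_one]
  set X := ∑ l, x l with hX
  have P := fun (u U : ℂ) (hu : u = Complex.exp U) (k : ℕ) => Twist.poch (p := p) (h := h) hu k
  have Q1 : ∀ t k, Twist (wt h (a + h - t) k)
      (poch p (Complex.exp h) (Complex.exp a * Complex.exp h / Complex.exp t) k)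
      (sp (sigma p) h (a + h - t) k) := fun t k => P _ _ (by rw [Complex.exp_sub, Complex.exp_add]) k
  have Q2 : ∀ t i k, Twist (wt h (t + z i) k)
      (poch p (Complex.exp h) (Complex.exp t * Complex.exp (z i)) k)
      (sp (sigma p) h (t + z i) k) := fun t i k => P _ _ (by rw [Complex.exp_add]) k
  have key := (((((deltaRatio_twist (p := p) (h := h) z x).mul (Twist.prod fun i (_ : i ∈ univ) =>
    (Twist.theta (p := p) (u := Complex.exp a * Complex.exp (z i) * Complex.exp h ^ (X + x i))
      (U := a + z i + (X + x i) * h) (by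
        rw [← Complex.exp_add, ← exp_add_nat_mul]; push_cast; rfl)).div
    (Twist.theta (p := p) (u := Complex.exp a * Complex.exp (z i)) (U := a + z i)
      (by rw [Complex.exp_add])))).mul
    ((pairProd_twist (p := p) (h := h) z x).div (Twist.prod fun i (_ : i ∈ univ) =>
      Q1 (z i) (X - x i)))).mul
    ((((P (Complex.exp h ^ (-(N : ℤ))) (-(N * h)) (by rw [exp_neg_nat_mul]) X).mul
      (P _ b rfl X)).mul (Twist.prod fun i (_ : i ∈ univ) => Q2 a i X)).div
      ((Q1 c X).mul ((Q1 d X).mul ((Q1 e X).mul ((Q1 f X).mul (Q1 g X))))))).mul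
    (Twist.exp (u := Complex.exp h ^ X) (w := X * h) (by rw [Complex.exp_nat_mul]) rfl)).mul
    (Twist.prod fun i (_ : i ∈ univ) => ((Q2 c i (x i)).mul ((Q2 d i (x i)).mul ((Q2 e i (x i)).mul
      ((Q2 f i (x i)).mul (Q2 g i (x i)))))).div
      (((P (Complex.exp a * Complex.exp h ^ (N + 1) * Complex.exp (z i)) (a + (N + 1) * h + z i)
        (by rw [Complex.exp_add, exp_add_succ_mul]) (x i)).mul
        (P (Complex.exp a * Complex.exp h * Complex.exp (z i) / Complex.exp b) (a + h - b + z i)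
        (by rw [← Complex.exp_add, ← Complex.exp_add, ← Complex.exp_sub]; congr 1; ring) (x i))).mul
        (Twist.prod fun j (_ : j ∈ univ) =>
          P (Complex.exp h * Complex.exp (z i) / Complex.exp (z j)) (h + z i - z j)
            (by rw [Complex.exp_sub, Complex.exp_add]) (x i))))
  refine (key.eq ?_).trans ?_
  · clear key
    have hbase := base_exponent (h := h) z x
    -- The moments `∑ x i * z i` and `∑ (x i)^2` appear here with signs opposite to those in
    -- `base_exponent`. What is left is a multiple of the balancing condition.
    have hsum := sum_polynomial z (fun j => (x j : ℂ)) 0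
      (-a + X * h - (N + 2) * h + (b + c + d + e + f + g)) (2 * X) 2 h
    have hpoly : ∀ i, (a + z i + (X + x i) * h - (a + z i)) - wt h (a + h - z i) (X - x i)
        + wt h (a + z i) X + (wt h (c + z i) (x i) + (wt h (d + z i) (x i) + (wt h (e + z i) (x i)
          + (wt h (f + z i) (x i) + wt h (g + z i) (x i))))
          - (wt h (a + (N + 1) * h + z i) (x i) + wt h (a + h - b + z i) (x i)))
        = 0 + (-a + X * h - (N + 2) * h + (b + c + d + e + f + g)) * x i + 2 * X * z i
          + 2 * (x i * z i) + h * x i ^ 2 := fun i => by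
      unfold wt
      rw [Nat.cast_sub (hxX i)]
      ring
    rw [← Finset.sum_congr rfl fun i _ => hpoly i] at hsum
    have hXc : ∑ i, (x i : ℂ) = X := by rw [hX]; push_cast; rfl
    rw [hXc] at hsum hbase
    simp only [Finset.sum_add_distrib, Finset.sum_sub_distrib] at hsum hbase ⊢
    have w : ∀ u, wt h u X = X * u + X * (X - 1) / 2 * h := fun _ => rfl
    simp only [w (-(N * h)), w b, w (a + h - c), w (a + h - d), w (a + h - e), w (a + h - f),
      w (a + h - g)]
    linear_combination hsum + hbase - 2 * X * hbal
  · rw [mul_one]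
    unfold leftSummand coreWeight wellPoised upFac downFac
    rw [← hX, ← baseWeight_eq hs]
    simp only [Finset.prod_mul_distrib, Finset.prod_div_distrib]
    rw [show a + h - (a + (N + 1) * h) = -(N * h) by ring, show a + h - (a + h - b) = b by ring]
    simp only [div_eq_mul_inv, mul_inv]
    ring

end Exponential

end EllipticBailey
end

noncomputable section

namespace EllipticBailey

open Finset

/-! ### Identification of the right-hand summands with their additive form. -/

section ExponentialRight

variable {p h : ℂ} {n : ℕ}

/-- Both parities carry the same exponent once balancing is used; for odd `n` the factor `(a / lam)
^ N` makes up the difference. -/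
theorem parityFactor_twist {a e f g lam Z : ℂ} {N : ℕ}
    (hb : a + (N + 1) * h + lam = e + f + g + 2 * Z) (X : ℕ) :
    Twist (N * (3 * a + lam + 4 * h - 4 * Z - (e + f + g)) + 2 * N * (N - 1) * h
        - X * (2 * lam - 2 * a - 2 * N * h + 2 * X * h))
      (parityFactor p (Complex.exp h) (Complex.exp a) (Complex.exp lam) (Complex.exp e)
        (Complex.exp f) (Complex.exp g) (Complex.exp Z) n N X)
      (parityNum (sigma p) h a e f g lam Z n N / parityDen (sigma p) h a e f g lam Z n N X) := by
  have P := fun (u U : ℂ) (hu : u = Complex.exp U) (k : ℕ) => Twist.poch (p := p) (h := h) hu k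
  have Q1 : ∀ a t k, Twist (wt h (a + h - t) k)
      (poch p (Complex.exp h) (Complex.exp a * Complex.exp h / Complex.exp t) k)
      (sp (sigma p) h (a + h - t) k) := fun a t k => P _ _ (by rw [Complex.exp_sub, Complex.exp_add]) k
  have Q2 : ∀ a t k, Twist (wt h (a + h - t - Z) k)
      (poch p (Complex.exp h) (Complex.exp a * Complex.exp h / (Complex.exp t * Complex.exp Z)) k)
      (sp (sigma p) h (a + h - t - Z) k) := fun a t k => P _ _ (by
        rw [← Complex.exp_add, ← Complex.exp_add, ← Complex.exp_sub]; congr 1; ring) k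
  have Q3 : ∀ t u k, Twist (wt h (lam + h - t - u - Z) k)
      (poch p (Complex.exp h) (Complex.exp lam * Complex.exp h
        / (Complex.exp t * Complex.exp u * Complex.exp Z)) k)
      (sp (sigma p) h (lam + h - t - u - Z) k) := fun t u k => P _ _ (by
        rw [← Complex.exp_add, ← Complex.exp_add, ← Complex.exp_add, ← Complex.exp_sub]
        congr 1; ring) k
  unfold parityFactor parityNum parityDen
  simp only [pochs, List.map_cons, List.map_nil, List.prod_cons, List.prod_nil, mul_one]
  split_ifs
  · have key := (Twist.exp (u := (Complex.exp a / Complex.exp lam) ^ N) (w := N * (a - lam))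
      (by rw [Complex.exp_nat_mul, Complex.exp_sub]) rfl).mul
      (((Q1 a Z N).mul ((Q2 lam e N).mul ((Q2 lam f N).mul (Q2 lam g N)))).div
      ((P (Complex.exp h ^ (-(N : ℤ)) * Complex.exp Z / Complex.exp a) (-(N * h) + Z - a)
        (by rw [Complex.exp_sub, Complex.exp_add, exp_neg_nat_mul]) X).mul
        ((Q2 lam e X).mul ((Q2 lam f X).mul (Q2 lam g X)))))
    convert key using 1
    · unfold wt
      linear_combination (X : ℂ) * hb
    · rw [one_mul, mul_assoc (sp (sigma p) h (lam + h - e - Z) N),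
        mul_assoc (sp (sigma p) h (lam + h - e - Z) X)]
  · have key := ((Q1 lam Z N).mul ((Q2 a e N).mul ((Q2 a f N).mul (Q2 a g N)))).div
      ((Q1 lam Z X).mul ((Q3 e f X).mul ((Q3 e g X).mul (Q3 f g X))))
    convert key using 1
    · unfold wt
      linear_combination (2 * X : ℂ) * hb
    · rw [mul_assoc (sp (sigma p) h (a + h - e - Z) N),
        mul_assoc (sp (sigma p) h (lam + h - e - f - Z) X)]

theorem prefactor_mul_rightTerm_exp (hs : IsSigma (sigma p)) {a b c d e f g lam : ℂ} {z : Fin n → ℂ}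
    {N : ℕ} (hb : a + (N + 1) * h + lam = e + f + g + 2 * ∑ i, z i)
    (hcd : c + d = 2 * a + h - b - lam) (x : Fin n → ℕ) :
    prefactor p (Complex.exp h) (Complex.exp a) (Complex.exp e) (Complex.exp f) (Complex.exp g)
        (Complex.exp lam) (fun i => Complex.exp (z i)) N
      * rightTerm p (Complex.exp h) (Complex.exp a) (Complex.exp b) (Complex.exp c) (Complex.exp d)
        (Complex.exp e) (Complex.exp f) (Complex.exp g) (Complex.exp lam) (fun i => Complex.exp (z i))
        N x
      = rightConst (sigma p) h a e f g lam z N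
        * rightSummand (sigma p) h a b c d e f g lam z N x := by
  have hxX : ∀ i, x i ≤ ∑ l, x l := fun i =>
    Finset.single_le_sum (fun _ _ => Nat.zero_le _) (Finset.mem_univ i)
  unfold prefactor rightTerm
  simp only [pochs, List.map_cons, List.map_nil, List.prod_cons, List.prod_nil, mul_one]
  rw [← Complex.exp_sum]
  set X := ∑ l, x l with hX
  have P := fun (u U : ℂ) (hu : u = Complex.exp U) (k : ℕ) => Twist.poch (p := p) (h := h) hu k
  have Q1 : ∀ t k, Twist (wt h (a + h - t) k)
      (poch p (Complex.exp h) (Complex.exp a * Complex.exp h / Complex.exp t) k)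
      (sp (sigma p) h (a + h - t) k) := fun t k => P _ _ (by rw [Complex.exp_sub, Complex.exp_add]) k
  have Q2 : ∀ t i k, Twist (wt h (t + z i) k)
      (poch p (Complex.exp h) (Complex.exp t * Complex.exp (z i)) k)
      (sp (sigma p) h (t + z i) k) := fun t i k => P _ _ (by rw [Complex.exp_add]) k
  have Q3 : ∀ i k, Twist (wt h (lam + b - a - z i) k)
      (poch p (Complex.exp h) (Complex.exp lam * Complex.exp b / (Complex.exp a * Complex.exp (z i))) k)
      (sp (sigma p) h (lam + b - a - z i) k) := fun i k => P _ _ (by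
        rw [← Complex.exp_add, ← Complex.exp_add, ← Complex.exp_sub]; congr 1; ring) k
  have Q4 : ∀ t k, Twist (wt h (lam + t - a) k)
      (poch p (Complex.exp h) (Complex.exp lam * Complex.exp t / Complex.exp a) k)
      (sp (sigma p) h (lam + t - a) k) := fun t k => P _ _ (by rw [Complex.exp_sub, Complex.exp_add]) k
  have Qq : ∀ k, Twist (wt h (-(N * h)) k)
      (poch p (Complex.exp h) (Complex.exp h ^ (-(N : ℤ))) k)
      (sp (sigma p) h (-(N * h)) k) := fun k => P _ _ (by rw [exp_neg_nat_mul]) k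
  have pre := ((Twist.exp (u := Complex.exp (∑ i, z i) ^ N) (w := N * ∑ i, z i)
    (by rw [Complex.exp_nat_mul]) rfl).mul (Twist.prod fun i (_ : i ∈ univ) =>
      P (Complex.exp a * Complex.exp h * Complex.exp (z i)) (a + h + z i)
        (by rw [Complex.exp_add, Complex.exp_add]) N)).div
    (((P (Complex.exp lam * Complex.exp h) (lam + h) (by rw [Complex.exp_add]) N).mul
      ((Q1 e N).mul ((Q1 f N).mul (Q1 g N)))).mul (Twist.prod fun i (_ : i ∈ univ) => Q1 (z i) N))
  have key := pre.mul (((((((deltaRatio_twist (p := p) (h := h) z x).mul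
    ((Twist.theta (p := p) (u := Complex.exp lam * Complex.exp h ^ (2 * X)) (U := lam + 2 * X * h) (by
      rw [← exp_add_nat_mul]; push_cast; rfl)).div
    (Twist.theta (p := p) (u := Complex.exp lam) rfl))).mul
    ((pairProd_twist (p := p) (h := h) z x).div (Twist.prod fun i (_ : i ∈ univ) =>
      Q3 i (X - x i)))).mul
    ((((P (Complex.exp lam) lam rfl X).mul ((Qq X).mul ((Q4 c X).mul (Q4 d X)))).mul
      (Twist.prod fun i (_ : i ∈ univ) => Q3 i X)).div
      ((P (Complex.exp lam * Complex.exp h ^ (N + 1)) (lam + (N + 1) * h)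
        (by rw [exp_add_succ_mul]) X).mul ((Q1 c X).mul (Q1 d X))))).mul
    (Twist.exp (u := Complex.exp h ^ X) (w := X * h) (by rw [Complex.exp_nat_mul]) rfl)).mul
    (Twist.prod fun i (_ : i ∈ univ) => ((Q2 e i (x i)).mul ((Q2 f i (x i)).mul ((Q2 g i (x i)).mul
      (P (Complex.exp h ^ (-(N : ℤ)) * Complex.exp (z i) / Complex.exp a) (-(N * h) - a + z i)
        (by rw [← exp_neg_nat_mul, ← Complex.exp_add, ← Complex.exp_sub]; congr 1; ring) (x i))))).div
      ((P (Complex.exp a * Complex.exp h * Complex.exp (z i) / Complex.exp b) (a + h - b + z i)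
        (by rw [← Complex.exp_add, ← Complex.exp_add, ← Complex.exp_sub]; congr 1; ring) (x i)).mul
        (Twist.prod fun j (_ : j ∈ univ) =>
          P (Complex.exp h * Complex.exp (z i) / Complex.exp (z j)) (h + z i - z j)
            (by rw [Complex.exp_sub, Complex.exp_add]) (x i))))).mul
    (parityFactor_twist (p := p) (n := n) hb X))
  refine (key.eq ?_).trans ?_
  · clear key pre
    have hbase := base_exponent (h := h) z x
    have hsum := sum_polynomial z (fun j => (x j : ℂ)) 0
      (lam + 2 * b - 3 * a + X * h - (N + 3) * h + (e + f + g)) 0 2 h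
    have hpoly : ∀ i, -wt h (lam + b - a - z i) (X - x i)
        + wt h (lam + b - a - z i) X + (wt h (e + z i) (x i) + (wt h (f + z i) (x i)
          + (wt h (g + z i) (x i) + wt h (-(N * h) - a + z i) (x i))) - wt h (a + h - b + z i) (x i))
        = 0 + (lam + 2 * b - 3 * a + X * h - (N + 3) * h + (e + f + g)) * x i + 0 * z i
          + 2 * (x i * z i) + h * x i ^ 2 := fun i => by
      unfold wt
      rw [Nat.cast_sub (hxX i)]
      ring
    -- The products of `(a + h ± z i)_N` contribute `2 N ∑ z i`. Together with the same amount from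
    -- `Z ^ N` this offsets the `-4 N Z` in the parity factor.
    have hsum2 := sum_polynomial z (fun j => (x j : ℂ)) 0 0 (2 * N) 0 0
    have hpoly2 : ∀ i, wt h (a + h + z i) N - wt h (a + h - z i) N
        = 0 + 0 * x i + 2 * N * z i + 0 * (x i * z i) + 0 * x i ^ 2 := fun i => by
      unfold wt; ring
    rw [← Finset.sum_congr rfl fun i _ => hpoly i] at hsum
    rw [← Finset.sum_congr rfl fun i _ => hpoly2 i] at hsum2
    have hXc : ∑ i, (x i : ℂ) = X := by rw [hX]; push_cast; rfl
    rw [hXc] at hsum hsum2 hbase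
    simp only [Finset.sum_add_distrib, Finset.sum_sub_distrib, Finset.sum_neg_distrib]
      at hsum hsum2 hbase ⊢
    have w : ∀ u, wt h u X = X * u + X * (X - 1) / 2 * h := fun _ => rfl
    have w' : ∀ u, wt h u N = N * u + N * (N - 1) / 2 * h := fun _ => rfl
    simp only [w (-(N * h)), w lam, w (a + h - c), w (a + h - d), w (lam + c - a), w (lam + d - a),
      w (lam + (N + 1) * h), w' (lam + h), w' (a + h - e), w' (a + h - f), w' (a + h - g)]
    linear_combination hsum + hsum2 + hbase + 2 * X * hcd - X * hb
  · rw [one_mul, mul_one]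
    unfold rightConst rightSummand complFac vertexFac radialFac cdFac
    rw [← hX, ← baseWeight_eq hs]
    simp only [Finset.prod_mul_distrib, Finset.prod_div_distrib]
    simp only [div_eq_mul_inv, mul_inv]
    ring

end ExponentialRight

/-! ### Transfer of the non-vanishing conditions. -/

section Regularity

variable {p h : ℂ} {n : ℕ}

theorem theta_exp_ne_zero_iff (U : ℂ) : theta p (Complex.exp U) ≠ 0 ↔ sigma p U ≠ 0 := by
  rw [theta_exp]
  simp [Complex.exp_ne_zero]

theorem poch_exp_ne_zero_iff {u U : ℂ} (hu : u = Complex.exp U) (k : ℕ) :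
    poch p (Complex.exp h) u k ≠ 0 ↔ sp (sigma p) h U k ≠ 0 := by
  have := Twist.poch (p := p) (h := h) hu k
  unfold Twist at this
  rw [this]
  simp [Complex.exp_ne_zero]

end Regularity

end EllipticBailey
end

/-! ### Return to multiplicative variables. -/

open EllipticBailey
theorem theorem4p1 (n N : ℕ) (p q a b c d e f g lam : ℂ) (z : Fin n → ℂ)
    (hp : ‖p‖ < 1) (hq : q ≠ 0) (ha : a ≠ 0)
    (hbal : a ^ 3 * q ^ (N + 2) = b * c * d * e * f * g * (∏ i, z i) ^ 2)
    (hlam : lam = a ^ 2 * q / (b * c * d))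
    -- all remaining hypotheses: no denominator in the two sides vanishes
    (hzz : ∀ i j, i < j → theta p (z j / z i) ≠ 0)
    (haz : ∀ i, theta p (a * z i) ≠ 0)
    (hl : theta p lam ≠ 0)
    (hN : pochs p q [a * q / c, a * q / d, a * q / e, a * q / f, a * q / g,
      lam * q, lam * q ^ (N + 1)] N ≠ 0)
    (hi : ∀ i, pochs p q [a * q / z i, a * q ^ (N + 1) * z i, a * q * z i / b] N ≠ 0)
    (hij : ∀ i j, poch p q (q * z i / z j) N ≠ 0)
    (hlb : ∀ x ∈ simplex n N, ∀ i, poch p q (lam * b / (a * z i)) ((∑ k, x k) - x i) ≠ 0)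
    (hodd : Odd n → pochs p q [q ^ (-(N : ℤ)) * (∏ i, z i) / a, lam * q / (e * ∏ i, z i),
      lam * q / (f * ∏ i, z i), lam * q / (g * ∏ i, z i)] N ≠ 0)
    (heven : Even n → pochs p q [lam * q / ∏ i, z i, lam * q / (e * f * ∏ i, z i),
      lam * q / (e * g * ∏ i, z i), lam * q / (f * g * ∏ i, z i)] N ≠ 0) :
    ∑ x ∈ simplex n N, leftTerm p q a b c d e f g z N x
      = prefactor p q a e f g lam z N
        * ∑ x ∈ simplex n N, rightTerm p q a b c d e f g lam z N x := by
  have hs := isSigma_sigma hp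
  -- As `a` and `q` are non-zero, balancing implies that all other parameters are non-zero too, so
  -- logarithms exist.
  have h0 : b * c * d * e * f * g * (∏ i, z i) ^ 2 ≠ 0 := by
    rw [← hbal]; exact mul_ne_zero (pow_ne_zero _ ha) (pow_ne_zero _ hq)
  simp only [mul_ne_zero_iff, ne_eq, not_false_eq_true, pow_eq_zero_iff, OfNat.ofNat_ne_zero,
    Finset.prod_eq_zero_iff, not_exists, not_and, Finset.mem_univ, true_implies] at h0
  obtain ⟨⟨⟨⟨⟨⟨hb0, hc0⟩, hd0⟩, he0⟩, hf0⟩, hg0⟩, hz0⟩ := h0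
  obtain ⟨h, rfl⟩ : ∃ h, q = Complex.exp h := ⟨_, (Complex.exp_log hq).symm⟩
  obtain ⟨A, rfl⟩ : ∃ h, a = Complex.exp h := ⟨_, (Complex.exp_log ha).symm⟩
  obtain ⟨B, rfl⟩ : ∃ h, b = Complex.exp h := ⟨_, (Complex.exp_log hb0).symm⟩
  obtain ⟨C, rfl⟩ : ∃ h, c = Complex.exp h := ⟨_, (Complex.exp_log hc0).symm⟩
  obtain ⟨D, rfl⟩ : ∃ h, d = Complex.exp h := ⟨_, (Complex.exp_log hd0).symm⟩
  obtain ⟨E, rfl⟩ : ∃ h, e = Complex.exp h := ⟨_, (Complex.exp_log he0).symm⟩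
  obtain ⟨F, rfl⟩ : ∃ h, f = Complex.exp h := ⟨_, (Complex.exp_log hf0).symm⟩
  obtain ⟨ζ, rfl⟩ : ∃ ζ : Fin n → ℂ, z = fun i => Complex.exp (ζ i) :=
    ⟨fun i => Complex.log (z i), funext fun i => (Complex.exp_log (hz0 i)).symm⟩
  -- Principal logarithms would be balanced only modulo `2πi`. Logarithms of `lam` and `g` are
  -- therefore defined by the additive balancing conditions, and shown afterwards to exponentiate
  -- correctly.
  obtain ⟨L, hL⟩ : ∃ L, L = 2 * A + h - B - C - D := ⟨_, rfl⟩
  obtain ⟨G, hG⟩ : ∃ G, G = A + (N + 1) * h + L - E - F - 2 * ∑ i, ζ i := ⟨_, rfl⟩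
  have hlam' : lam = Complex.exp L := by
    rw [hlam, ← Complex.exp_nat_mul, ← Complex.exp_add, ← Complex.exp_add, ← Complex.exp_add,
      ← Complex.exp_sub, hL]
    congr 1
    push_cast
    ring
  have hg' : g = Complex.exp G := by
    have hne : Complex.exp (B + C + D + E + F + 2 * ∑ i, ζ i) ≠ 0 := Complex.exp_ne_zero _
    refine mul_left_cancel₀ hne ?_
    rw [← Complex.exp_add, show B + C + D + E + F + 2 * ∑ i, ζ i + G = (3 : ℕ) * A + (N + 2 : ℕ) * h by
      rw [hG, hL]; push_cast; ring, Complex.exp_add (((3 : ℕ) : ℂ) * A), Complex.exp_nat_mul, Complex.exp_nat_mul, hbal,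
      ← Complex.exp_sum]
    simp only [Complex.exp_add, two_mul]
    ring
  subst hlam' hg'
  clear hlam hbal
  simp only [pochs, List.map_cons, List.map_nil, List.prod_cons, List.prod_nil, mul_one,
    mul_ne_zero_iff, ← Complex.exp_sum] at hN hi hodd heven
  have K := fun (u U : ℂ) (hu : u = Complex.exp U) (k : ℕ) =>
    (poch_exp_ne_zero_iff (p := p) (h := h) hu k).1
  have R : BaileyRegular (sigma p) h A B C D E F G L ζ N := by
    refine ⟨fun i j hij' => ?_, fun i => ?_, (theta_exp_ne_zero_iff L).1 hl, ?_, ?_, ?_, ?_, ?_, ?_, ?_,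
      fun i => ?_, fun i => ?_, fun i => ?_, fun i j => ?_, fun x hx i => ?_, ?_⟩
    · rcases lt_or_gt_of_ne hij' with h1 | h1
      · have := hzz i j h1
        rw [← Complex.exp_sub, theta_exp_ne_zero_iff] at this
        rw [hs.sub_comm]
        exact neg_ne_zero.2 this
      · have := hzz j i h1
        rwa [← Complex.exp_sub, theta_exp_ne_zero_iff] at this
    · have := haz i
      rwa [← Complex.exp_add, theta_exp_ne_zero_iff] at this
    · exact K _ _ (by rw [Complex.exp_sub, Complex.exp_add]) _ hN.1
    · exact K _ _ (by rw [Complex.exp_sub, Complex.exp_add]) _ hN.2.1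
    · exact K _ _ (by rw [Complex.exp_sub, Complex.exp_add]) _ hN.2.2.1
    · exact K _ _ (by rw [Complex.exp_sub, Complex.exp_add]) _ hN.2.2.2.1
    · exact K _ _ (by rw [Complex.exp_sub, Complex.exp_add]) _ hN.2.2.2.2.1
    · exact K _ _ (by rw [Complex.exp_add]) _ hN.2.2.2.2.2.1
    · exact K _ _ (by rw [exp_add_succ_mul]) _ hN.2.2.2.2.2.2
    · exact K _ _ (by rw [Complex.exp_sub, Complex.exp_add]) _ (hi i).1
    · exact K _ _ (by rw [Complex.exp_add, exp_add_succ_mul]) _ (hi i).2.1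
    · exact K _ _ (by
        rw [← Complex.exp_add, ← Complex.exp_add, ← Complex.exp_sub]; congr 1; ring) _ (hi i).2.2
    · exact K _ _ (by rw [Complex.exp_sub, Complex.exp_add]) _ (hij i j)
    · exact K _ _ (by
        rw [← Complex.exp_add, ← Complex.exp_add, ← Complex.exp_sub]; congr 1; ring) _ (hlb x hx i)
    · have K2 : ∀ t, poch p (Complex.exp h) (Complex.exp L * Complex.exp h
          / (Complex.exp t * Complex.exp (∑ i, ζ i))) N ≠ 0
          → sp (sigma p) h (L + h - t - ∑ i, ζ i) N ≠ 0 := fun t => K _ _ (by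
        rw [← Complex.exp_add, ← Complex.exp_add, ← Complex.exp_sub]; congr 1; ring) _
      have K3 : ∀ t u, poch p (Complex.exp h) (Complex.exp L * Complex.exp h
          / (Complex.exp t * Complex.exp u * Complex.exp (∑ i, ζ i))) N ≠ 0
          → sp (sigma p) h (L + h - t - u - ∑ i, ζ i) N ≠ 0 := fun t u => K _ _ (by
        rw [← Complex.exp_add, ← Complex.exp_add, ← Complex.exp_add, ← Complex.exp_sub]
        congr 1; ring) _
      unfold parityDen
      split_ifs with hn
      · obtain ⟨k1, k2, k3, k4⟩ := hodd hn
        exact mul_ne_zero (K _ _ (by rw [Complex.exp_sub, Complex.exp_add, exp_neg_nat_mul]) _ k1)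
          (mul_ne_zero (mul_ne_zero (K2 _ k2) (K2 _ k3)) (K2 _ k4))
      · obtain ⟨k1, k2, k3, k4⟩ := heven (Nat.not_odd_iff_even.1 hn)
        exact mul_ne_zero (K _ _ (by rw [Complex.exp_sub, Complex.exp_add]) _ k1)
          (mul_ne_zero (mul_ne_zero (K3 _ _ k2) (K3 _ _ k3)) (K3 _ _ k4))
  have hb : A + (N + 1) * h + L = E + F + G + 2 * ∑ i, ζ i := by rw [hG]; ring
  have hcd : C + D = 2 * A + h - B - L := by rw [hL]; ring
  rw [Finset.sum_congr rfl fun x _ => leftTerm_exp hs (by linear_combination hb - hcd) x,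
    bailey_additive hs R hb hcd, Finset.mul_sum, Finset.mul_sum]
  exact Finset.sum_congr rfl fun x _ => (prefactor_mul_rightTerm_exp hs hb hcd x).symm
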